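/- **Setting.** There are $N\ge 2$ sellers, each owning one item, with private values $v_i$ drawn independently from a distribution on $[0,1]$ that has a density and a CDF $F$ which is strictly increasing on $[0,r]$. Here $r\in(0,1]$ is the reserve price of a first-price procurement auction: the lowest bid that does not exceed $r$ wins and is paid its bid. A speculator offers each seller a fixed price $p\in[0,r]$ for his item. The sellers simultaneously accept (payoff $p-v_i$) or reject. Then the auction takes place among the $m$ sellers who rejected and, if $m<N$, the speculator, who submits one bid and has value $0$. The pair $(m,S)$, where $S\in\{0,1\}$ tells whether the speculator participates, is publicly announced. A winner with bid $b$ and value $v$ gets $b-v$, a loser gets $0$. A tie among sellers is broken by a fair lottery; if the speculator ties with $k$ sellers he wins with probability $\tau_k\in[0,1]$, and otherwise these sellers share the win equally. A symmetric perfect Bayesian equilibrium (PBE) consists of a (possibly mixed) acceptance and bidding strategy common to all sellers, a (possibly mixed) bid of the speculator for each $m<N$, and common beliefs, independent across sellers, about the values of the sellers in the auction at each history. Beliefs obey Bayes' rule at all histories reached with positive probability; every type of seller and the speculator act optimally at every history. *Undominated bidding* means that in the auction no bidder ever bids below his value. For $c\in[0,r]$ and $m\ge1$ let $$G(x;c)=\frac{F(x)-F(c)}{1-F(c)},\qquad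 \underline b(m,c)=\max_{c\le b\le r} b[1-G(b;c)]^m,\qquad \bar b(m,c)=\min\Big(\arg\max_{c\le b\le r} b[1-G(b;c)]^m\Big),$$ with the convention $G(c;c)=0$ also when $F(c)=1$ (which is possible only for $c=r$). Let $\pi_0=\int_0^r[1-F(x)]^{N-1}dx$. Define $v^\star(p)=0$ if $p\le\pi_0$, and, if $\pi_0<p\le r$, let $v^\star(p)\in[0,r]$ be the unique solution $c$ of $$p-c=\int_c^r[1-F(x)]^{N-1}dx+\sum_{m=0}^{N-2}\binom{N-1}{m}[1-F(c)]^m[F(c)]^{N-1-m}\,[\underline b(m+1,c)-c].$$ **Proposition.** Fix $p\in[0,r]$. Then $v^\star(p)$ is well defined (the solution exists and is unique), and, writing $c=v^\star(p)$: (i) For every tie-breaking rule $\tau$, in every symmetric PBE with undominated bidding a seller accepts the offer if and only if $v_i<c$, up to a set of values of probability $0$. (ii) Suppose $F(c)<1$ (this fails only if $p=r$ and $F(r)=1$, when $G(\cdot;c)$ is undefined), and let the speculator lose ties against sellers ($\tau\equiv0$). Then a strategy profile of the following form exists, and every such profile, with the belief that the values of the sellers in the auction are independently distributed according to $G(\cdot;c)$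 at every history, is a symmetric PBE with undominated bidding. - A seller accepts if and only if $v_i<c$. - If $1\le m\le N-1$ sellers are in the auction, a seller of value $v\ge c$ bids $$\beta(v)=\begin{cases}\underline b(m,c)/[1-G(v;c)]^m,& c\le v\le\bar b(m,c),\\ v,& v>\bar b(m,c),\end{cases}$$ and the speculator's bid is distributed on $[\underline b(m,c),\bar b(m,c)]$ with CDF, at $b\in[\underline b(m,c),\bar b(m,c))$, $$\Psi(b)=1-\exp\left\{-\int_c^{\beta^{-1}(b)}\frac{\beta(x)+(m-1)x}{[\beta(x)-x][1-G(x;c)]}\,dG(x;c)\right\}$$ (any remaining probability is placed on $\bar b(m,c)$). - If all sellers sold, the speculator bids $r$. - If no seller sold, a seller of value $v\ge c$ bids as in the standard symmetric first-price auction: $v+\int_v^r[1-G(x;c)]^{N-1}dx\,/\,[1-G(v;c)]^{N-1}$ if $v\le r$ (read as $r$ when $v=r$), and $v$ if $v>r$. - A seller with $v<c$ who nevertheless rejected bids like a seller of value $c$. -/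

import Mathlib

open MeasureTheory ProbabilityTheory Set

noncomputable section

namespace FPASpeculation

/-! ### The first-price procurement auction

The lowest bid not exceeding the reserve price `r` wins and is paid its bid. A tie among sellers is
broken by a fair lottery; if the speculator ties with `k ≥ 1` sellers, he wins with
probability `τ k` and otherwise the tied sellers share the win equally. -/

/-- Probability that a seller with bid `b` wins against `k` other sellers with bids `x`, when the
speculator does not bid. -/
def sellerShare (r b : ℝ) {k : ℕ} (x : Fin k → ℝ) : ℝ :=
  if b ≤ r ∧ ∀ j, b ≤ x j then
    1 / (((Finset.univ.filter fun j => x j = b).card : ℝ) + 1)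
  else 0

/-- Probability that a seller with bid `b` wins against `k` other sellers with bids `x` and the
speculator's bid `s`. -/
def sellerShareSpec (r : ℝ) (τ : ℕ → ℝ) (b : ℝ) {k : ℕ} (x : Fin k → ℝ) (s : ℝ) : ℝ :=
  if b < s then sellerShare r b x
  else if b = s then
    (1 - τ ((Finset.univ.filter fun j => x j = b).card + 1)) * sellerShare r b x
  else 0

/-- Probability that the speculator wins with bid `s` against `m` sellers with bids `x`. -/
def specShare (r : ℝ) (τ : ℕ → ℝ) (s : ℝ) {m : ℕ} (x : Fin m → ℝ) : ℝ :=
  if s ≤ r ∧ ∀ j, s ≤ x j then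
    (if (Finset.univ.filter fun j => x j = s).card = 0 then 1
     else τ (Finset.univ.filter fun j => x j = s).card)
  else 0

/-! ### The two-stage game for a fixed acquisition price `p`

A public history is the pair `(m, S)` of the number of sellers who kept their item and the
speculator's status. As `S = 1` exactly when at least one seller sold, i.e. `m < N`, the history
is encoded by `m ∈ {0, …, N}`. -/

/-- A symmetric (behavioural) strategy profile. -/
structure Profile where
  /-- probability with which a seller of value `v` accepts the speculator's offer -/
  accept : ℝ → ℝ
  /-- law of the bid of a seller of value `v` when `m` sellers are in the auction -/
  bid : ℕ → Kernel ℝ ℝ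
  /-- law of the speculator's bid against `m < N` sellers -/
  spec : ℕ → Measure ℝ

variable (N : ℕ) (r p : ℝ) (μ : Measure ℝ) (τ : ℕ → ℝ) (σ : Profile) (bel : ℕ → Measure ℝ)

/-- Ex-ante probability that a given seller accepts. -/
def accProb : ℝ := ∫ v, σ.accept v ∂μ

/-- Ex-ante probability that a given seller rejects. -/
def rejProb : ℝ := ∫ v, (1 - σ.accept v) ∂μ

/-- Law of a seller's value conditional on his rejecting the offer (Bayes' rule). -/
def posterior : Measure ℝ :=
  (∫⁻ v, ENNReal.ofReal (1 - σ.accept v) ∂μ)⁻¹ •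
    μ.withDensity (fun v => ENNReal.ofReal (1 - σ.accept v))

/-- Law of a seller's bid at history `m`, as expected by the other bidders. Here `bel m` is the
common belief about the value of each seller in the auction, independent across sellers. -/
def bidLaw (m : ℕ) : Measure ℝ := (bel m).bind (σ.bid m)

/-- Winning probability of a seller who bids `b` at history `m` (against `m - 1` other sellers, and
against the speculator if `m < N`). -/
def sellerWin (m : ℕ) (b : ℝ) : ℝ :=
  if m < N then
    ∫ s, (∫ x : Fin (m - 1) → ℝ, sellerShareSpec r τ b x s
      ∂(Measure.pi fun _ => bidLaw σ bel m)) ∂(σ.spec m)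
  else
    ∫ x : Fin (m - 1) → ℝ, sellerShare r b x ∂(Measure.pi fun _ => bidLaw σ bel m)

/-- Expected auction payoff of a seller of value `v` who bids `b` at history `m`. -/
def sellerPayoff (m : ℕ) (v b : ℝ) : ℝ := (b - v) * sellerWin N r τ σ bel m b

/-- Expected auction payoff of a seller of value `v` who follows the profile at history `m`. -/
def sellerValue (m : ℕ) (v : ℝ) : ℝ := ∫ b, sellerPayoff N r τ σ bel m v b ∂(σ.bid m v)

/-- Expected auction payoff of the speculator from the bid `b` against `m` sellers. -/
def specPayoff (m : ℕ) (b : ℝ) : ℝ :=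
  b * ∫ x : Fin m → ℝ, specShare r τ b x ∂(Measure.pi fun _ => bidLaw σ bel m)

/-- Expected payoff of a seller of value `v` from rejecting the offer: if `k` of the `N - 1` other
sellers reject too, the history is `k + 1`. -/
def rejectValue (v : ℝ) : ℝ :=
  ∑ k ∈ Finset.range (N - 1), ((N - 1).choose k : ℝ) * rejProb μ σ ^ k *
      accProb μ σ ^ (N - 1 - k) * sellerValue N r τ σ bel (k + 1) v
    + rejProb μ σ ^ (N - 1) * sellerValue N r τ σ bel N v

/-- Symmetric perfect Bayesian equilibrium: the profile `σ` with beliefs `bel`. -/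
structure IsSymmetricPBE : Prop where
  accept_measurable : Measurable σ.accept
  accept_mem : ∀ v ∈ Icc (0 : ℝ) 1, σ.accept v ∈ Icc (0 : ℝ) 1
  bid_markov : ∀ m ∈ Icc 1 N, IsMarkovKernel (σ.bid m)
  spec_prob : ∀ m < N, IsProbabilityMeasure (σ.spec m)
  bel_prob : ∀ m ∈ Icc 1 N, IsProbabilityMeasure (bel m)
  bel_supp : ∀ m ∈ Icc 1 N, bel m (Icc 0 1) = 1
  /-- beliefs follow Bayes' rule at every history that is reached with positive probability -/
  bayes : ∀ m ∈ Icc 1 N, 0 < rejProb μ σ → (m < N → 0 < accProb μ σ) → bel m = posterior μ σ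
  /-- every type of seller bids optimally at every history -/
  bid_optimal : ∀ m ∈ Icc 1 N, ∀ v ∈ Icc (0 : ℝ) 1, ∀ b : ℝ,
    sellerPayoff N r τ σ bel m v b ≤ sellerValue N r τ σ bel m v
  /-- the speculator bids optimally at every history at which he owns an item -/
  spec_optimal : ∀ m < N, ∀ b : ℝ,
    specPayoff r τ σ bel m b ≤ ∫ b', specPayoff r τ σ bel m b' ∂(σ.spec m)
  /-- every type of seller responds optimally to the offer -/
  accept_optimal : ∀ v ∈ Icc (0 : ℝ) 1, ∀ a ∈ Icc (0 : ℝ) 1,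
    a * (p - v) + (1 - a) * rejectValue N r μ τ σ bel v ≤
      σ.accept v * (p - v) + (1 - σ.accept v) * rejectValue N r μ τ σ bel v

/-- Undominated bidding: in the auction, no bidder ever bids below his value. -/
structure UndominatedBidding : Prop where
  seller : ∀ m ∈ Icc 1 N, ∀ v ∈ Icc (0 : ℝ) 1, σ.bid m v (Iio v) = 0
  speculator : ∀ m < N, σ.spec m (Iio 0) = 0

/-! ### Explicit subgame strategies and the cutoff -/

/-- The CDF `G(·; c) = (F - F(c)) / (1 - F(c))` of a value conditional on being at least `c`. -/
def G (c x : ℝ) : ℝ := (cdf μ x - cdf μ c) / (1 - cdf μ c)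

/-- `b [1 - G(b; c)]^m`. -/
def revenue (m : ℕ) (c b : ℝ) : ℝ := b * (1 - G μ c b) ^ m

/-- `max_{c ≤ b ≤ r} b [1 - G(b; c)]^m`. -/
def bLow (m : ℕ) (c : ℝ) : ℝ := sSup (revenue μ m c '' Icc c r)

/-- The least maximizer of `b [1 - G(b; c)]^m` on `[c, r]`. -/
def bHigh (m : ℕ) (c : ℝ) : ℝ := sInf {b ∈ Icc c r | IsMaxOn (revenue μ m c) (Icc c r) b}

/-- Bid of a seller of value `v ≥ c` against the speculator and `m - 1` other sellers. -/
def beta (m : ℕ) (c v : ℝ) : ℝ :=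
  if v ≤ bHigh r μ m c then bLow r μ m c / (1 - G μ c v) ^ m else v

/-- Bid of a seller of value `v ≥ c` in the symmetric first-price auction among `N` sellers. -/
def betaSym (c v : ℝ) : ℝ :=
  if v ≤ r then v + (∫ x in v..r, (1 - G μ c x) ^ (N - 1)) / (1 - G μ c v) ^ (N - 1) else v

/-- The speculator's bid distribution on `[bLow, bHigh)`; the integral is with respect to the
conditional law of a value given that it is at least `c`, whose CDF is `G(·; c)`. -/
def Psi (m : ℕ) (c b : ℝ) : ℝ :=
  1 - Real.exp (-∫ x in Icc c (Function.invFunOn (beta r μ m c) (Icc c (bHigh r μ m c)) b),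
    (beta r μ m c x + ((m : ℝ) - 1) * x) / ((beta r μ m c x - x) * (1 - G μ c x))
      ∂(cond μ (Ici c)))

/-- `π₀ = ∫₀^r [1 - F(x)]^(N-1) dx`. -/
def piZero : ℝ := ∫ x in (0 : ℝ)..r, (1 - cdf μ x) ^ (N - 1)

/-- The indifference condition of the marginal seller, of value `c`. -/
def Indifference (c : ℝ) : Prop :=
  p - c = (∫ x in c..r, (1 - cdf μ x) ^ (N - 1)) +
    ∑ m ∈ Finset.range (N - 1), ((N - 1).choose m : ℝ) * (1 - cdf μ c) ^ m *
      cdf μ c ^ (N - 1 - m) * (bLow r μ (m + 1) c - c)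

/-- `c` is the cutoff belonging to the price `p`: it is `0` if `p ≤ π₀`, and a solution in `[0, r]`
of the indifference condition if `p > π₀`. -/
def IsCutoff (c : ℝ) : Prop :=
  c ∈ Icc 0 r ∧ (p ≤ piZero N r μ → c = 0) ∧ (piZero N r μ < p → Indifference N r p μ c)

/-- The cutoff acceptance strategy with cutoff `c` together with the explicit bidding strategies.
A seller who should have sold (`v < c`) but did not bids like a seller of value `c`. -/
structure IsCutoffProfile (c : ℝ) : Prop where
  accept_measurable : Measurable σ.accept
  accept_eq : ∀ v ∈ Icc (0 : ℝ) 1, σ.accept v = if v < c then 1 else 0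
  bid_markov : ∀ m ∈ Icc 1 N, IsMarkovKernel (σ.bid m)
  /-- bids of the sellers against the speculator -/
  bid_spec : ∀ m ∈ Ico 1 N, ∀ v ∈ Icc (0 : ℝ) 1,
    σ.bid m v = Measure.dirac (beta r μ m c (max v c))
  /-- bids when all sellers rejected the offer -/
  bid_sym : ∀ v ∈ Icc (0 : ℝ) 1, σ.bid N v = Measure.dirac (betaSym N r μ c (max v c))
  /-- the speculator bids `r` when all sellers sold -/
  spec_zero : σ.spec 0 = Measure.dirac r
  spec_prob : ∀ m < N, IsProbabilityMeasure (σ.spec m)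
  /-- otherwise he mixes over `[bLow, bHigh]` according to `Psi` -/
  spec_supp : ∀ m ∈ Ico 1 N, σ.spec m (Icc (bLow r μ m c) (bHigh r μ m c)) = 1
  spec_cdf : ∀ m ∈ Ico 1 N, ∀ b ∈ Ico (bLow r μ m c) (bHigh r μ m c),
    cdf (σ.spec m) b = Psi r μ m c b

end FPASpeculation

end

set_option linter.unusedSectionVars false

noncomputable section

namespace FPASpeculation

open Filter Topology

/-! ### Probability measures on the line -/

/-! Everything rests on one quantity per auction, the payoff of the lowest type `c`, which is the
same in every equilibrium although the bidding strategies and the tie rule are not fixed. At one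
history the sellers' behaviour enters only through `BestResponse`: undominated best replies to a
decreasing winning probability. Revealed preference makes their bids increasing in the value, and
undercutting controls atoms.

If no seller sold, there are no atoms in the bid law, so type `x` wins exactly when all rivals have
higher values, and the envelope formula gives the payoff of `c` (`symmetric_value`). Against the
speculator, his payoff `U` is first pinned down (`specPayoff_eq`). It is at least the maximal
posted-price revenue because bids exceed values, and at most that because at the top `t` of his
support no type below `t` bids above `t`. Then `V c = U - c` (`speculator_value`): if all sellers
bid at least `b`, the speculator can secure almost `b`; conversely no seller bids below the bottom
of the speculator's support, which is at least `U`, so type `c` can win for sure just below it.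

For the acceptance stage, the value of rejecting decreases in the seller's value with slope at least
-1, so the gain from accepting is decreasing and behaviour is a cutoff. Indifferent types form a
null set unless they accept, since almost every bid in the auction among sellers loses with positive
probability. The marginal type is indifferent exactly when `cutoffPrice` equals `p`, and
`cutoffPrice` is continuous and strictly increasing from `piZero` to `r`. A corner without sales
forces `p ≤ piZero`, one without rejections forces `p = r`.

For existence, `beta` makes the speculator indifferent over his support, and the hazard rate behind
`Psi` makes each type's own bid satisfy its first-order condition. At which hazard a type would be
indifferent is increasing in the type, so local optimality is global (`imitationPayoff_le`,
`beta_optimal`). The symmetric auction is handled by comparing areas (`betaSym_optimal`). -/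

lemma continuous_cdf_of_noAtoms (H : Measure ℝ) [IsProbabilityMeasure H] [NullSingletonClass H] :
    Continuous (cdf H) := by
  rw [continuous_iff_continuousAt]
  intro x
  rw [continuousAt_iff_continuous_left'_right']
  refine ⟨?_, ((cdf H).right_continuous x).mono Ioi_subset_Ici_self⟩
  rw [(cdf H).mono.continuousWithinAt_Iio_iff_leftLim_eq]
  have h := (cdf H).measure_singleton x
  rw [measure_cdf, measure_singleton] at h
  have h1 := ENNReal.ofReal_eq_zero.1 h.symm
  exact le_antisymm ((cdf H).mono.leftLim_le le_rfl) (by linarith)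

lemma real_Ioi_eq (H : Measure ℝ) [IsProbabilityMeasure H] (b : ℝ) :
    H.real (Ioi b) = 1 - cdf H b := by
  rw [cdf_eq_real, ← compl_Iic, probReal_compl_eq_one_sub measurableSet_Iic]

lemma real_Ici_eq_Ioi (H : Measure ℝ) [NullSingletonClass H] (b : ℝ) : H.real (Ici b) = H.real (Ioi b) := by
  simp only [Measure.real, measure_congr (Ioi_ae_eq_Ici (μ := H) (a := b))]

lemma continuous_real_Ioi (H : Measure ℝ) [IsProbabilityMeasure H] [NullSingletonClass H] :
    Continuous fun b => H.real (Ioi b) := by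
  simp only [real_Ioi_eq]
  exact continuous_const.sub (continuous_cdf_of_noAtoms H)

lemma antitone_real_Ici (H : Measure ℝ) [IsProbabilityMeasure H] :
    Antitone fun b => H.real (Ici b) :=
  fun _ _ h => measureReal_mono (Ici_subset_Ici.2 h)

lemma real_Ici_add (H : Measure ℝ) [IsProbabilityMeasure H] (b : ℝ) :
    H.real (Ici b) = H.real (Ioi b) + H.real {b} := by
  rw [← Ioi_union_left, measureReal_union (by simp) (measurableSet_singleton b)]

lemma pi_real_forall (β : Measure ℝ) [IsProbabilityMeasure β] (k : ℕ) (S : Set ℝ) :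
    (Measure.pi fun _ : Fin k => β).real {x | ∀ j, x j ∈ S} = β.real S ^ k := by
  have : {x : Fin k → ℝ | ∀ j, x j ∈ S} = Set.pi univ fun _ => S := by
    ext x; simp
  rw [this, Measure.real, Measure.pi_pi]
  simp [Measure.real]

lemma measurableSet_forall_mem {k : ℕ} {S : Set ℝ} (hS : MeasurableSet S) :
    MeasurableSet {x : Fin k → ℝ | ∀ j, x j ∈ S} := by
  have : {x : Fin k → ℝ | ∀ j, x j ∈ S} = Set.pi univ fun _ => S := by
    ext x; simp
  rw [this]
  exact MeasurableSet.univ_pi fun _ => hS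

/-! ### Winning probabilities in terms of bid laws -/

/-- Probability of winning with the bid `b` against `k` sellers, the speculator being absent. -/
def winAlone (r : ℝ) (k : ℕ) (β : Measure ℝ) (b : ℝ) : ℝ :=
  ∫ x : Fin k → ℝ, sellerShare r b x ∂(Measure.pi fun _ => β)

/-- Probability of winning with the bid `b` against `k` sellers and a speculator who bids `b`. -/
def winTied (r : ℝ) (τ : ℕ → ℝ) (k : ℕ) (β : Measure ℝ) (b : ℝ) : ℝ :=
  ∫ x : Fin k → ℝ, (1 - τ ((Finset.univ.filter fun j => x j = b).card + 1)) * sellerShare r b x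
    ∂(Measure.pi fun _ => β)

/-- Probability that the speculator wins with the bid `b` against `m` sellers. -/
def specWin (r : ℝ) (τ : ℕ → ℝ) (m : ℕ) (β : Measure ℝ) (b : ℝ) : ℝ :=
  ∫ x : Fin m → ℝ, specShare r τ b x ∂(Measure.pi fun _ => β)

lemma measurable_tieCount {k : ℕ} (b : ℝ) :
    Measurable fun x : Fin k → ℝ => (Finset.univ.filter fun j => x j = b).card := by
  simp only [Finset.card_filter]
  refine Finset.measurable_sum _ fun j _ => Measurable.ite ?_ measurable_const measurable_const
  exact measurableSet_eq_fun (measurable_pi_apply j) measurable_const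

lemma measurable_sellerShare (r b : ℝ) (k : ℕ) :
    Measurable fun x : Fin k → ℝ => sellerShare r b x := by
  unfold sellerShare
  refine Measurable.ite ?_ ?_ measurable_const
  · by_cases h : b ≤ r
    · simp only [h, true_and]
      exact measurableSet_forall_mem (S := Ici b) measurableSet_Ici
    · simp [h]
  · exact (measurable_from_nat (f := fun n : ℕ => 1 / ((n : ℝ) + 1))).comp (measurable_tieCount b)

lemma measurable_tiedShare (r : ℝ) (τ : ℕ → ℝ) (b : ℝ) (k : ℕ) :
    Measurable fun x : Fin k → ℝ =>
      (1 - τ ((Finset.univ.filter fun j => x j = b).card + 1)) * sellerShare r b x :=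
  ((measurable_from_nat (f := fun n : ℕ => 1 - τ (n + 1))).comp (measurable_tieCount b)).mul
    (measurable_sellerShare r b k)

lemma measurable_specShare (r : ℝ) (τ : ℕ → ℝ) (b : ℝ) (m : ℕ) :
    Measurable fun x : Fin m → ℝ => specShare r τ b x := by
  unfold specShare
  refine Measurable.ite ?_ ?_ measurable_const
  · by_cases h : b ≤ r
    · simp only [h, true_and]
      exact measurableSet_forall_mem (S := Ici b) measurableSet_Ici
    · simp [h]
  · exact (measurable_from_nat (f := fun n : ℕ => if n = 0 then 1 else τ n)).comp
      (measurable_tieCount b)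

lemma sellerShare_nonneg (r b : ℝ) {k : ℕ} (x : Fin k → ℝ) : 0 ≤ sellerShare r b x := by
  unfold sellerShare; split_ifs <;> positivity

lemma sellerShare_le_one (r b : ℝ) {k : ℕ} (x : Fin k → ℝ) : sellerShare r b x ≤ 1 := by
  unfold sellerShare; split_ifs
  · rw [div_le_one (by positivity)]; linarith [(Nat.cast_nonneg (α := ℝ)
      (Finset.univ.filter fun j => x j = b).card)]
  · exact zero_le_one

lemma sellerShare_eq_zero {r b : ℝ} (h : r < b) {k : ℕ} (x : Fin k → ℝ) :
    sellerShare r b x = 0 := by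
  unfold sellerShare; rw [if_neg]; exact fun h' => absurd h'.1 (not_le.2 h)

lemma sellerShare_eq_one {r b : ℝ} (h : b ≤ r) {k : ℕ} {x : Fin k → ℝ} (hx : ∀ j, b < x j) :
    sellerShare r b x = 1 := by
  unfold sellerShare
  rw [if_pos ⟨h, fun j => (hx j).le⟩, Finset.filter_false_of_mem fun j _ => (hx j).ne']
  simp

lemma sellerShare_eq_zero_of_not {r b : ℝ} {k : ℕ} {x : Fin k → ℝ} (hx : ¬ ∀ j, b ≤ x j) :
    sellerShare r b x = 0 := by
  unfold sellerShare; rw [if_neg]; exact fun h' => hx h'.2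

lemma sellerShare_antitone (r : ℝ) {k : ℕ} (x : Fin k → ℝ) :
    Antitone fun b => sellerShare r b x := by
  intro b b' h
  rcases h.eq_or_lt with rfl | h
  · exact le_rfl
  by_cases h' : b' ≤ r ∧ ∀ j, b' ≤ x j
  · have : sellerShare r b x = 1 :=
      sellerShare_eq_one (h.le.trans h'.1) fun j => h.trans_le (h'.2 j)
    simp only [this]
    exact sellerShare_le_one _ _ _
  · have : sellerShare r b' x = 0 := by unfold sellerShare; rw [if_neg h']
    simp only [this]
    exact sellerShare_nonneg _ _ _

/-- If all `k` rivals bid `b` too, the lottery leaves this seller at most `(1 - τ (k + 1)) / (k +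
1)`; in every other case 1 is a sufficient bound. This single tie event is enough to make
undercutting profitable. For `k = 0` both events are certain and the bound is `1 - τ 1`. -/
lemma tiedShare_le {r : ℝ} {τ : ℕ → ℝ} (hτ : ∀ k, τ k ∈ Icc (0 : ℝ) 1) (b : ℝ) {k : ℕ}
    (x : Fin k → ℝ) :
    (1 - τ ((Finset.univ.filter fun j => x j = b).card + 1)) * sellerShare r b x ≤
      {x : Fin k → ℝ | ∀ j, x j ∈ Ici b}.indicator 1 x -
        (1 - (1 - τ (k + 1)) / (k + 1)) * {x : Fin k → ℝ | ∀ j, x j ∈ ({b} : Set ℝ)}.indicator 1 x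
    := by
  have h0 := sellerShare_nonneg r b x
  have h1 := sellerShare_le_one r b x
  by_cases hx : ∀ j, x j = b
  · have hx' : ∀ j, b ≤ x j := fun j => (hx j).ge
    rw [indicator_of_mem (by simpa using hx'), indicator_of_mem (by simpa using hx)]
    have hc : (Finset.univ.filter fun j => x j = b).card = k := by
      rw [Finset.filter_true_of_mem fun j _ => hx j]; simp
    rw [hc]
    have := hτ (k + 1)
    have h2 : sellerShare r b x ≤ 1 / (k + 1) := by
      unfold sellerShare
      split_ifs
      · rw [hc]
      · positivity
    simp only [Pi.one_apply, mul_one]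
    calc _ ≤ (1 - τ (k + 1)) * (1 / (k + 1)) := mul_le_mul_of_nonneg_left h2 (by linarith [this.2])
      _ = _ := by ring
  · rw [indicator_of_notMem (s := {x : Fin k → ℝ | ∀ j, x j ∈ ({b} : Set ℝ)}) (by simpa using hx)]
    have := hτ ((Finset.univ.filter fun j => x j = b).card + 1)
    by_cases hx' : ∀ j, b ≤ x j
    · rw [indicator_of_mem (by simpa using hx')]
      simp only [Pi.one_apply, mul_zero, sub_zero]
      nlinarith [this.1, this.2]
    · rw [indicator_of_notMem (by simpa using hx'), sellerShare_eq_zero_of_not hx']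
      simp

/-! ### Bounds and monotonicity of the winning probabilities. -/

section Win

variable {r : ℝ} {τ : ℕ → ℝ} {k m : ℕ} {β : Measure ℝ} [IsProbabilityMeasure β]

lemma integrable_of_mem_Icc {α : Type*} [MeasurableSpace α] {P : Measure α} [IsFiniteMeasure P]
    {f : α → ℝ} (hf : Measurable f) {C : ℝ} (h : ∀ x, f x ∈ Icc 0 C) : Integrable f P :=
  Integrable.of_bound hf.aestronglyMeasurable C
    (Eventually.of_forall fun x => by rw [Real.norm_of_nonneg (h x).1]; exact (h x).2)

lemma integrable_sellerShare (b : ℝ) :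
    Integrable (fun x : Fin k → ℝ => sellerShare r b x) (Measure.pi fun _ => β) :=
  integrable_of_mem_Icc (measurable_sellerShare r b k)
    fun x => ⟨sellerShare_nonneg _ _ _, sellerShare_le_one _ _ _⟩

lemma tiedShare_mem (hτ : ∀ k, τ k ∈ Icc (0 : ℝ) 1) (b : ℝ) (x : Fin k → ℝ) :
    0 ≤ (1 - τ ((Finset.univ.filter fun j => x j = b).card + 1)) * sellerShare r b x ∧
    (1 - τ ((Finset.univ.filter fun j => x j = b).card + 1)) * sellerShare r b x
      ≤ sellerShare r b x := by
  have := hτ ((Finset.univ.filter fun j => x j = b).card + 1)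
  have h0 := sellerShare_nonneg r b x
  constructor
  · exact mul_nonneg (by linarith [this.2]) h0
  · nlinarith [this.1]

lemma integrable_tiedShare (hτ : ∀ k, τ k ∈ Icc (0 : ℝ) 1) (b : ℝ) :
    Integrable (fun x : Fin k → ℝ =>
      (1 - τ ((Finset.univ.filter fun j => x j = b).card + 1)) * sellerShare r b x)
      (Measure.pi fun _ => β) :=
  integrable_of_mem_Icc (measurable_tiedShare r τ b k)
    fun x => ⟨(tiedShare_mem hτ b x).1, (tiedShare_mem hτ b x).2.trans (sellerShare_le_one _ _ _)⟩

lemma winTied_nonneg (hτ : ∀ k, τ k ∈ Icc (0 : ℝ) 1) (b : ℝ) : 0 ≤ winTied r τ k β b :=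
  integral_nonneg fun x => (tiedShare_mem hτ b x).1

lemma winTied_le_winAlone (hτ : ∀ k, τ k ∈ Icc (0 : ℝ) 1) (b : ℝ) :
    winTied r τ k β b ≤ winAlone r k β b :=
  integral_mono (integrable_tiedShare hτ b) (integrable_sellerShare b)
    fun x => (tiedShare_mem hτ b x).2

lemma winTied_zero (b : ℝ) : winTied r (fun _ => 0) k β b = winAlone r k β b := by
  simp [winTied, winAlone]

lemma winAlone_nonneg (b : ℝ) : 0 ≤ winAlone r k β b :=
  integral_nonneg fun x => sellerShare_nonneg _ _ _

lemma winAlone_eq_zero {b : ℝ} (h : r < b) : winAlone r k β b = 0 := by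
  simp [winAlone, sellerShare_eq_zero h]

lemma winAlone_antitone : Antitone (winAlone r k β) := fun _ _ h =>
  integral_mono (integrable_sellerShare _) (integrable_sellerShare _)
    fun x => sellerShare_antitone r x h

lemma le_winAlone {b : ℝ} (h : b ≤ r) : β.real (Ioi b) ^ k ≤ winAlone r k β b := by
  have hm := measurableSet_forall_mem (k := k) (measurableSet_Ioi (a := b))
  rw [← pi_real_forall, ← integral_indicator_one hm]
  refine integral_mono ((integrable_const (1 : ℝ)).indicator hm) (integrable_sellerShare b)
    fun x => ?_
  refine indicator_apply_le' ?_ ?_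
  · exact fun hx => (sellerShare_eq_one h hx).ge
  · exact fun _ => sellerShare_nonneg _ _ _

lemma winTied_le (hτ : ∀ k, τ k ∈ Icc (0 : ℝ) 1) (b : ℝ) :
    winTied r τ k β b ≤
      β.real (Ici b) ^ k - (1 - (1 - τ (k + 1)) / (k + 1)) * β.real {b} ^ k := by
  have hm := measurableSet_forall_mem (k := k) (measurableSet_Ici (a := b))
  have hm' := measurableSet_forall_mem (k := k) (measurableSet_singleton b)
  have hi : ∀ {s : Set (Fin k → ℝ)}, MeasurableSet s →
      Integrable (s.indicator 1 : (Fin k → ℝ) → ℝ) (Measure.pi fun _ => β) :=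
    fun hs => (integrable_const (1 : ℝ)).indicator hs
  rw [← pi_real_forall, ← pi_real_forall, ← integral_indicator_one hm, ← integral_indicator_one hm',
    ← integral_const_mul, ← integral_sub (hi hm) ((hi hm').const_mul _)]
  exact integral_mono (integrable_tiedShare hτ b) ((hi hm).sub ((hi hm').const_mul _))
    fun x => tiedShare_le hτ b x

/-- The case `τ = 0` of the tied bound: with a speculator who loses ties only the lottery among the
sellers matters. -/
lemma winAlone_le (b : ℝ) :
    winAlone r k β b ≤ β.real (Ici b) ^ k - (1 - 1 / ((k : ℝ) + 1)) * β.real {b} ^ k := by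
  have := winTied_le (r := r) (τ := fun _ => 0) (k := k) (β := β) (by simp) b
  simpa [winTied_zero] using this

lemma winAlone_le_pow (b : ℝ) : winAlone r k β b ≤ β.real (Ici b) ^ k := by
  refine (winAlone_le b).trans (sub_le_self _ (mul_nonneg ?_ (by positivity)))
  rw [sub_nonneg, div_le_one (by positivity)]; linarith [(Nat.cast_nonneg (α := ℝ) k)]

lemma winAlone_le_one (b : ℝ) : winAlone r k β b ≤ 1 :=
  (winAlone_le_pow b).trans (pow_le_one₀ measureReal_nonneg measureReal_le_one)

lemma winAlone_of_atomless {b : ℝ} (h : b ≤ r) (hb : β.real {b} = 0) :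
    winAlone r k β b = β.real (Ioi b) ^ k := by
  refine le_antisymm ?_ (le_winAlone h)
  have := winAlone_le_pow (r := r) (k := k) (β := β) b
  rwa [real_Ici_add, hb, add_zero] at this

/-! ### The speculator's winning probability -/

lemma specShare_nonneg (hτ : ∀ k, τ k ∈ Icc (0 : ℝ) 1) (b : ℝ) (x : Fin m → ℝ) :
    0 ≤ specShare r τ b x := by
  unfold specShare; split_ifs <;> first | exact zero_le_one | exact (hτ _).1 | exact le_rfl

lemma specShare_le_one (hτ : ∀ k, τ k ∈ Icc (0 : ℝ) 1) (b : ℝ) (x : Fin m → ℝ) :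
    specShare r τ b x ≤ 1 := by
  unfold specShare; split_ifs <;> first | exact zero_le_one | exact (hτ _).2 | exact le_rfl

lemma specShare_eq_one {b : ℝ} (h : b ≤ r) {x : Fin m → ℝ} (hx : ∀ j, b < x j) :
    specShare r τ b x = 1 := by
  unfold specShare
  rw [if_pos ⟨h, fun j => (hx j).le⟩, Finset.filter_false_of_mem fun j _ => (hx j).ne']
  simp

lemma specShare_antitone (hτ : ∀ k, τ k ∈ Icc (0 : ℝ) 1) (x : Fin m → ℝ) :
    Antitone fun b => specShare r τ b x := by
  intro b b' h
  rcases h.eq_or_lt with rfl | h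
  · exact le_rfl
  by_cases h' : b' ≤ r ∧ ∀ j, b' ≤ x j
  · have : specShare r τ b x = 1 :=
      specShare_eq_one (h.le.trans h'.1) fun j => h.trans_le (h'.2 j)
    simp only [this]
    exact specShare_le_one hτ _ _
  · have : specShare r τ b' x = 0 := by unfold specShare; rw [if_neg h']
    simp only [this]
    exact specShare_nonneg hτ _ _

lemma integrable_specShare (hτ : ∀ k, τ k ∈ Icc (0 : ℝ) 1) (b : ℝ) :
    Integrable (fun x : Fin m → ℝ => specShare r τ b x) (Measure.pi fun _ => β) :=
  integrable_of_mem_Icc (measurable_specShare r τ b m)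
    fun x => ⟨specShare_nonneg hτ _ _, specShare_le_one hτ _ _⟩

lemma specWin_nonneg (hτ : ∀ k, τ k ∈ Icc (0 : ℝ) 1) (b : ℝ) : 0 ≤ specWin r τ m β b :=
  integral_nonneg fun x => specShare_nonneg hτ _ _

lemma specWin_antitone (hτ : ∀ k, τ k ∈ Icc (0 : ℝ) 1) : Antitone (specWin r τ m β) :=
  fun _ _ h => integral_mono (integrable_specShare hτ _) (integrable_specShare hτ _)
    fun x => specShare_antitone hτ x h

lemma specWin_eq_zero {b : ℝ} (h : r < b) : specWin r τ m β b = 0 := by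
  have : ∀ x : Fin m → ℝ, specShare r τ b x = 0 := fun x => by
    unfold specShare; rw [if_neg]; exact fun h' => absurd h'.1 (not_le.2 h)
  simp [specWin, this]

lemma le_specWin (hτ : ∀ k, τ k ∈ Icc (0 : ℝ) 1) {b : ℝ} (h : b ≤ r) :
    β.real (Ioi b) ^ m ≤ specWin r τ m β b := by
  have hm := measurableSet_forall_mem (k := m) (measurableSet_Ioi (a := b))
  rw [← pi_real_forall, ← integral_indicator_one hm]
  refine integral_mono ((integrable_const (1 : ℝ)).indicator hm) (integrable_specShare hτ b)
    fun x => ?_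
  refine indicator_apply_le' ?_ ?_
  · exact fun hx => (specShare_eq_one h hx).ge
  · exact fun _ => specShare_nonneg hτ _ _

lemma specWin_le (hτ : ∀ k, τ k ∈ Icc (0 : ℝ) 1) (b : ℝ) :
    specWin r τ m β b ≤ β.real (Ici b) ^ m := by
  have hm := measurableSet_forall_mem (k := m) (measurableSet_Ici (a := b))
  rw [← pi_real_forall, ← integral_indicator_one hm]
  refine integral_mono (integrable_specShare hτ b) ((integrable_const (1 : ℝ)).indicator hm)
    fun x => ?_
  refine le_indicator_apply ?_ ?_
  · exact fun hx => specShare_le_one hτ _ _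
  · intro hx
    unfold specShare; rw [if_neg]; exact fun h' => hx h'.2

/-- If the speculator loses ties against a single seller, he wins only with a lower bid. -/
lemma specWin_one_le (hτ : ∀ k, τ k ∈ Icc (0 : ℝ) 1) (h1 : τ 1 = 0) (b : ℝ) :
    specWin r τ 1 β b ≤ β.real (Ioi b) := by
  have hm := measurableSet_forall_mem (k := 1) (measurableSet_Ioi (a := b))
  rw [← pow_one (β.real (Ioi b)), ← pi_real_forall, ← integral_indicator_one hm]
  refine integral_mono (integrable_specShare hτ b) ((integrable_const (1 : ℝ)).indicator hm)
    fun x => ?_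
  refine le_indicator_apply ?_ ?_
  · exact fun hx => specShare_le_one hτ _ _
  · intro hx
    have hx' : ¬ b < x 0 := by simpa using hx
    unfold specShare
    split_ifs with h2 h3
    · exact absurd (h2.2 0) fun h => by
        have h4 : x 0 = b := le_antisymm (not_lt.1 hx') h
        simp [h4] at h3
    · have h4 : x 0 = b := le_antisymm (not_lt.1 hx') (h2.2 0)
      have h5 : (Finset.univ.filter fun j : Fin 1 => x j = b).card = 1 := by
        rw [Finset.filter_true_of_mem fun j _ => by rw [Subsingleton.elim j 0, h4]]; simp
      rw [h5, h1]
    · exact le_rfl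

end Win

/-- Winning probability of a seller against `k` sellers and a speculator with bid law `ν`. -/
def winSpec (r : ℝ) (τ : ℕ → ℝ) (k : ℕ) (β ν : Measure ℝ) (b : ℝ) : ℝ :=
  ν.real (Ioi b) * winAlone r k β b + ν.real {b} * winTied r τ k β b

lemma integral_sellerShareSpec (r : ℝ) (τ : ℕ → ℝ) (k : ℕ) (β ν : Measure ℝ)
    [IsProbabilityMeasure ν] (b : ℝ) :
    ∫ s, (∫ x : Fin k → ℝ, sellerShareSpec r τ b x s ∂(Measure.pi fun _ => β)) ∂ν =
      winSpec r τ k β ν b := by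
  have : ∀ s, (∫ x : Fin k → ℝ, sellerShareSpec r τ b x s ∂(Measure.pi fun _ => β)) =
      (Ioi b).indicator (fun _ => winAlone r k β b) s +
        ({b} : Set ℝ).indicator (fun _ => winTied r τ k β b) s := by
    intro s
    rcases lt_trichotomy b s with h | h | h
    · rw [indicator_of_mem (mem_Ioi.2 h), indicator_of_notMem (by simp [h.ne'])]
      simp [sellerShareSpec, h, winAlone]
    · subst h
      simp [sellerShareSpec, winTied]
    · rw [indicator_of_notMem (by simp [h.le]), indicator_of_notMem (by simp [h.ne])]
      simp [sellerShareSpec, h.ne', not_lt.2 h.le]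
  simp only [this]
  rw [integral_add ((integrable_const _).indicator measurableSet_Ioi)
    ((integrable_const _).indicator (measurableSet_singleton b)),
    integral_indicator measurableSet_Ioi, integral_indicator (measurableSet_singleton b)]
  simp [winSpec, Measure.real]

section WinSpec

variable {r : ℝ} {τ : ℕ → ℝ} {k : ℕ} {β ν : Measure ℝ} [IsProbabilityMeasure β]
  [IsProbabilityMeasure ν]

lemma le_winSpec (hτ : ∀ k, τ k ∈ Icc (0 : ℝ) 1) (b : ℝ) :
    ν.real (Ioi b) * winAlone r k β b ≤ winSpec r τ k β ν b :=
  le_add_of_nonneg_right (mul_nonneg measureReal_nonneg (winTied_nonneg hτ b))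

lemma winSpec_le (hτ : ∀ k, τ k ∈ Icc (0 : ℝ) 1) (b : ℝ) :
    winSpec r τ k β ν b ≤ ν.real (Ici b) * winAlone r k β b := by
  rw [real_Ici_add, add_mul]
  exact add_le_add_right (mul_le_mul_of_nonneg_left (winTied_le_winAlone hτ b) measureReal_nonneg) _

lemma winSpec_nonneg (hτ : ∀ k, τ k ∈ Icc (0 : ℝ) 1) (b : ℝ) : 0 ≤ winSpec r τ k β ν b :=
  le_trans (mul_nonneg measureReal_nonneg (winAlone_nonneg b)) (le_winSpec hτ b)

lemma winSpec_le_real (hτ : ∀ k, τ k ∈ Icc (0 : ℝ) 1) (b : ℝ) :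
    winSpec r τ k β ν b ≤ ν.real (Ici b) :=
  (winSpec_le hτ b).trans (mul_le_of_le_one_right measureReal_nonneg (winAlone_le_one b))

lemma winSpec_le_one (hτ : ∀ k, τ k ∈ Icc (0 : ℝ) 1) (b : ℝ) : winSpec r τ k β ν b ≤ 1 :=
  (winSpec_le_real hτ b).trans measureReal_le_one

lemma winSpec_eq_zero (hτ : ∀ k, τ k ∈ Icc (0 : ℝ) 1) {b : ℝ} (h : r < b) :
    winSpec r τ k β ν b = 0 :=
  le_antisymm (by simpa [winAlone_eq_zero h] using winSpec_le (ν := ν) (β := β) (r := r) (k := k) hτ b)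
    (winSpec_nonneg hτ b)

lemma winSpec_antitone (hτ : ∀ k, τ k ∈ Icc (0 : ℝ) 1) : Antitone (winSpec r τ k β ν) := by
  intro b b' h
  rcases h.eq_or_lt with rfl | h
  · exact le_rfl
  refine (winSpec_le hτ b').trans (le_trans ?_ (le_winSpec hτ b))
  exact mul_le_mul (measureReal_mono (Ici_subset_Ioi.2 h)) (winAlone_antitone h.le)
    (winAlone_nonneg _) measureReal_nonneg

end WinSpec

/-! ### Essential bounds and mixtures -/

/-- The exceptional points form a down-set. If it has a maximum it lies in a single null ray;
otherwise countably many null rays with rational endpoints cover it. -/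
lemma ae_pos_Iic (β : Measure ℝ) : ∀ᵐ b ∂β, β (Iic b) ≠ 0 := by
  rw [ae_iff]
  set A := {b : ℝ | ¬ β (Iic b) ≠ 0} with hA
  have hmem : ∀ b, b ∈ A ↔ β (Iic b) = 0 := fun b => by simp [hA]
  have hdown : ∀ {x y}, x ≤ y → y ∈ A → x ∈ A := fun h hy => by
    rw [hmem] at *; exact measure_mono_null (Iic_subset_Iic.2 h) hy
  by_cases hmax : ∃ t ∈ A, ∀ b ∈ A, b ≤ t
  · obtain ⟨t, ht, hb⟩ := hmax
    exact measure_mono_null hb ((hmem t).1 ht)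
  · push Not at hmax
    have hsub : A ⊆ ⋃ q : {q : ℚ // (q : ℝ) ∈ A}, Iic (q : ℝ) := fun b hb => by
      obtain ⟨t, ht, hbt⟩ := hmax b hb
      obtain ⟨q, hq1, hq2⟩ := exists_rat_btwn hbt
      exact mem_iUnion.2 ⟨⟨q, hdown hq2.le ht⟩, hq1.le⟩
    exact measure_mono_null hsub (measure_iUnion_null fun q => (hmem _).1 q.2)

/-- The reflection of `ae_pos_Iic` for the part of `β` below `s`. It selects a bid below `s` at
which the tail of the bid law is strictly larger than at `s`. -/
lemma ae_pos_Ico (β : Measure ℝ) (s : ℝ) : ∀ᵐ b ∂β, b < s → β (Ico b s) ≠ 0 := by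
  have h := ae_pos_Iic ((β.restrict (Iio s)).map Neg.neg)
  have h2 := ae_of_ae_map measurable_neg.aemeasurable h
  rw [ae_restrict_iff' measurableSet_Iio] at h2
  filter_upwards [h2] with b hb hbs
  have := hb hbs
  rw [Measure.map_apply measurable_neg measurableSet_Iic] at this
  simp only [neg_preimage, neg_Iic, neg_neg] at this
  rwa [Measure.restrict_apply measurableSet_Ici, Ici_inter_Iio] at this

lemma exists_ess_inf (ν : Measure ℝ) [IsProbabilityMeasure ν] {a b : ℝ}
    (h : ∀ᵐ s ∂ν, s ∈ Icc a b) :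
    ∃ t ∈ Icc a b, ν (Iio t) = 0 ∧ ∀ t' > t, ν (Iio t') ≠ 0 := by
  set T := {t | ν (Iio t) = 0} with hT
  have ha : a ∈ T := by
    exact measure_mono_null (t := {s | ¬ s ∈ Icc a b}) (fun s hs hs' => absurd hs'.1 (not_le.2 hs))
      (ae_iff.1 h)
  have hb : ∀ t ∈ T, t ≤ b := fun t ht => by
    by_contra hbt
    push Not at hbt
    have : ν univ = 0 := measure_mono_null (t := Iio t ∪ {s | ¬ s ∈ Icc a b}) (fun s _ => by
      by_cases hs : s ∈ Icc a b
      · exact Or.inl (hs.2.trans_lt hbt)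
      · exact Or.inr hs) (measure_union_null ht (ae_iff.1 h))
    simp at this
  have hbdd : BddAbove T := ⟨b, hb⟩
  refine ⟨sSup T, ⟨le_csSup hbdd ha, csSup_le ⟨a, ha⟩ hb⟩, ?_, fun t' ht' h0 => ?_⟩
  · have hsub : Iio (sSup T) ⊆ ⋃ q : {q : ℚ // (q : ℝ) ∈ T}, Iio (q : ℝ) := fun x hx => by
      obtain ⟨q, hq1, hq2⟩ := exists_rat_btwn (mem_Iio.1 hx)
      obtain ⟨t, ht, hqt⟩ := exists_lt_of_lt_csSup ⟨a, ha⟩ hq2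
      exact mem_iUnion.2 ⟨⟨q, measure_mono_null (Iio_subset_Iio hqt.le) ht⟩, hq1⟩
    exact measure_mono_null hsub (measure_iUnion_null fun q => q.2)
  · exact absurd (le_csSup hbdd h0) (not_le.2 ht')

lemma exists_ess_sup (ν : Measure ℝ) [IsProbabilityMeasure ν] {a b : ℝ}
    (h : ∀ᵐ s ∂ν, s ∈ Icc a b) :
    ∃ t ∈ Icc a b, ν (Ioi t) = 0 ∧ ∀ t' < t, ν (Ioi t') ≠ 0 := by
  have : IsProbabilityMeasure (ν.map Neg.neg) :=
    Measure.isProbabilityMeasure_map measurable_neg.aemeasurable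
  obtain ⟨t, ht, h0, h1⟩ := exists_ess_inf (ν.map Neg.neg) (a := -b) (b := -a)
    ((ae_map_iff measurable_neg.aemeasurable measurableSet_Icc).2
      (h.mono fun s hs => ⟨neg_le_neg hs.2, neg_le_neg hs.1⟩))
  refine ⟨-t, ⟨by linarith [ht.2], by linarith [ht.1]⟩, ?_, fun t' ht' => ?_⟩
  · rw [Measure.map_apply measurable_neg measurableSet_Iio] at h0
    simpa using h0
  · have := h1 (-t') (by linarith)
    rw [Measure.map_apply measurable_neg measurableSet_Iio] at this
    simpa using this

/-- Turns statements about which types may place which bids into inequalities between the bid law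
and the law of values. -/
lemma bind_real_le {H : Measure ℝ} [IsProbabilityMeasure H] {κ : Kernel ℝ ℝ} [IsMarkovKernel κ]
    {S A : Set ℝ} (hS : MeasurableSet S) (hA : MeasurableSet A)
    (h : ∀ᵐ v ∂H, v ∉ A → κ v S = 0) : (H.bind κ).real S ≤ H.real A := by
  refine ENNReal.toReal_mono (measure_ne_top _ _) ?_
  rw [Measure.bind_apply hS κ.measurable.aemeasurable, ← lintegral_indicator_one hA]
  refine lintegral_mono_ae (h.mono fun v hv => ?_)
  by_cases hvA : v ∈ A
  · rw [indicator_of_mem hvA]; exact prob_le_one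
  · rw [indicator_of_notMem hvA, hv hvA]

/-! ### Best responses of the sellers at one history -/

/-- The bids drawn from `κ` are undominated best responses to the winning probability `W`, and `V`
is the resulting payoff. -/
structure BestResponse (r : ℝ) (κ : Kernel ℝ ℝ) (W V : ℝ → ℝ) : Prop where
  antitone : Antitone W
  nonneg : ∀ b, 0 ≤ W b
  le_one : ∀ b, W b ≤ 1
  zero_above : ∀ b, r < b → W b = 0
  le_value : ∀ v ∈ Icc (0 : ℝ) 1, ∀ b, (b - v) * W b ≤ V v
  ae_opt : ∀ v ∈ Icc (0 : ℝ) 1, ∀ᵐ b ∂(κ v), v ≤ b ∧ (b - v) * W b = V v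

/-- The difference between the mean and `f` is nonnegative with integral zero. The lower bound,
supplied by undominated bidding, only serves integrability: without it the integral could be the
default value 0. -/
lemma ae_eq_value_of_le {P : Measure ℝ} [IsProbabilityMeasure P] {f : ℝ → ℝ} (hf : Measurable f)
    (hle : ∀ b, f b ≤ ∫ b', f b' ∂P) (h0 : ∀ᵐ b ∂P, 0 ≤ f b) : ∀ᵐ b ∂P, f b = ∫ b', f b' ∂P := by
  have hi : Integrable f P := Integrable.of_bound hf.aestronglyMeasurable (∫ b', f b' ∂P)
    (h0.mono fun b hb => by rw [Real.norm_of_nonneg hb]; exact hle b)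
  have h := (integral_eq_zero_iff_of_nonneg (μ := P) (f := fun b => (∫ b', f b' ∂P) - f b)
    (fun b => sub_nonneg.2 (hle b)) ((integrable_const _).sub hi)).1
    (by rw [integral_sub (integrable_const _) hi]; simp)
  filter_upwards [h] with b hb
  simp only [Pi.zero_apply] at hb
  linarith

namespace BestResponse

variable {r : ℝ} {κ : Kernel ℝ ℝ} {W V : ℝ → ℝ}

lemma of_optimal [IsMarkovKernel κ] (hW : Antitone W) (h0 : ∀ b, 0 ≤ W b) (h1 : ∀ b, W b ≤ 1)
    (hr : ∀ b, r < b → W b = 0)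
    (hV : ∀ v ∈ Icc (0 : ℝ) 1, V v = ∫ b, (b - v) * W b ∂(κ v))
    (hle : ∀ v ∈ Icc (0 : ℝ) 1, ∀ b, (b - v) * W b ≤ V v)
    (hund : ∀ v ∈ Icc (0 : ℝ) 1, κ v (Iio v) = 0) : BestResponse r κ W V where
  antitone := hW
  nonneg := h0
  le_one := h1
  zero_above := hr
  le_value := hle
  ae_opt v hv := by
    have hge : ∀ᵐ b ∂(κ v), v ≤ b := by
      rw [ae_iff]; simpa [Iio] using hund v hv
    have := ae_eq_value_of_le (P := κ v) (f := fun b => (b - v) * W b)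
      ((measurable_id.sub_const v).mul hW.measurable) (fun b => (hV v hv) ▸ hle v hv b)
      (hge.mono fun b hb => mul_nonneg (sub_nonneg.2 hb) (h0 b))
    filter_upwards [hge, this] with b hb hb'
    exact ⟨hb, hb'.trans (hV v hv).symm⟩

variable (h : BestResponse r κ W V)
include h

lemma value_nonneg {v : ℝ} (hv : v ∈ Icc (0 : ℝ) 1) : 0 ≤ V v := by
  simpa [h.zero_above (r + 1) (by linarith)] using h.le_value v hv (r + 1)

lemma value_pos {v b : ℝ} (hv : v ∈ Icc (0 : ℝ) 1) (hb : v < b) (hW : 0 < W b) : 0 < V v :=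
  (mul_pos (sub_pos.2 hb) hW).trans_le (h.le_value v hv b)

lemma exists_opt [IsMarkovKernel κ] {v : ℝ} (hv : v ∈ Icc (0 : ℝ) 1) :
    ∃ b, v ≤ b ∧ (b - v) * W b = V v :=
  (h.ae_opt v hv).exists

lemma win_pos {v b : ℝ} (hV : 0 < V v) (ho : (b - v) * W b = V v) : 0 < W b :=
  (h.nonneg b).lt_of_ne fun h0 => by rw [← h0, mul_zero] at ho; linarith

lemma le_reserve {v b : ℝ} (hV : 0 < V v) (ho : (b - v) * W b = V v) : b ≤ r := by
  by_contra hb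
  exact (h.win_pos hV ho).ne' (h.zero_above b (not_le.1 hb))

/-- Adding the two incentive constraints gives `(v' - v) * (W b - W b') ≥ 0`. If `b` exceeded `b'`,
both bids would win equally often, with positive probability, and `v'` would prefer the higher one.
-/
lemma bid_mono_of_pos_right {v v' b b' : ℝ} (hv : v ∈ Icc (0 : ℝ) 1) (hv' : v' ∈ Icc (0 : ℝ) 1)
    (hlt : v < v') (ho : (b - v) * W b = V v) (ho' : (b' - v') * W b' = V v') (hV : 0 < V v') :
    b ≤ b' := by
  by_contra hb
  push Not at hb
  have h1 := h.le_value v hv b'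
  have h2 := h.le_value v' hv' b
  have h3 := h.antitone hb.le
  have h4 := h.win_pos hV ho'
  have h5 : 0 ≤ (v' - v) * (W b - W b') := by nlinarith
  have h6 : W b = W b' := le_antisymm h3 (by nlinarith)
  rw [h6] at h2
  nlinarith

/-- Only the case `V v' = 0` is new. There undominatedness gives `v' ≤ b'`, so a larger `b`, which
wins with positive probability, would give `v'` a positive payoff. -/
lemma bid_mono_of_pos_left {v v' b b' : ℝ} (hv : v ∈ Icc (0 : ℝ) 1) (hv' : v' ∈ Icc (0 : ℝ) 1)
    (hlt : v < v') (ho : (b - v) * W b = V v) (hge : v' ≤ b') (ho' : (b' - v') * W b' = V v')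
    (hV : 0 < V v) : b ≤ b' := by
  rcases (h.value_nonneg hv').lt_or_eq with hp | h0
  · exact h.bid_mono_of_pos_right hv hv' hlt ho ho' hp
  · by_contra hb
    exact (h.value_pos hv' (hge.trans_lt (not_le.1 hb)) (h.win_pos hV ho)).ne h0

/-- Bidding slightly less costs a vanishing amount, so a winning probability available just below an
optimal bid must also be attained at it. Combined with the upper bounds on shares in a tie, this
excludes atoms. -/
lemma undercut {v b w : ℝ} (hv : v ∈ Icc (0 : ℝ) 1) (hlt : v < b) (ho : (b - v) * W b = V v)
    (hw : ∀ b' < b, w ≤ W b') : w ≤ W b := by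
  have h1 : ∀ᶠ b' in 𝓝[<] b, (b' - v) * w ≤ (b - v) * W b := by
    filter_upwards [Ioo_mem_nhdsLT hlt] with b' hb'
    rw [ho]
    exact (mul_le_mul_of_nonneg_left (hw b' hb'.2) (sub_nonneg.2 hb'.1.le)).trans
      (h.le_value v hv b')
  have h2 : Tendsto (fun b' => (b' - v) * w) (𝓝[<] b) (𝓝 ((b - v) * w)) :=
    (Continuous.tendsto (by fun_prop) b).mono_left nhdsWithin_le_nhds
  exact le_of_mul_le_mul_left (le_of_tendsto h2 h1) (sub_pos.2 hlt)

lemma value_sub_le {v v' b : ℝ} (hv' : v' ∈ Icc (0 : ℝ) 1) (ho : (b - v) * W b = V v) :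
    V v - V v' ≤ (v' - v) * W b := by
  have := h.le_value v' hv' b
  linarith

lemma value_sub_le_sub [IsMarkovKernel κ] {v v' : ℝ} (hv : v ∈ Icc (0 : ℝ) 1)
    (hv' : v' ∈ Icc (0 : ℝ) 1) (hle : v ≤ v') : V v - V v' ≤ v' - v := by
  obtain ⟨b, -, ho⟩ := h.exists_opt hv
  exact (h.value_sub_le hv' ho).trans
    (mul_le_of_le_one_right (sub_nonneg.2 hle) (h.le_one b))

lemma value_antitone [IsMarkovKernel κ] {v v' : ℝ} (hv : v ∈ Icc (0 : ℝ) 1)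
    (hv' : v' ∈ Icc (0 : ℝ) 1) (hle : v ≤ v') : V v' ≤ V v := by
  obtain ⟨b, -, ho⟩ := h.exists_opt hv'
  have := h.value_sub_le hv ho
  nlinarith [h.nonneg b]

variable {H : Measure ℝ} [IsProbabilityMeasure H] [IsMarkovKernel κ]

/-- Any event of positive probability for the bids contains an optimal bid of some type. -/
lemma exists_opt_of_pos {c : ℝ} (hc : 0 ≤ c) (hH : ∀ᵐ v ∂H, v ∈ Icc c 1) {S : Set ℝ}
    (hS : MeasurableSet S) (hpos : H.bind κ S ≠ 0) {q p : ℝ → Prop} (hq : ∀ᵐ v ∂H, q v)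
    (hp : ∀ᵐ b ∂(H.bind κ), p b) :
    ∃ v ∈ Icc c 1, q v ∧ ∃ b ∈ S, p b ∧ v ≤ b ∧ (b - v) * W b = V v := by
  by_contra hcon
  push Not at hcon
  apply hpos
  rw [Measure.bind_apply hS κ.measurable.aemeasurable,
    lintegral_eq_zero_iff (κ.measurable_coe hS)]
  filter_upwards [hH, hq, Measure.ae_ae_of_ae_comp hp] with v hv hqv hpv
  have : ∀ᵐ b ∂(κ v), b ∉ S := by
    filter_upwards [hpv, h.ae_opt v ⟨hc.trans hv.1, hv.2⟩] with b hb hb' hbS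
    exact hcon v hv hqv b hbS hb hb'.1 hb'.2
  exact measure_eq_zero_iff_ae_notMem.2 this

/-- Bids exceed values. -/
lemma le_bind_Ioi {c : ℝ} (hc : 0 ≤ c) (hH : ∀ᵐ v ∂H, v ∈ Icc c 1) (b : ℝ) :
    H.real (Ioi b) ≤ (H.bind κ).real (Ioi b) := by
  have := bind_real_le (H := H) (κ := κ) (measurableSet_Iic (a := b)) (measurableSet_Iic (a := b))
    (hH.mono fun v hv hvb => by
      have : ∀ᵐ x ∂(κ v), x ∉ Iic b := (h.ae_opt v ⟨hc.trans hv.1, hv.2⟩).mono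
        fun x hx hxb => hvb (hx.1.trans hxb)
      exact measure_eq_zero_iff_ae_notMem.2 this)
  rw [← compl_Iic, probReal_compl_eq_one_sub measurableSet_Iic,
    probReal_compl_eq_one_sub measurableSet_Iic]
  linarith

variable [NullSingletonClass H]

lemma exists_opt_of_atom {c : ℝ} (hc : 0 ≤ c) (hH : ∀ᵐ v ∂H, v ∈ Icc c 1) {b : ℝ}
    (hb : (H.bind κ).real {b} ≠ 0) : ∃ v ∈ Icc c 1, v < b ∧ (b - v) * W b = V v := by
  have hq : ∀ᵐ v ∂H, v ≠ b := by simp [ae_iff]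
  obtain ⟨v, hv, hvb, b', hb', -, hle, ho⟩ := h.exists_opt_of_pos hc hH (measurableSet_singleton b)
    (fun h0 => hb (by simp [Measure.real, h0])) hq (p := fun _ => True) (by simp)
  obtain rfl : b' = b := hb'
  exact ⟨v, hv, lt_of_le_of_ne hle hvb, ho⟩

/-- Types below `v` bid at most as much as `v`. -/
lemma bind_Ioi_le {c : ℝ} (hc : 0 ≤ c) (hH : ∀ᵐ v ∂H, v ∈ Icc c 1) {v b : ℝ}
    (hv : v ∈ Icc (0 : ℝ) 1) (ho : (b - v) * W b = V v) (hV : 0 < V v) :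
    (H.bind κ).real (Ioi b) ≤ H.real (Ioi v) := by
  rw [← real_Ici_eq_Ioi H v]
  refine bind_real_le measurableSet_Ioi measurableSet_Ici (hH.mono fun u hu huv => ?_)
  have hu' : u ∈ Icc (0 : ℝ) 1 := ⟨hc.trans hu.1, hu.2⟩
  have : ∀ᵐ x ∂(κ u), x ∉ Ioi b := (h.ae_opt u hu').mono fun x hx hxb =>
    absurd (h.bid_mono_of_pos_right hu' hv (not_le.1 huv) hx.2 ho hV) (not_le.2 hxb)
  exact measure_eq_zero_iff_ae_notMem.2 this

/-- Types above `v` bid at least as much as `v`. -/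
lemma le_bind_Ici {c : ℝ} (hc : 0 ≤ c) (hH : ∀ᵐ v ∂H, v ∈ Icc c 1) {v b : ℝ}
    (hv : v ∈ Icc (0 : ℝ) 1) (ho : (b - v) * W b = V v) (hV : 0 < V v) :
    H.real (Ioi v) ≤ (H.bind κ).real (Ici b) := by
  have := bind_real_le (H := H) (κ := κ) (measurableSet_Iio (a := b)) (measurableSet_Iic (a := v))
    (hH.mono fun u hu huv => by
      have hu' : u ∈ Icc (0 : ℝ) 1 := ⟨hc.trans hu.1, hu.2⟩
      have : ∀ᵐ x ∂(κ u), x ∉ Iio b := (h.ae_opt u hu').mono fun x hx hxb =>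
        absurd (h.bid_mono_of_pos_left hv hu' (not_le.1 huv) ho hx.1 hx.2 hV) (not_le.2 hxb)
      exact measure_eq_zero_iff_ae_notMem.2 this)
  rw [← compl_Iic, ← compl_Iio, probReal_compl_eq_one_sub measurableSet_Iic,
    probReal_compl_eq_one_sub measurableSet_Iio]
  linarith

end BestResponse

/-! ### The symmetric auction among sellers -/

/-- An envelope formula that needs no derivative of `f`. The increments of `f` plus the primitive of
`g` are bounded by `(y - x) * (g x - g y)`, which is of smaller order than `y - x` by continuity of
`g`; a continuous function with zero right derivative is constant. -/
lemma sub_eq_integral_of_squeeze {f g : ℝ → ℝ} {a b : ℝ} (hab : a ≤ b) (hg : Continuous g)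
    (hlow : ∀ x ∈ Icc a b, ∀ y ∈ Icc a b, x < y → (y - x) * g y ≤ f x - f y)
    (hup : ∀ x ∈ Icc a b, ∀ y ∈ Icc a b, x < y → f x - f y ≤ (y - x) * g x) :
    f a - f b = ∫ x in a..b, g x := by
  set D : ℝ → ℝ := fun x => f x + ∫ t in a..x, g t with hD
  have hbd : ∀ x ∈ Icc a b, ∀ y ∈ Icc a b, x < y → |D y - D x| ≤ (y - x) * (g x - g y) := by
    have hanti : ∀ x ∈ Icc a b, ∀ y ∈ Icc a b, x ≤ y → g y ≤ g x := fun x hx y hy hxy => by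
      rcases hxy.eq_or_lt with rfl | hxy
      · exact le_rfl
      · exact le_of_mul_le_mul_left ((hlow x hx y hy hxy).trans (hup x hx y hy hxy))
          (sub_pos.2 hxy)
    intro x hx y hy hxy
    have hint : D y - D x = (∫ t in x..y, g t) - (f x - f y) := by
      have := intervalIntegral.integral_add_adjacent_intervals
        (hg.intervalIntegrable (μ := volume) a x) (hg.intervalIntegrable x y)
      simp only [hD]; linarith
    have h1 : ∫ t in x..y, g t ≤ (y - x) * g x := by
      have := intervalIntegral.integral_mono_on hxy.le (hg.intervalIntegrable (μ := volume) x y)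
        (intervalIntegrable_const (c := g x))
        fun t ht => hanti x hx t ⟨hx.1.trans ht.1, ht.2.trans hy.2⟩ ht.1
      simpa using this
    have h2 : (y - x) * g y ≤ ∫ t in x..y, g t := by
      have := intervalIntegral.integral_mono_on hxy.le (intervalIntegrable_const (c := g y))
        (hg.intervalIntegrable (μ := volume) x y)
        fun t ht => hanti t ⟨hx.1.trans ht.1, ht.2.trans hy.2⟩ y hy ht.2
      simpa using this
    rw [hint, abs_le]
    constructor <;> nlinarith [hlow x hx y hy hxy, hup x hx y hy hxy]
  have hderiv : ∀ x ∈ Ico a b, HasDerivWithinAt D 0 (Ici x) x := by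
    intro x hx
    rw [hasDerivWithinAt_iff_isLittleO, Asymptotics.isLittleO_iff]
    intro ε hε
    have h1 : ∀ᶠ y in 𝓝[Ici x] x, g x - g y < ε := by
      have : Tendsto (fun y => g x - g y) (𝓝[Ici x] x) (𝓝 (g x - g x)) :=
        (Continuous.tendsto (by fun_prop) x).mono_left nhdsWithin_le_nhds
      rw [sub_self] at this
      exact this.eventually (gt_mem_nhds hε)
    filter_upwards [h1, Ico_mem_nhdsGE hx.2] with y hy1 hy2
    rcases hy2.1.eq_or_lt with rfl | hxy
    · simp
    have := hbd x ⟨hx.1, hx.2.le⟩ y ⟨hx.1.trans hy2.1, hy2.2.le⟩ hxy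
    simp only [smul_zero, sub_zero, Real.norm_eq_abs, abs_of_pos (sub_pos.2 hxy)]
    nlinarith
  have hcont : ContinuousOn D (Icc a b) := by
    refine Metric.continuousOn_iff.2 fun x hx ε hε => ?_
    obtain ⟨δ, hδ, hδ'⟩ := Metric.continuous_iff.1
      (show Continuous fun y => |y - x| * |g x - g y| by fun_prop) x ε hε
    refine ⟨δ, hδ, fun y hy hd => lt_of_le_of_lt ?_ (by simpa using hδ' y hd)⟩
    rw [Real.dist_eq, ← abs_mul]
    rcases lt_trichotomy x y with hxy | rfl | hxy
    · exact (hbd x hx y hy hxy).trans (le_abs_self _)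
    · simp
    · rw [abs_sub_comm]
      refine (hbd y hy x hx hxy).trans ((le_of_eq ?_).trans (le_abs_self _))
      ring
  have := constant_of_has_deriv_right_zero hcont hderiv b ⟨hab, le_rfl⟩
  simp only [hD, intervalIntegral.integral_same, add_zero] at this
  linarith

section Symmetric

variable {r c : ℝ} {κ : Kernel ℝ ℝ} {V : ℝ → ℝ} {k : ℕ} {H : Measure ℝ} [IsProbabilityMeasure H]
  [NullSingletonClass H] [IsMarkovKernel κ]

/-- At an atom, undercutting wins at least whenever all rivals bid `b` or more, whereas bidding `b`
forfeits the fraction `1 - 1 / (k + 1)` of the event that all tie. This fraction is positive because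
there is a rival. -/
lemma bind_singleton_eq_zero (hk : 1 ≤ k) (hc : 0 ≤ c) (hH : ∀ᵐ v ∂H, v ∈ Icc c 1)
    (h : BestResponse r κ (winAlone r k (H.bind κ)) V) {b : ℝ} (hb : b ≤ r) :
    (H.bind κ).real {b} = 0 := by
  by_contra hne
  obtain ⟨v, hv, hvb, ho⟩ := h.exists_opt_of_atom hc hH hne
  have h1 := h.undercut ⟨hc.trans hv.1, hv.2⟩ hvb ho (w := (H.bind κ).real (Ici b) ^ k)
    fun b' hb' => (pow_le_pow_left₀ measureReal_nonneg
      (measureReal_mono (Ici_subset_Ioi.2 hb')) k).trans (le_winAlone (hb'.le.trans hb))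
  have h2 := winAlone_le (r := r) (k := k) (β := H.bind κ) b
  have h3 : 0 < (H.bind κ).real {b} ^ k :=
    pow_pos (lt_of_le_of_ne measureReal_nonneg (Ne.symm hne)) k
  have h4 : (0 : ℝ) < 1 - 1 / ((k : ℝ) + 1) := by
    have : (1 : ℝ) ≤ k := by exact_mod_cast hk
    rw [sub_pos, div_lt_one (by positivity)]; linarith
  nlinarith [mul_pos h4 h3]

/-- Revenue equivalence: payoff of the lowest type in the symmetric auction. -/
theorem symmetric_value (hk : 1 ≤ k) (hc : 0 ≤ c) (hcr : c ≤ r) (hr : r ≤ 1)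
    (hH : ∀ᵐ v ∂H, v ∈ Icc c 1) (hpos : ∀ b < r, 0 < H.real (Ioi b))
    (h : BestResponse r κ (winAlone r k (H.bind κ)) V) :
    V c = ∫ x in c..r, H.real (Ioi x) ^ k := by
  have hle : ∀ b ≤ r, H.real (Ioi b) ^ k ≤ winAlone r k (H.bind κ) b := fun b hb =>
    (pow_le_pow_left₀ measureReal_nonneg (h.le_bind_Ioi hc hH b) k).trans (le_winAlone hb)
  have hmem : ∀ x ∈ Icc c r, x ∈ Icc (0 : ℝ) 1 := fun x hx => ⟨hc.trans hx.1, hx.2.trans hr⟩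
  have hVpos : ∀ x ∈ Icc c r, x < r → 0 < V x := fun x hx hxr =>
    h.value_pos (b := (x + r) / 2) (hmem x hx) (by linarith)
      ((pow_pos (hpos _ (by linarith)) k).trans_le (hle _ (by linarith)))
  have hVr : V r = 0 := by
    have hr' := hmem r ⟨hcr, le_rfl⟩
    obtain ⟨b, hb, ho⟩ := h.exists_opt hr'
    rcases hb.eq_or_lt with rfl | hb
    · rw [← ho]; ring
    · rw [← ho, h.zero_above b hb, mul_zero]
  -- Monotonicity bounds the mass of rival bids above `b` from both sides by the mass of values
  -- above `x`; without an atom at `b` the two bounds coincide.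
  have hwin : ∀ x ∈ Icc c r, x < r → ∀ b, (b - x) * winAlone r k (H.bind κ) b = V x →
      winAlone r k (H.bind κ) b = H.real (Ioi x) ^ k := fun x hx hxr b ho => by
    have hV := hVpos x hx hxr
    have hb := h.le_reserve hV ho
    have h0 := bind_singleton_eq_zero hk hc hH h hb
    have h1 := h.bind_Ioi_le hc hH (hmem x hx) ho hV
    have h2 := h.le_bind_Ici hc hH (hmem x hx) ho hV
    rw [real_Ici_add, h0, add_zero] at h2
    rw [winAlone_of_atomless hb h0, le_antisymm h1 h2]
  have := sub_eq_integral_of_squeeze (f := V) (g := fun x => H.real (Ioi x) ^ k) hcr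
    ((continuous_real_Ioi H).pow k) (fun x hx y hy hxy => ?_) (fun x hx y hy hxy => ?_)
  · rwa [hVr, sub_zero] at this
  -- At `y = r` the payoff is zero and the optimal bid does not determine a winning probability, so
  -- the deviation of `x` to the bid `r` is used directly.
  · rcases hy.2.eq_or_lt with rfl | hyr
    · have := h.le_value x (hmem x hx) y
      rw [hVr, sub_zero]
      exact (mul_le_mul_of_nonneg_left (hle y le_rfl) (sub_nonneg.2 hxy.le)).trans this
    · obtain ⟨b, -, ho⟩ := h.exists_opt (hmem y hy)
      have := h.value_sub_le (hmem x hx) ho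
      rw [hwin y hy hyr b ho] at this
      linarith
  · obtain ⟨b, -, ho⟩ := h.exists_opt (hmem x hx)
    have := h.value_sub_le (hmem y hy) ho
    rwa [hwin x hx (hxy.trans_le hy.2) b ho] at this

end Symmetric

/-! ### The auction against the speculator -/

section Speculator

variable {r c U : ℝ} {κ : Kernel ℝ ℝ} {V : ℝ → ℝ} {τ : ℕ → ℝ} {k : ℕ} {H ν : Measure ℝ}
  [IsProbabilityMeasure H] [IsProbabilityMeasure ν] [NullSingletonClass H] [IsMarkovKernel κ]

/-- A lower bound valid below `t` passes to `t` from the left. -/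
lemma le_mul_of_forall_lt {a t w : ℝ} {f : ℝ → ℝ} (hf : Tendsto f (𝓝[<] t) (𝓝 w))
    (h : ∃ᶠ s in 𝓝[<] t, a ≤ f s) : a ≤ w := by
  by_contra hlt
  push Not at hlt
  exact h ((hf.eventually (gt_mem_nhds hlt)).mono fun s hs => not_le.2 hs)

lemma tendsto_real_Ici_left (β : Measure ℝ) [IsProbabilityMeasure β] (t : ℝ) :
    Tendsto (fun s => β.real (Ici s)) (𝓝[<] t) (𝓝 (β.real (Ici t))) := by
  have h := tendsto_measure_biInter_gt (μ := β.map Neg.neg) (s := fun x : ℝ => Iic x) (a := -t)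
    (fun _ _ => measurableSet_Iic.nullMeasurableSet) (fun i j _ hij => Iic_subset_Iic.2 hij)
    ⟨-t + 1, by linarith, measure_ne_top _ _⟩
  have hI : ⋂ x > -t, Iic x = Iic (-t) := by
    ext x
    simp only [mem_iInter, mem_Iic, gt_iff_lt]
    exact ⟨fun h => le_of_forall_gt_imp_ge_of_dense h, fun h y hy => h.trans hy.le⟩
  rw [hI] at h
  have h' := ((ENNReal.tendsto_toReal (measure_ne_top _ _)).comp h).comp
    (tendsto_neg_nhdsLT (a := t))
  simp only [Function.comp_def, Measure.map_apply measurable_neg measurableSet_Iic, neg_preimage,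
    neg_Iic, neg_neg] at h'
  exact h'

lemma frequently_nhdsLT_of_ess_sup {t : ℝ} (h0 : ν {t} = 0) (hs0 : ν (Ioi t) = 0)
    (hs1 : ∀ t' < t, ν (Ioi t') ≠ 0) {p : ℝ → Prop} (hp : ∀ᵐ s ∂ν, p s) :
    ∃ᶠ s in 𝓝[<] t, p s := by
  intro hcon
  obtain ⟨l, hl, hsub⟩ := (mem_nhdsLT_iff_exists_Ioo_subset).1 hcon
  refine hs1 l hl (measure_mono_null (t := {s | ¬ p s} ∪ ({t} ∪ Ioi t)) (fun s hs => ?_)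
    (measure_union_null (ae_iff.1 hp) (measure_union_null h0 hs0)))
  rcases lt_trichotomy s t with hst | hst | hst
  · exact Or.inl (hsub ⟨hs, hst⟩)
  · exact Or.inr (Or.inl hst)
  · exact Or.inr (Or.inr hst)

lemma real_Ioi_le_revenue_bound (hcr : c ≤ r) (hc : 0 ≤ c) {n : ℕ} {b : ℝ} (hb : b ∈ Icc c r) :
    b * H.real (Ioi b) ^ n ≤ sSup ((fun b => b * H.real (Ioi b) ^ n) '' Icc c r) :=
  le_csSup (isCompact_Icc.bddAbove_image
    (continuous_id.mul ((continuous_real_Ioi H).pow n)).continuousOn) ⟨b, hb, rfl⟩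

variable (hτ : ∀ k, τ k ∈ Icc (0 : ℝ) 1) (hc : 0 ≤ c) (hcr : c < r) (hr : r ≤ 1)
  (hH : ∀ᵐ v ∂H, v ∈ Icc c 1) (hpos : ∀ b < r, 0 < H.real (Ioi b))
  (h : BestResponse r κ (winSpec r τ k (H.bind κ) ν) V)
  (hU : ∀ s, s * specWin r τ (k + 1) (H.bind κ) s ≤ U)
  (hν : ∀ᵐ s ∂ν, 0 ≤ s ∧ s * specWin r τ (k + 1) (H.bind κ) s = U)
include hτ hc hcr hr hH hpos h hU hν

/-- Since sellers never bid below their values, the bid `b` wins at least whenever all values exceed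
`b`. -/
lemma revenue_le_specPayoff {b : ℝ} (hb : b ∈ Icc c r) :
    b * H.real (Ioi b) ^ (k + 1) ≤ U := by
  refine le_trans (mul_le_mul_of_nonneg_left ?_ (hc.trans hb.1)) (hU b)
  exact (pow_le_pow_left₀ measureReal_nonneg (h.le_bind_Ioi hc hH b) _).trans (le_specWin hτ hb.2)

lemma specPayoff_pos : 0 < U := by
  have hb : (c + r) / 2 ∈ Icc c r := ⟨by linarith, by linarith⟩
  refine lt_of_lt_of_le (mul_pos (by linarith) (pow_pos (hpos _ (by linarith)) _))
    (revenue_le_specPayoff hτ hc hcr hr hH hpos h hU hν hb)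

lemma ae_spec_mem : ∀ᵐ s ∂ν, s ∈ Icc U r := by
  have hU0 := specPayoff_pos hτ hc hcr hr hH hpos h hU hν
  filter_upwards [hν] with s hs
  have h1 : specWin r τ (k + 1) (H.bind κ) s ≤ 1 :=
    (specWin_le hτ s).trans (pow_le_one₀ measureReal_nonneg measureReal_le_one)
  refine ⟨by nlinarith [hs.1, hs.2], ?_⟩
  by_contra hsr
  have := hs.2
  rw [specWin_eq_zero (not_le.1 hsr), mul_zero] at this
  linarith

lemma le_specPayoff : c ≤ U := by
  have h1 : H.real (Ioi c) = 1 := by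
    rw [← real_Ici_eq_Ioi]
    have : H.real (Ici c) = H.real univ := measureReal_congr (by
      filter_upwards [hH] with v hv
      exact propext ⟨fun _ => trivial, fun _ => hv.1⟩)
    rw [this, probReal_univ]
  have := revenue_le_specPayoff hτ hc hcr hr hH hpos h hU hν (b := c) ⟨le_rfl, hcr.le⟩
  simpa [h1] using this

/-- The speculator earns no more than by posting a price for the values. -/
lemma exists_specPayoff_le : ∃ b ∈ Icc c r, U ≤ b * H.real (Ioi b) ^ (k + 1) := by
  set β := H.bind κ with hβ
  have hU0 := specPayoff_pos hτ hc hcr hr hH hpos h hU hν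
  have hcU := le_specPayoff hτ hc hcr hr hH hpos h hU hν
  obtain ⟨t, ht, ht0, ht1⟩ := exists_ess_sup ν (ae_spec_mem hτ hc hcr hr hH hpos h hU hν)
  have hct : c ≤ t := hcU.trans ht.1
  have hνt : ν.real (Ici t) = ν.real {t} := by
    rw [real_Ici_add]; simp [Measure.real, ht0]
  -- With `t` the top of the speculator's support, a bid halfway between `v` and `t` beats him with
  -- positive probability, and the other sellers as well since their bids exceed their values.
  have hVpos : ∀ v ∈ Icc (0 : ℝ) 1, v < t → 0 < V v := fun v hv hvt => by
    have hb : (v + t) / 2 < t := by linarith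
    refine h.value_pos (b := (v + t) / 2) hv (by linarith) (lt_of_lt_of_le ?_ (le_winSpec hτ _))
    refine mul_pos (ENNReal.toReal_pos (ht1 _ hb) (measure_ne_top _ _)) ?_
    have hbr : (v + t) / 2 < r := hb.trans_le ht.2
    exact (pow_pos ((hpos _ hbr).trans_le (h.le_bind_Ioi hc hH _)) k).trans_le (le_winAlone hbr.le)
  -- A bid above `t` loses for sure, so a type below `t`, whose payoff is positive, never makes one.
  have hβt : β.real (Ioi t) ≤ H.real (Ioi t) := by
    rw [← real_Ici_eq_Ioi H t]
    refine bind_real_le measurableSet_Ioi measurableSet_Ici (hH.mono fun u hu hut => ?_)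
    have hu' : u ∈ Icc (0 : ℝ) 1 := ⟨hc.trans hu.1, hu.2⟩
    refine measure_eq_zero_iff_ae_notMem.2 ((h.ae_opt u hu').mono fun x hx hxt => ?_)
    have hW := h.win_pos (hVpos u hu' (not_le.1 hut)) hx.2
    have hW' := winSpec_le_real (r := r) (k := k) (β := β) (ν := ν) hτ x
    have : ν.real (Ici x) = 0 := by
      simp [Measure.real, measure_mono_null (Ici_subset_Ioi.2 hxt) ht0]
    linarith
  refine ⟨t, ⟨hct, ht.2⟩, ?_⟩
  suffices hU' : U ≤ t * β.real (Ioi t) ^ (k + 1) from hU'.trans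
    (mul_le_mul_of_nonneg_left (pow_le_pow_left₀ measureReal_nonneg hβt _) (hc.trans hct))
  -- Without a seller atom at `t` the tail of the bid law is continuous there. Either optimal bids
  -- of the speculator accumulate at `t` from the left, or he has an atom at `t` and `t` itself is
  -- optimal.
  by_cases hatom : β.real {t} = 0
  · by_cases hνatom : ν {t} = 0
    · have hT : Tendsto (fun s => t * β.real (Ici s) ^ (k + 1)) (𝓝[<] t)
          (𝓝 (t * β.real (Ici t) ^ (k + 1))) := ((tendsto_real_Ici_left β t).pow _).const_mul _
      rw [real_Ici_add, hatom, add_zero] at hT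
      refine le_mul_of_forall_lt hT ((frequently_nhdsLT_of_ess_sup hνatom ht0 ht1
        hν).and_eventually self_mem_nhdsWithin |>.mono fun s hs => ?_)
      rw [← hs.1.2]
      exact mul_le_mul (le_of_lt hs.2) (specWin_le hτ s) (specWin_nonneg hτ s) (hc.trans hct)
    · have hs : t * specWin r τ (k + 1) β t = U := by
        by_contra hne
        exact hνatom (measure_eq_zero_iff_ae_notMem.2 (hν.mono fun s hs hs' => hne
          ((congrArg (fun s => s * specWin r τ (k + 1) β s) hs').symm.trans hs.2)))
      rw [← hs]
      have h1 := specWin_le (r := r) (m := k + 1) (β := β) hτ t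
      rw [real_Ici_add, hatom, add_zero] at h1
      exact mul_le_mul_of_nonneg_left h1 (hc.trans hct)
  · obtain ⟨v, hv, hvt, ho⟩ := h.exists_opt_of_atom hc hH hatom
    have hv' : v ∈ Icc (0 : ℝ) 1 := ⟨hc.trans hv.1, hv.2⟩
    have hW := h.win_pos (hVpos v hv' hvt) ho
    have hνpos : 0 < ν.real {t} := by
      have := hW.trans_le (winSpec_le_real hτ t)
      rwa [hνt] at this
    have hνatom : ν {t} ≠ 0 := fun h0 => by simp [Measure.real, h0] at hνpos
    have hs : t * specWin r τ (k + 1) β t = U := by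
      by_contra hne
      exact hνatom (measure_eq_zero_iff_ae_notMem.2 (hν.mono fun s hs hs' => hne
          ((congrArg (fun s => s * specWin r τ (k + 1) β s) hs').symm.trans hs.2)))
    -- A seller who bids `t` beats the speculator only through a tie, while slightly less wins
    -- whenever the speculator bids `t` and all rivals bid at least `t`.
    have h1 := h.undercut hv' hvt ho (w := ν.real {t} * β.real (Ici t) ^ k) fun b' hb' => by
      refine le_trans (mul_le_mul ?_ ?_ (by positivity) measureReal_nonneg) (le_winSpec hτ b')
      · exact measureReal_mono (by simpa using hb')
      · exact (pow_le_pow_left₀ measureReal_nonneg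
          (measureReal_mono (Ici_subset_Ioi.2 hb')) k).trans (le_winAlone (hb'.le.trans ht.2))
    have h2 : winSpec r τ k β ν t = ν.real {t} * winTied r τ k β t := by
      simp [winSpec, Measure.real, ht0]
    have h3 := winTied_le (r := r) (k := k) (β := β) hτ t
    rw [h2] at h1
    have h4 : 0 < β.real {t} ^ k := pow_pos (lt_of_le_of_ne measureReal_nonneg (Ne.symm hatom)) k
    have h5 : 1 - (1 - τ (k + 1)) / ((k : ℝ) + 1) ≤ 0 := by
      have := le_of_mul_le_mul_left h1 hνpos
      by_contra hcon
      nlinarith [mul_pos (not_le.1 hcon) h4]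
    -- The atom thus survives undercutting only if there is no rival seller and the speculator loses
    -- ties. Then his own bid `t` wins only against strictly higher bids, and the atom does not help
    -- him.
    have h6 : (k : ℝ) + τ (k + 1) ≤ 0 := by
      have hk : (0 : ℝ) < (k : ℝ) + 1 := by positivity
      rw [sub_nonpos, one_le_div hk] at h5
      linarith
    have hk0 : k = 0 := by
      have : (k : ℝ) ≤ 0 := by linarith [(hτ (k + 1)).1]
      exact_mod_cast le_antisymm this (Nat.cast_nonneg k)
    subst hk0
    have h7 : τ 1 = 0 := le_antisymm (by simpa using h6) (hτ 1).1
    rw [← hs]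
    simpa using mul_le_mul_of_nonneg_left (specWin_one_le (r := r) (β := β) hτ h7 t) (hc.trans hct)

lemma specPayoff_eq : U = sSup ((fun b => b * H.real (Ioi b) ^ (k + 1)) '' Icc c r) := by
  refine le_antisymm ?_ (csSup_le ((nonempty_Icc.2 hcr.le).image _) ?_)
  · obtain ⟨b, hb, hle⟩ := exists_specPayoff_le hτ hc hcr hr hH hpos h hU hν
    exact hle.trans (real_Ioi_le_revenue_bound hcr.le hc hb)
  · rintro _ ⟨b, hb, rfl⟩
    exact revenue_le_specPayoff hτ hc hcr hr hH hpos h hU hν hb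

/-- If `c` has a positive payoff from an optimal bid `b`, then all sellers bid at least `b` by
monotonicity. Any bid of the speculator below `b` wins for sure, so `b ≤ U`, while `c` earns at most
`b - c`. -/
lemma value_lowest_le : V c ≤ U - c := by
  have hc' : c ∈ Icc (0 : ℝ) 1 := ⟨hc, hcr.le.trans hr⟩
  have hcU := le_specPayoff hτ hc hcr hr hH hpos h hU hν
  rcases (h.value_nonneg hc').lt_or_eq with hV | hV
  · obtain ⟨b, hb, ho⟩ := h.exists_opt hc'
    have hbr := h.le_reserve hV ho
    have hY := h.le_bind_Ici hc hH hc' ho hV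
    have h1 : H.real (Ioi c) = 1 := by
      rw [← real_Ici_eq_Ioi]
      have : H.real (Ici c) = H.real univ := measureReal_congr (by
        filter_upwards [hH] with v hv
        exact propext ⟨fun _ => trivial, fun _ => hv.1⟩)
      rw [this, probReal_univ]
    have hbU : b ≤ U := by
      refine le_of_forall_lt_imp_le_of_dense fun b' hb' => ?_
      refine le_trans ?_ (hU b')
      by_cases hb0 : 0 ≤ b'
      · refine le_mul_of_one_le_right hb0 (le_trans ?_ (le_specWin hτ (hb'.le.trans hbr)))
        refine one_le_pow₀ (le_trans ?_ (measureReal_mono (Ici_subset_Ioi.2 hb')))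
        rwa [h1] at hY
      · push Not at hb0
        have h2 : specWin r τ (k + 1) (H.bind κ) b' ≤ 1 :=
          (specWin_le hτ b').trans (pow_le_one₀ measureReal_nonneg measureReal_le_one)
        nlinarith
    have := h.le_one b
    nlinarith
  · linarith

/-- Let `t` be the bottom of the speculator's support; `U ≤ t`, as he cannot earn more than his bid.
No seller bids below `t`, so a bid just below `t` wins for sure and gives `c` almost `t - c`. -/
lemma le_value_lowest : U - c ≤ V c := by
  set β := H.bind κ with hβ
  have hc' : c ∈ Icc (0 : ℝ) 1 := ⟨hc, hcr.le.trans hr⟩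
  have hU0 := specPayoff_pos hτ hc hcr hr hH hpos h hU hν
  obtain ⟨t, ht, ht0, ht1⟩ := exists_ess_inf ν (ae_spec_mem hτ hc hcr hr hH hpos h hU hν)
  have ht0' : 0 < t := hU0.trans_le ht.1
  have hνt : ∀ s ≤ t, ν.real (Ici s) = 1 := fun s hs => by
    have h1 : ν.real (Iio s) = 0 := by
      simp [Measure.real, measure_mono_null (Iio_subset_Iio hs) ht0]
    have := probReal_compl_eq_one_sub (μ := ν) (s := Iio s) measurableSet_Iio
    rwa [h1, compl_Iio, sub_zero] at this
  have hνt' : ∀ s < t, ν.real (Ioi s) = 1 := fun s hs => by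
    refine le_antisymm measureReal_le_one ?_
    rw [← hνt t le_rfl]
    exact measureReal_mono (Ici_subset_Ioi.2 hs)
  have hUt : U ≤ t * β.real (Ici t) ^ (k + 1) := by
    refine le_of_forall_gt_imp_ge_of_dense fun a ha => ?_
    have hY : 0 ≤ β.real (Ici t) ^ (k + 1) := by positivity
    have hY1 : β.real (Ici t) ^ (k + 1) ≤ 1 := pow_le_one₀ measureReal_nonneg measureReal_le_one
    -- The width of the interval equals the slack in the target. Since the tail probability is at
    -- most 1, an optimal bid in `[t, t')` earns at most `a`.
    set t' := t + (a - t * β.real (Ici t) ^ (k + 1)) with ht'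
    have hne : ν (Iio t') ≠ 0 := ht1 t' (by linarith)
    obtain ⟨s, hs, hst, hst'⟩ : ∃ s, (0 ≤ s ∧ s * specWin r τ (k + 1) β s = U) ∧ t ≤ s ∧ s < t' := by
      by_contra hcon
      push Not at hcon
      refine hne (measure_mono_null
        (t := {s | ¬ (0 ≤ s ∧ s * specWin r τ (k + 1) β s = U)} ∪ Iio t) (fun s hs => ?_)
        (measure_union_null (ae_iff.1 hν) ht0))
      by_cases h1 : 0 ≤ s ∧ s * specWin r τ (k + 1) β s = U
      · by_cases h2 : t ≤ s
        · exact absurd hs (not_lt.2 (hcon s h1 h2))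
        · exact Or.inr (not_le.1 h2)
      · exact Or.inl h1
    have h1 : specWin r τ (k + 1) β s ≤ β.real (Ici t) ^ (k + 1) :=
      (specWin_le hτ s).trans (pow_le_pow_left₀ measureReal_nonneg (antitone_real_Ici β hst) _)
    rw [← hs.2]
    have h2 := mul_le_mul_of_nonneg_left h1 hs.1
    nlinarith
  have hYt : 0 < β.real (Ici t) := by
    refine lt_of_le_of_ne measureReal_nonneg fun h0 => ?_
    rw [← h0, zero_pow (by omega), mul_zero] at hUt
    linarith
  -- Suppose some type optimally bids `b < t`, chosen so that the bid law charges `[b, t)`.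
  -- Preferring `b` to bids just below `t` bounds `t * Y(t) ^ k` by `b * Y(b) ^ k`, where `Y` is the
  -- tail of the bid law. Multiplying by the strictly larger tail at `b`, the speculator would earn
  -- more than `U` by undercutting `b`.
  have hnull : β (Iio t) = 0 := by
    by_contra hne
    obtain ⟨v, hv, -, b, hbt, hpb, hvb, ho⟩ := h.exists_opt_of_pos hc hH measurableSet_Iio hne
      (q := fun _ => True) (by simp) (ae_pos_Ico β t)
    have hbt : b < t := hbt
    have hv' : v ∈ Icc (0 : ℝ) 1 := ⟨hc.trans hv.1, hv.2⟩
    have hb0 : 0 ≤ b := hv'.1.trans hvb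
    have hYb : 0 < β.real (Ici b) := hYt.trans_le (antitone_real_Ici β hbt.le)
    have hWeq : ∀ s < t, winAlone r k β s ≤ winSpec r τ k β ν s := fun s hs => by
      have := le_winSpec (r := r) (k := k) (β := β) (ν := ν) hτ s
      rwa [hνt' s hs, one_mul] at this
    have hWle : winSpec r τ k β ν b ≤ β.real (Ici b) ^ k := by
      refine (winSpec_le hτ b).trans ?_
      rw [hνt b hbt.le, one_mul]
      exact winAlone_le_pow b
    have hstep : t * β.real (Ici t) ^ k ≤ b * β.real (Ici b) ^ k := by
      have hT : Tendsto (fun s => s * β.real (Ici t) ^ k) (𝓝[<] t)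
          (𝓝 (t * β.real (Ici t) ^ k)) :=
        (Continuous.tendsto (by fun_prop) t).mono_left nhdsWithin_le_nhds
      refine le_of_tendsto hT ?_
      filter_upwards [Ioo_mem_nhdsLT hbt] with s hs
      have h1 : β.real (Ici t) ^ k ≤ winSpec r τ k β ν s :=
        ((pow_le_pow_left₀ measureReal_nonneg (measureReal_mono (Ici_subset_Ioi.2 hs.2)) k).trans
          (le_winAlone (hs.2.le.trans ht.2))).trans (hWeq s hs.2)
      have h2 := h.le_value v hv' s
      rw [← ho] at h2
      have h3 := h.antitone hs.1.le
      calc s * β.real (Ici t) ^ k ≤ s * winSpec r τ k β ν s :=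
            mul_le_mul_of_nonneg_left h1 (hb0.trans hs.1.le)
        -- The type's preference for `b` extends to gross revenue because the value is nonnegative
        -- and the lower bid wins more often.
        _ ≤ b * winSpec r τ k β ν b := by nlinarith [hv'.1]
        _ ≤ _ := mul_le_mul_of_nonneg_left hWle hb0
    have hbpos : 0 < b := by
      refine lt_of_le_of_ne hb0 fun h0 => ?_
      rw [← h0, zero_mul] at hstep
      exact absurd hstep (not_le.2 (by positivity))
    have hUb : b * β.real (Ici b) ^ (k + 1) ≤ U := by
      have hT : Tendsto (fun s => s * β.real (Ici b) ^ (k + 1)) (𝓝[<] b)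
          (𝓝 (b * β.real (Ici b) ^ (k + 1))) :=
        (Continuous.tendsto (by fun_prop) b).mono_left nhdsWithin_le_nhds
      refine le_of_tendsto hT ?_
      filter_upwards [Ioo_mem_nhdsLT hbpos] with s hs
      refine le_trans (mul_le_mul_of_nonneg_left ?_ hs.1.le) (hU s)
      exact (pow_le_pow_left₀ measureReal_nonneg (measureReal_mono (Ici_subset_Ioi.2 hs.2)) _).trans
        (le_specWin hτ ((hs.2.trans hbt).le.trans ht.2))
    have hle : β.real (Ici b) ≤ β.real (Ici t) := by
      have h1 : b * β.real (Ici b) ^ (k + 1) ≤ b * β.real (Ici b) ^ k * β.real (Ici t) := by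
        refine (hUb.trans hUt).trans ?_
        rw [pow_succ, ← mul_assoc]
        exact mul_le_mul_of_nonneg_right hstep hYt.le
      rw [pow_succ, ← mul_assoc] at h1
      exact le_of_mul_le_mul_left h1 (by positivity)
    have hsplit : β.real (Ici b) = β.real (Ico b t) + β.real (Ici t) := by
      rw [← Ico_union_Ici_eq_Ici hbt.le, measureReal_union _ measurableSet_Ici]
      exact Set.disjoint_left.2 fun x hx hx' => absurd hx.2 (not_lt.2 hx')
    have : 0 < β.real (Ico b t) := ENNReal.toReal_pos (hpb hbt) (measure_ne_top _ _)
    linarith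
  have hT : Tendsto (fun s => s - c) (𝓝[<] t) (𝓝 (t - c)) :=
    (Continuous.tendsto (by fun_prop) t).mono_left nhdsWithin_le_nhds
  have : t - c ≤ V c := by
    refine le_of_tendsto hT ?_
    filter_upwards [self_mem_nhdsWithin] with s hs
    have hs : s < t := hs
    have h1 : β.real (Ici t) = 1 := by
      have := probReal_compl_eq_one_sub (μ := β) (s := Iio t) measurableSet_Iio
      rwa [show β.real (Iio t) = 0 by simp [Measure.real, hnull], compl_Iio, sub_zero] at this
    have h2 : 1 ≤ winSpec r τ k β ν s := by
      refine le_trans ?_ (le_winSpec hτ s)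
      rw [hνt' s hs, one_mul]
      refine le_trans ?_ (le_winAlone (hs.le.trans ht.2))
      refine one_le_pow₀ ?_
      rw [← h1]
      exact measureReal_mono (Ici_subset_Ioi.2 hs)
    have h3 := h.le_value c hc' s
    have h4 : winSpec r τ k β ν s = 1 := le_antisymm (h.le_one s) h2
    rwa [h4, mul_one] at h3
  linarith [ht.1]

/-- Payoff of the lowest type in the auction against the speculator. -/
theorem speculator_value :
    V c = sSup ((fun b => b * H.real (Ioi b) ^ (k + 1)) '' Icc c r) - c := by
  rw [← specPayoff_eq hτ hc hcr hr hH hpos h hU hν]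
  exact le_antisymm (value_lowest_le hτ hc hcr hr hH hpos h hU hν)
    (le_value_lowest hτ hc hcr hr hH hpos h hU hν)

end Speculator

/-! ### Binomial means -/

/-- Mean of `f` under the binomial law with `n` trials and success probability `x`. -/
def binomialMean (n : ℕ) (f : ℕ → ℝ) (x : ℝ) : ℝ :=
  ∑ m ∈ Finset.range (n + 1), (n.choose m : ℝ) * (x ^ m * (1 - x) ^ (n - m) * f m)

/-- Pascal's rule: condition on the outcome of one trial. It drives the induction for stochastic
monotonicity. -/
lemma binomialMean_succ (n : ℕ) (f : ℕ → ℝ) (x : ℝ) :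
    binomialMean (n + 1) f x =
      (1 - x) * binomialMean n f x + x * binomialMean n (fun m => f (m + 1)) x := by
  unfold binomialMean
  rw [Finset.sum_choose_succ_mul (fun i j => x ^ i * (1 - x) ^ j * f i) n, Finset.mul_sum,
    Finset.mul_sum]
  congr 1
  · refine Finset.sum_congr rfl fun i hi => ?_
    rw [Nat.succ_sub (Nat.lt_succ_iff.1 (Finset.mem_range.1 hi)), pow_succ]; ring
  · refine Finset.sum_congr rfl fun i hi => ?_
    rw [pow_succ]; ring

/-- The term of `n` successes is kept because it yields the strict inequalities: it is the event
that all other sellers reject. -/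
lemma binomialMean_mono {n : ℕ} {f g : ℕ → ℝ} {x : ℝ} (hx : x ∈ Icc (0 : ℝ) 1)
    (h : ∀ m ≤ n, g m ≤ f m) :
    binomialMean n g x + x ^ n * (f n - g n) ≤ binomialMean n f x := by
  have h1 : binomialMean n f x - binomialMean n g x =
      ∑ m ∈ Finset.range (n + 1), (n.choose m : ℝ) * (x ^ m * (1 - x) ^ (n - m) * (f m - g m)) := by
    unfold binomialMean
    rw [← Finset.sum_sub_distrib]
    exact Finset.sum_congr rfl fun i _ => by ring
  have h2 : 0 ≤ ∑ m ∈ Finset.range n,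
      (n.choose m : ℝ) * (x ^ m * (1 - x) ^ (n - m) * (f m - g m)) :=
    Finset.sum_nonneg fun m hm => mul_nonneg (Nat.cast_nonneg _) (mul_nonneg
      (mul_nonneg (pow_nonneg hx.1 _) (pow_nonneg (sub_nonneg.2 hx.2) _)) (sub_nonneg.2 (h m (Finset.mem_range.1 hm).le)))
  rw [Finset.sum_range_succ] at h1
  simp only [Nat.choose_self, Nat.cast_one, one_mul, Nat.sub_self, pow_zero, mul_one] at h1
  linarith

lemma binomialMean_antitone (n : ℕ) : ∀ {f : ℕ → ℝ}, Antitone f →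
    ∀ {x y : ℝ}, x ∈ Icc (0 : ℝ) 1 → y ∈ Icc (0 : ℝ) 1 → x ≤ y →
      binomialMean n f y ≤ binomialMean n f x := by
  induction n with
  | zero => intro f _ x y _ _ _; simp [binomialMean]
  | succ n ih =>
    intro f hf x y hx hy hxy
    have hf' : Antitone fun m => f (m + 1) := fun a b h => hf (Nat.succ_le_succ h)
    rw [binomialMean_succ, binomialMean_succ]
    have h1 := ih hf hx hy hxy
    have h2 := ih hf' hx hy hxy
    have h3 : binomialMean n (fun m => f (m + 1)) y ≤ binomialMean n f y := by
      have := binomialMean_mono (n := n) (f := f) hy fun m _ => hf (Nat.le_succ m)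
      nlinarith [mul_nonneg (pow_nonneg hy.1 n) (sub_nonneg.2 (hf (Nat.le_succ n)))]
    have h4 : binomialMean n (fun m => f (m + 1)) x ≤ binomialMean n f x := by
      have := binomialMean_mono (n := n) (f := f) hx fun m _ => hf (Nat.le_succ m)
      nlinarith [mul_nonneg (pow_nonneg hx.1 n) (sub_nonneg.2 (hf (Nat.le_succ n)))]
    nlinarith [mul_nonneg (sub_nonneg.2 hy.2) (sub_nonneg.2 h1), mul_nonneg hy.1 (sub_nonneg.2 h2),
      mul_nonneg (sub_nonneg.2 hxy) (sub_nonneg.2 h4)]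

lemma binomialMean_const (n : ℕ) (a x : ℝ) : binomialMean n (fun _ => a) x = a := by
  have h := add_pow x (1 - x) n
  rw [add_sub_cancel, one_pow] at h
  unfold binomialMean
  calc _ = a * ∑ m ∈ Finset.range (n + 1), x ^ m * (1 - x) ^ (n - m) * (n.choose m : ℝ) := by
        rw [Finset.mul_sum]; exact Finset.sum_congr rfl fun i _ => by ring
    _ = a := by rw [← h, mul_one]

lemma binomialMean_add_const (n : ℕ) (f : ℕ → ℝ) (a x : ℝ) :
    binomialMean n (fun m => f m + a) x = binomialMean n f x + a := by
  conv_rhs => rw [← binomialMean_const n a x]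
  unfold binomialMean
  rw [← Finset.sum_add_distrib]
  exact Finset.sum_congr rfl fun i _ => by ring

/-! ### The conditional distribution -/

section Conditional

variable {r c b : ℝ} {m : ℕ} {μ : Measure ℝ} [IsProbabilityMeasure μ]

lemma G_nonneg (h : c ≤ b) : 0 ≤ G μ c b :=
  div_nonneg (sub_nonneg.2 (monotone_cdf μ h)) (sub_nonneg.2 (cdf_le_one μ c))

lemma G_le_one : G μ c b ≤ 1 :=
  div_le_one_of_le₀ (sub_le_sub_right (cdf_le_one μ b) _) (sub_nonneg.2 (cdf_le_one μ c))

lemma G_self : G μ c c = 0 := by simp [G]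

lemma one_sub_G (h : cdf μ c < 1) : 1 - G μ c b = (1 - cdf μ b) / (1 - cdf μ c) := by
  have : (1 : ℝ) - cdf μ c ≠ 0 := (sub_pos.2 h).ne'
  unfold G
  field_simp
  ring

lemma cdf_lt_one (hF : StrictMonoOn (cdf μ) (Icc 0 r)) (hb0 : 0 ≤ b) (hb : b < r) :
    cdf μ b < 1 :=
  (hF ⟨hb0, hb.le⟩ ⟨hb0.trans hb.le, le_rfl⟩ hb).trans_le (cdf_le_one μ r)

lemma revenue_le (hb0 : 0 ≤ b) (h : c ≤ b) : revenue μ m c b ≤ b :=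
  mul_le_of_le_one_right hb0 (pow_le_one₀ (sub_nonneg.2 G_le_one)
    (sub_le_self _ (G_nonneg h)))

lemma bddAbove_revenue (hc : 0 ≤ c) : BddAbove (revenue μ m c '' Icc c r) := by
  refine ⟨r, ?_⟩
  rintro _ ⟨b, hb, rfl⟩
  exact (revenue_le (hc.trans hb.1) hb.1).trans hb.2

lemma revenue_le_bLow (hc : 0 ≤ c) (hb : b ∈ Icc c r) : revenue μ m c b ≤ bLow r μ m c :=
  le_csSup (bddAbove_revenue hc) ⟨b, hb, rfl⟩

lemma le_bLow (hc : 0 ≤ c) (hcr : c ≤ r) : c ≤ bLow r μ m c := by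
  have := revenue_le_bLow (μ := μ) (m := m) hc (b := c) ⟨le_rfl, hcr⟩
  simpa [revenue, G_self] using this

lemma bLow_le (hc : 0 ≤ c) (hcr : c ≤ r) : bLow r μ m c ≤ r := by
  refine csSup_le ((nonempty_Icc.2 hcr).image _) ?_
  rintro _ ⟨b, hb, rfl⟩
  exact (revenue_le (hc.trans hb.1) hb.1).trans hb.2

lemma bLow_antitone (hc : 0 ≤ c) (hcr : c ≤ r) : Antitone fun m => bLow r μ m c := by
  intro m n hmn
  refine csSup_le ((nonempty_Icc.2 hcr).image _) ?_
  rintro _ ⟨b, hb, rfl⟩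
  refine le_trans (mul_le_mul_of_nonneg_left ?_ (hc.trans hb.1)) (revenue_le_bLow (m := m) hc hb)
  exact pow_le_pow_of_le_one (sub_nonneg.2 G_le_one) (sub_le_self _ (G_nonneg hb.1)) hmn

/-- A posted price below `c'` yields at most `c'`, which is available at the cutoff `c'`. At a price
above `c'`, conditioning on values above the larger cutoff raises the probability of winning. -/
lemma bLow_mono {c' : ℝ} (hF : StrictMonoOn (cdf μ) (Icc 0 r)) (hc : 0 ≤ c) (hcc : c ≤ c')
    (hcr : c' ≤ r) : bLow r μ m c ≤ bLow r μ m c' := by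
  refine csSup_le ((nonempty_Icc.2 (hcc.trans hcr)).image _) ?_
  rintro _ ⟨b, hb, rfl⟩
  have hc' := hc.trans hcc
  rcases le_or_gt b c' with h | h
  · exact ((revenue_le (hc.trans hb.1) hb.1).trans h).trans (le_bLow hc' hcr)
  · refine le_trans ?_ (revenue_le_bLow (m := m) hc' ⟨h.le, hb.2⟩)
    refine mul_le_mul_of_nonneg_left (pow_le_pow_left₀ (sub_nonneg.2 G_le_one) ?_ m)
      (hc.trans hb.1)
    have h1 : cdf μ c' < 1 := cdf_lt_one hF hc' (h.trans_le hb.2)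
    have h2 := monotone_cdf μ hcc
    rw [one_sub_G h1, one_sub_G (h2.trans_lt h1)]
    exact div_le_div_of_nonneg_left (sub_nonneg.2 (cdf_le_one μ b)) (sub_pos.2 h1) (by linarith)

variable [NullSingletonClass μ]

lemma continuous_G : Continuous (G μ c) :=
  ((continuous_cdf_of_noAtoms μ).sub continuous_const).div_const _

lemma continuous_revenue : Continuous (revenue μ m c) :=
  continuous_id.mul ((continuous_const.sub continuous_G).pow m)

/-- Below `r`, factor out the power of `1 - F(c)` and replace `b` by `max b c`; the supremum then
runs over a fixed compact set and is continuous. At `r` the denominator may vanish, and the bounds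
`c ≤ bLow ≤ r` squeeze instead. -/
lemma continuousOn_bLow (hF : StrictMonoOn (cdf μ) (Icc 0 r)) (hr : 0 ≤ r) :
    ContinuousOn (bLow r μ m) (Icc 0 r) := by
  intro c hc
  rcases hc.2.eq_or_lt with rfl | hcr
  · refine tendsto_of_tendsto_of_tendsto_of_le_of_le'
      (g := fun x => x) (h := fun _ => c) ?_ ?_ ?_ ?_
    · have : bLow c μ m c = c := le_antisymm (bLow_le hr le_rfl) (le_bLow hr le_rfl)
      rw [this]
      exact tendsto_id.mono_left nhdsWithin_le_nhds
    · have : bLow c μ m c = c := le_antisymm (bLow_le hr le_rfl) (le_bLow hr le_rfl)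
      rw [this]
      exact tendsto_const_nhds
    · filter_upwards [self_mem_nhdsWithin] with x hx using le_bLow hx.1 hx.2
    · filter_upwards [self_mem_nhdsWithin] with x hx using bLow_le hx.1 hx.2
  · have hcF := continuous_cdf_of_noAtoms μ
    set M : ℝ → ℝ := fun c => sSup ((fun b => max b c * (1 - cdf μ (max b c)) ^ m) '' Icc 0 r)
      with hM
    have hMc : Continuous M := isCompact_Icc.continuous_sSup
      (f := fun c b => max b c * (1 - cdf μ (max b c)) ^ m) (by fun_prop)
    have heq : ∀ x ∈ Icc 0 r, x < r → bLow r μ m x = M x / (1 - cdf μ x) ^ m := by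
      intro x hx hxr
      have h1 : cdf μ x < 1 := cdf_lt_one hF hx.1 hxr
      have himg : revenue μ m x '' Icc x r = (fun t => ((1 - cdf μ x) ^ m)⁻¹ • t) ''
          ((fun b => max b x * (1 - cdf μ (max b x)) ^ m) '' Icc 0 r) := by
        rw [image_image]
        ext y
        constructor
        · rintro ⟨b, hb, rfl⟩
          refine ⟨b, ⟨hx.1.trans hb.1, hb.2⟩, ?_⟩
          simp only [max_eq_left hb.1, revenue, one_sub_G h1, div_pow, smul_eq_mul]
          ring
        · rintro ⟨b, hb, rfl⟩
          refine ⟨max b x, ⟨le_max_right _ _, max_le hb.2 hx.2⟩, ?_⟩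
          simp only [revenue, one_sub_G h1, div_pow, smul_eq_mul]
          ring
      rw [bLow, himg, image_smul, Real.sSup_smul_of_nonneg
        (inv_nonneg.2 (pow_nonneg (sub_nonneg.2 h1.le) m)), smul_eq_mul, div_eq_inv_mul]
    refine ContinuousWithinAt.congr_of_eventuallyEq (f := fun x => M x / (1 - cdf μ x) ^ m) ?_ ?_
      (heq c hc hcr)
    · have h1 : cdf μ c < 1 := cdf_lt_one hF hc.1 hcr
      exact (hMc.continuousAt.div (by fun_prop : Continuous fun x => (1 - cdf μ x) ^ m).continuousAt
        (pow_ne_zero _ (sub_pos.2 h1).ne')).continuousWithinAt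
    · filter_upwards [self_mem_nhdsWithin, mem_nhdsWithin_of_mem_nhds (Iio_mem_nhds hcr)] with
        x hx hxr using heq x hx hxr

end Conditional

/-! ### The cutoff -/

section Cutoff

variable {N : ℕ} {r p : ℝ} {μ : Measure ℝ} [IsProbabilityMeasure μ]

/-- The price at which a type `c` is indifferent if `c` is the cutoff. -/
def cutoffPrice (N : ℕ) (r : ℝ) (μ : Measure ℝ) (c : ℝ) : ℝ :=
  c + ((∫ x in c..r, (1 - cdf μ x) ^ (N - 1)) +
    ∑ m ∈ Finset.range (N - 1), ((N - 1).choose m : ℝ) * (1 - cdf μ c) ^ m *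
      cdf μ c ^ (N - 1 - m) * (bLow r μ (m + 1) c - c))

lemma indifference_iff {c : ℝ} : Indifference N r p μ c ↔ cutoffPrice N r μ c = p := by
  unfold Indifference cutoffPrice
  constructor <;> intro h <;> linarith

/-- Gross value of the lowest type when `m` other sellers reject, net of the symmetric auction. -/
def lowestGross (N : ℕ) (r : ℝ) (μ : Measure ℝ) (c : ℝ) (m : ℕ) : ℝ :=
  if m < N - 1 then bLow r μ (m + 1) c else c

/-- Absorbing the constant `c` into the binomial mean turns the net payoffs into gross values, which
are decreasing in the number of rejections. -/
lemma cutoffPrice_eq (c : ℝ) : cutoffPrice N r μ c =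
    binomialMean (N - 1) (lowestGross N r μ c) (1 - cdf μ c) +
      ∫ x in c..r, (1 - cdf μ x) ^ (N - 1) := by
  have h : binomialMean (N - 1) (lowestGross N r μ c) (1 - cdf μ c) -
      binomialMean (N - 1) (fun _ => c) (1 - cdf μ c) =
      ∑ m ∈ Finset.range (N - 1), ((N - 1).choose m : ℝ) * (1 - cdf μ c) ^ m *
      cdf μ c ^ (N - 1 - m) * (bLow r μ (m + 1) c - c) := by
    unfold binomialMean
    rw [← Finset.sum_sub_distrib, Finset.sum_range_succ]
    simp only [lowestGross, lt_irrefl, if_false, sub_self, add_zero, sub_sub_cancel]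
    refine Finset.sum_congr rfl fun m hm => ?_
    rw [if_pos (Finset.mem_range.1 hm)]; ring
  rw [binomialMean_const] at h
  unfold cutoffPrice
  linarith

variable (hN : 2 ≤ N) (hr0 : 0 < r) (hF : StrictMonoOn (cdf μ) (Icc 0 r))

lemma lowestGross_antitone {c : ℝ} (hc : c ∈ Icc 0 r) : Antitone (lowestGross N r μ c) := by
  intro m n hmn
  unfold lowestGross
  split_ifs with h1 h2 h2
  · exact bLow_antitone hc.1 hc.2 (Nat.succ_le_succ hmn)
  · omega
  · exact le_bLow hc.1 hc.2
  · exact le_rfl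

include hF in
lemma lowestGross_mono {c c' : ℝ} (hc : 0 ≤ c) (hcc : c ≤ c') (hcr : c' ≤ r) (m : ℕ) :
    lowestGross N r μ c m ≤ lowestGross N r μ c' m := by
  unfold lowestGross
  split_ifs
  · exact bLow_mono hF hc hcc hcr
  · exact hcc

variable [NullSingletonClass μ]

include hN hF in
-- A higher cutoff means fewer rejections and higher gross values, both raising the binomial mean.
-- The event that all others reject alone contributes `(c' - c) * (1 - F(c)) ^ (N - 1)`, which
-- strictly exceeds the loss in the integral because `F` is strictly increasing.
lemma cutoffPrice_strictMonoOn : StrictMonoOn (cutoffPrice N r μ) (Icc 0 r) := by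
  intro c hc c' hc' hlt
  have hcF := continuous_cdf_of_noAtoms μ
  have hmem : ∀ x, 1 - cdf μ x ∈ Icc (0 : ℝ) 1 := fun x =>
    ⟨sub_nonneg.2 (cdf_le_one μ x), sub_le_self _ (cdf_nonneg μ x)⟩
  rw [cutoffPrice_eq, cutoffPrice_eq]
  have h1 := binomialMean_antitone (N - 1) (lowestGross_antitone (N := N) (μ := μ) hc') (hmem c')
    (hmem c) (sub_le_sub_left (monotone_cdf μ hlt.le) _)
  have h2 := binomialMean_mono (n := N - 1) (hmem c)
    fun m _ => lowestGross_mono (N := N) hF hc.1 hlt.le hc'.2 m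
  have h3 : lowestGross N r μ c' (N - 1) - lowestGross N r μ c (N - 1) = c' - c := by
    simp [lowestGross]
  rw [h3] at h2
  have hcont : Continuous fun x => (1 - cdf μ x) ^ (N - 1) := by fun_prop
  have h4 := intervalIntegral.integral_add_adjacent_intervals
    (hcont.intervalIntegrable (μ := volume) c c') (hcont.intervalIntegrable c' r)
  have h5 : ∫ x in c..c', (1 - cdf μ x) ^ (N - 1) < ∫ x in c..c', (1 - cdf μ c) ^ (N - 1) := by
    refine intervalIntegral.integral_lt_integral_of_continuousOn_of_le_of_exists_lt hlt
      hcont.continuousOn continuousOn_const (fun x hx => ?_) ⟨c', ⟨hlt.le, le_rfl⟩, ?_⟩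
    · exact pow_le_pow_left₀ (hmem x).1 (sub_le_sub_left (monotone_cdf μ hx.1.le) _) _
    · exact pow_lt_pow_left₀ (sub_lt_sub_left (hF hc hc' hlt) _) (hmem c').1 (by omega)
  simp only [intervalIntegral.integral_const, smul_eq_mul] at h5
  linarith

include hN hF hr0 in
lemma cutoffPrice_continuousOn : ContinuousOn (cutoffPrice N r μ) (Icc 0 r) := by
  have hcF := continuous_cdf_of_noAtoms μ
  have hcont : Continuous fun x => (1 - cdf μ x) ^ (N - 1) := by fun_prop
  refine continuousOn_id.add (ContinuousOn.add ?_ ?_)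
  · have : (fun c => ∫ x in c..r, (1 - cdf μ x) ^ (N - 1)) =
        fun c => -∫ x in r..c, (1 - cdf μ x) ^ (N - 1) := by
      ext c; rw [intervalIntegral.integral_symm]
    rw [this]
    exact (intervalIntegral.continuous_primitive (fun a b => hcont.intervalIntegrable a b)
      r).neg.continuousOn
  · refine continuousOn_finsetSum _ fun m _ => ContinuousOn.mul ?_ ?_
    · exact Continuous.continuousOn (by fun_prop)
    · exact (continuousOn_bLow hF hr0.le).sub continuousOn_id

include hN in
lemma cutoffPrice_zero (h0 : cdf μ 0 = 0) : cutoffPrice N r μ 0 = piZero N r μ := by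
  have : ∀ m ∈ Finset.range (N - 1), ((N - 1).choose m : ℝ) * (1 - cdf μ 0) ^ m *
      cdf μ 0 ^ (N - 1 - m) * (bLow r μ (m + 1) 0 - 0) = 0 := fun m hm => by
    have := Finset.mem_range.1 hm
    rw [h0, zero_pow (by omega)]; ring
  unfold cutoffPrice piZero
  rw [Finset.sum_eq_zero this]; ring

include hr0 in
lemma cutoffPrice_reserve : cutoffPrice N r μ r = r := by
  have : ∀ m ∈ Finset.range (N - 1), ((N - 1).choose m : ℝ) * (1 - cdf μ r) ^ m *
      cdf μ r ^ (N - 1 - m) * (bLow r μ (m + 1) r - r) = 0 := fun m hm => by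
    rw [le_antisymm (bLow_le hr0.le le_rfl) (le_bLow hr0.le le_rfl), sub_self, mul_zero]
  unfold cutoffPrice
  rw [Finset.sum_eq_zero this, intervalIntegral.integral_same]; ring

include hN hr0 hF in
theorem exists_unique_cutoff (h0 : cdf μ 0 = 0) (hp : p ∈ Icc 0 r) :
    ∃ c, IsCutoff N r p μ c ∧ ∀ c', IsCutoff N r p μ c' → c' = c := by
  rcases le_or_gt p (piZero N r μ) with h | h
  · exact ⟨0, ⟨⟨le_rfl, hr0.le⟩, fun _ => rfl, fun h' => absurd h' (not_lt.2 h)⟩,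
      fun c' hc' => hc'.2.1 h⟩
  · have hivt := intermediate_value_Icc hr0.le (cutoffPrice_continuousOn hN hr0 hF)
    rw [cutoffPrice_zero hN h0, cutoffPrice_reserve hr0] at hivt
    obtain ⟨c, hc, hcp⟩ := hivt ⟨h.le, hp.2⟩
    refine ⟨c, ⟨hc, fun h' => absurd h (not_lt.2 h'), fun _ => indifference_iff.2 hcp⟩,
      fun c' hc' => ?_⟩
    exact (cutoffPrice_strictMonoOn hN hF).injOn hc'.1 hc
      ((indifference_iff.1 (hc'.2.2 h)).trans hcp.symm)

end Cutoff

/-! ### The belief -/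

section Belief

variable {r c : ℝ} {μ : Measure ℝ} [IsProbabilityMeasure μ] [NullSingletonClass μ]

lemma real_Ici_eq (c : ℝ) : μ.real (Ici c) = 1 - cdf μ c := by
  rw [real_Ici_eq_Ioi, real_Ioi_eq]

lemma measure_Ici_ne_zero (hc : cdf μ c < 1) : μ (Ici c) ≠ 0 := fun h => by
  have := real_Ici_eq (μ := μ) c
  rw [Measure.real, h] at this
  simp at this
  linarith

lemma isProbabilityMeasure_belief (hc : cdf μ c < 1) : IsProbabilityMeasure (cond μ (Ici c)) :=
  cond_isProbabilityMeasure (measure_Ici_ne_zero hc)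

instance : NullSingletonClass (cond μ (Ici c)) :=
  ⟨fun x => cond_absolutelyContinuous (measure_singleton x)⟩

lemma ae_belief_mem (hsupp : μ (Icc 0 1) = 1) : ∀ᵐ v ∂(cond μ (Ici c)), v ∈ Icc c 1 := by
  have h1 : ∀ᵐ v ∂μ, v ∈ Icc (0 : ℝ) 1 := (mem_ae_iff_prob_eq_one measurableSet_Icc).2 hsupp
  have h2 : ∀ᵐ v ∂(cond μ (Ici c)), v ∈ Ici c := ae_cond_mem measurableSet_Ici
  filter_upwards [cond_absolutelyContinuous.ae_le h1, h2] with v hv hv'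
  exact ⟨hv', hv.2⟩

lemma belief_real_Ioi (hc : cdf μ c < 1) {b : ℝ} (hb : c ≤ b) :
    (cond μ (Ici c)).real (Ioi b) = 1 - G μ c b := by
  rw [Measure.real, cond_apply measurableSet_Ici, ENNReal.toReal_mul, ENNReal.toReal_inv,
    ← measureReal_def, ← measureReal_def, real_Ici_eq, one_sub_G hc,
    inter_eq_right.2 ((Ioi_subset_Ici_iff).2 hb), real_Ioi_eq, div_eq_inv_mul]

lemma belief_real_Ioi_pos (hF : StrictMonoOn (cdf μ) (Icc 0 r)) (hc0 : 0 ≤ c)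
    (hc : cdf μ c < 1) {b : ℝ} (hb : b < r) : 0 < (cond μ (Ici c)).real (Ioi b) := by
  have := isProbabilityMeasure_belief hc
  rcases le_or_gt c b with h | h
  · rw [belief_real_Ioi hc h, one_sub_G hc]
    exact div_pos (sub_pos.2 (cdf_lt_one hF (hc0.trans h) hb)) (sub_pos.2 hc)
  · refine lt_of_lt_of_le ?_ (measureReal_mono (Ioi_subset_Ioi h.le))
    rw [belief_real_Ioi hc le_rfl, G_self]
    norm_num

lemma sSup_belief_eq_bLow (hc : cdf μ c < 1) (m : ℕ) :
    sSup ((fun b => b * (cond μ (Ici c)).real (Ioi b) ^ m) '' Icc c r) = bLow r μ m c := by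
  unfold bLow
  rw [image_congr fun b hb => by rw [belief_real_Ioi hc hb.1]]
  rfl

end Belief

/-! ### Equilibrium of the auctions -/

/-- Optimal undominated bidding at every history, without regard to the acceptance stage. -/
structure BiddingEquilibrium (N : ℕ) (r : ℝ) (τ : ℕ → ℝ) (σ : Profile) (bel : ℕ → Measure ℝ) :
    Prop where
  tie_mem : ∀ k, τ k ∈ Icc (0 : ℝ) 1
  bid_markov : ∀ m ∈ Icc 1 N, IsMarkovKernel (σ.bid m)
  spec_prob : ∀ m < N, IsProbabilityMeasure (σ.spec m)
  bel_prob : ∀ m ∈ Icc 1 N, IsProbabilityMeasure (bel m)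
  bid_optimal : ∀ m ∈ Icc 1 N, ∀ v ∈ Icc (0 : ℝ) 1, ∀ b : ℝ,
    sellerPayoff N r τ σ bel m v b ≤ sellerValue N r τ σ bel m v
  spec_optimal : ∀ m < N, ∀ b : ℝ,
    specPayoff r τ σ bel m b ≤ ∫ b', specPayoff r τ σ bel m b' ∂(σ.spec m)
  undominated : UndominatedBidding N σ

lemma sellerWin_of_lt {N : ℕ} {r : ℝ} {τ : ℕ → ℝ} {σ : Profile} {bel : ℕ → Measure ℝ} {m : ℕ}
    (hm : m < N) [IsProbabilityMeasure (σ.spec m)] (b : ℝ) :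
    sellerWin N r τ σ bel m b = winSpec r τ (m - 1) (bidLaw σ bel m) (σ.spec m) b := by
  unfold sellerWin
  rw [if_pos hm, integral_sellerShareSpec]

lemma sellerWin_self {N : ℕ} {r : ℝ} {τ : ℕ → ℝ} {σ : Profile} {bel : ℕ → Measure ℝ} (b : ℝ) :
    sellerWin N r τ σ bel N b = winAlone r (N - 1) (bidLaw σ bel N) b := by
  unfold sellerWin
  rw [if_neg (lt_irrefl N), winAlone]

namespace BiddingEquilibrium

variable {N : ℕ} {r : ℝ} {τ : ℕ → ℝ} {σ : Profile} {bel : ℕ → Measure ℝ}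
  (h : BiddingEquilibrium N r τ σ bel)
include h

lemma isProbabilityMeasure_bidLaw {m : ℕ} (hm : m ∈ Icc 1 N) :
    IsProbabilityMeasure (bidLaw σ bel m) := by
  have := h.bid_markov m hm
  have := h.bel_prob m hm
  unfold bidLaw
  infer_instance

lemma bestResponse {m : ℕ} (hm : m ∈ Icc 1 N) : BestResponse r (σ.bid m)
    (sellerWin N r τ σ bel m) (sellerValue N r τ σ bel m) := by
  have := h.bid_markov m hm
  have := h.isProbabilityMeasure_bidLaw hm
  rcases hm.2.lt_or_eq with hlt | rfl
  · have := h.spec_prob m hlt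
    have heq : sellerWin N r τ σ bel m = winSpec r τ (m - 1) (bidLaw σ bel m) (σ.spec m) :=
      funext fun b => sellerWin_of_lt hlt b
    refine .of_optimal ?_ ?_ ?_ ?_ (fun v _ => rfl) (h.bid_optimal m hm)
      (h.undominated.seller m hm) <;> rw [heq]
    · exact winSpec_antitone h.tie_mem
    · exact winSpec_nonneg h.tie_mem
    · exact winSpec_le_one h.tie_mem
    · exact fun b => winSpec_eq_zero h.tie_mem
  · have heq : sellerWin m r τ σ bel m = winAlone r (m - 1) (bidLaw σ bel m) :=
      funext fun b => sellerWin_self b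
    refine .of_optimal ?_ ?_ ?_ ?_ (fun v _ => rfl) (h.bid_optimal m hm)
      (h.undominated.seller m hm) <;> rw [heq]
    · exact winAlone_antitone
    · exact winAlone_nonneg
    · exact winAlone_le_one
    · exact fun b => winAlone_eq_zero

variable {c : ℝ} {μ : Measure ℝ} [IsProbabilityMeasure μ] [NullSingletonClass μ]
  (hN : 2 ≤ N) (hr1 : r ≤ 1) (hsupp : μ (Icc 0 1) = 1) (hF : StrictMonoOn (cdf μ) (Icc 0 r))
  (hc : c ∈ Icc 0 r) (hc1 : cdf μ c < 1)
include hN hr1 hsupp hF hc hc1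

/-- The factor in front is the probability that all others reject; it cancels the denominators of
the conditional distribution. -/
lemma value_symmetric (hbel : bel N = cond μ (Ici c)) :
    (1 - cdf μ c) ^ (N - 1) * sellerValue N r τ σ bel N c =
      ∫ x in c..r, (1 - cdf μ x) ^ (N - 1) := by
  have hNm : N ∈ Icc 1 N := ⟨by omega, le_rfl⟩
  have := isProbabilityMeasure_belief hc1
  have := h.bid_markov N hNm
  have hb := h.bestResponse hNm
  rw [show sellerWin N r τ σ bel N = winAlone r (N - 1) ((cond μ (Ici c)).bind (σ.bid N)) from
    funext fun b => by rw [sellerWin_self, bidLaw, hbel]] at hb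
  rw [symmetric_value (by omega) hc.1 hc.2 hr1 (ae_belief_mem hsupp)
    (fun b hb => belief_real_Ioi_pos hF hc.1 hc1 hb) hb, ← intervalIntegral.integral_const_mul]
  refine intervalIntegral.integral_congr fun x hx => ?_
  rw [uIcc_of_le hc.2] at hx
  have : (1 : ℝ) - cdf μ c ≠ 0 := (sub_pos.2 hc1).ne'
  simp only [belief_real_Ioi hc1 hx.1, one_sub_G hc1, ← mul_pow]
  congr 1
  field_simp

lemma value_speculator {m : ℕ} (hm : m ∈ Icc 1 N) (hlt : m < N)
    (hbel : bel m = cond μ (Ici c)) :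
    sellerValue N r τ σ bel m c = bLow r μ m c - c := by
  have := isProbabilityMeasure_belief hc1
  have := h.bid_markov m hm
  have := h.spec_prob m hlt
  have := h.isProbabilityMeasure_bidLaw hm
  have hb := h.bestResponse hm
  -- For `c = r` a seller can win only at a bid equal to his value, so both sides vanish;
  -- `speculator_value` needs `c < r`.
  rcases hc.2.eq_or_lt with rfl | hcr
  · rw [le_antisymm (bLow_le hc.1 le_rfl) (le_bLow hc.1 le_rfl), sub_self]
    obtain ⟨b, hcb, ho⟩ := hb.exists_opt ⟨hc.1, hr1⟩
    rcases hcb.eq_or_lt with rfl | hcb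
    · rw [← ho]; ring
    · rw [← ho, hb.zero_above b hcb, mul_zero]
  obtain ⟨k, rfl⟩ : ∃ k, m = k + 1 := ⟨m - 1, by have := hm.1; omega⟩
  have hlaw : bidLaw σ bel (k + 1) = (cond μ (Ici c)).bind (σ.bid (k + 1)) := by
    rw [bidLaw, hbel]
  rw [show sellerWin N r τ σ bel (k + 1) = winSpec r τ k ((cond μ (Ici c)).bind (σ.bid (k + 1)))
    (σ.spec (k + 1)) from funext fun b => by
      rw [sellerWin_of_lt hlt, hlaw]; rfl] at hb
  have hP : ∀ s, specPayoff r τ σ bel (k + 1) s =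
      s * specWin r τ (k + 1) ((cond μ (Ici c)).bind (σ.bid (k + 1))) s := fun s => by
    rw [← hlaw]; rfl
  have hU := h.spec_optimal (k + 1) hlt
  have hge : ∀ᵐ s ∂(σ.spec (k + 1)), 0 ≤ s := by
    refine (measure_eq_zero_iff_ae_notMem.1 (h.undominated.speculator (k + 1) hlt)).mono
      fun s hs => not_lt.1 hs
  have hae := ae_eq_value_of_le (P := σ.spec (k + 1))
    (f := fun s => specPayoff r τ σ bel (k + 1) s) (by
      simp only [hP]
      exact measurable_id.mul (specWin_antitone h.tie_mem).measurable) hU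
    (hge.mono fun s hs => by
      simp only [hP]
      exact mul_nonneg hs (specWin_nonneg h.tie_mem s))
  rw [speculator_value (U := ∫ s, specPayoff r τ σ bel (k + 1) s ∂(σ.spec (k + 1))) h.tie_mem hc.1
    hcr hr1 (ae_belief_mem hsupp) (fun b hb => belief_real_Ioi_pos hF hc.1 hc1 hb) hb
    (fun s => by rw [← hP]; exact hU s) (by
      filter_upwards [hge, hae] with s hs hs'
      exact ⟨hs, by rw [← hP]; exact hs'⟩), sSup_belief_eq_bLow hc1]

omit [NullSingletonClass μ] hN hr1 hsupp hF hc hc1 in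
lemma rejectValue_eq (hN : 2 ≤ N) (hacc : accProb μ σ = 1 - rejProb μ σ) (v : ℝ) :
    rejectValue N r μ τ σ bel v = binomialMean (N - 1)
      (fun k => sellerValue N r τ σ bel (k + 1) v) (rejProb μ σ) := by
  unfold rejectValue binomialMean
  rw [Finset.sum_range_succ, hacc]
  simp only [Nat.choose_self, Nat.cast_one, one_mul, Nat.sub_self, pow_zero, mul_one,
    Nat.sub_add_cancel (show 1 ≤ N by omega)]
  congr 1
  exact Finset.sum_congr rfl fun k _ => by ring

/-- Beliefs after a sale are needed only if sales have positive probability. If `F(c) = 0`, these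
histories carry weight zero, so arbitrary beliefs there do no harm. -/
lemma rejectValue_cutoff (hrej : rejProb μ σ = 1 - cdf μ c) (hacc : accProb μ σ = cdf μ c)
    (hbel : ∀ m ∈ Icc 1 N, (m < N → 0 < cdf μ c) → bel m = cond μ (Ici c)) :
    c + rejectValue N r μ τ σ bel c = cutoffPrice N r μ c := by
  unfold rejectValue cutoffPrice
  rw [hrej, hacc, h.value_symmetric hN hr1 hsupp hF hc hc1
    (hbel N ⟨by omega, le_rfl⟩ fun h => absurd h (lt_irrefl N)), add_comm (Finset.sum _ _)]
  congr 2
  refine Finset.sum_congr rfl fun k hk => ?_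
  have hk' := Finset.mem_range.1 hk
  rcases (cdf_nonneg μ c).eq_or_lt with h0 | h0
  · rw [← h0, zero_pow (by omega)]; ring
  · have hm : k + 1 ∈ Icc 1 N := ⟨by omega, by omega⟩
    rw [h.value_speculator hN hr1 hsupp hF hc hc1 hm (by omega) (hbel _ hm fun _ => h0)]

omit [NullSingletonClass μ] hr1 hsupp hF hc hc1 in
lemma rejectValue_antitone (hrej : rejProb μ σ ∈ Icc (0 : ℝ) 1)
    (hacc : accProb μ σ = 1 - rejProb μ σ) {v v' : ℝ} (hv : v ∈ Icc (0 : ℝ) 1)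
    (hv' : v' ∈ Icc (0 : ℝ) 1) (hle : v ≤ v') :
    rejectValue N r μ τ σ bel v' ≤ rejectValue N r μ τ σ bel v := by
  rw [h.rejectValue_eq hN hacc, h.rejectValue_eq hN hacc]
  have hm : ∀ k ≤ N - 1, k + 1 ∈ Icc 1 N := fun k hk => ⟨by omega, by omega⟩
  have key : ∀ k ≤ N - 1, sellerValue N r τ σ bel (k + 1) v' ≤ sellerValue N r τ σ bel (k + 1) v :=
    fun k hk => by
      have := h.bid_markov _ (hm k hk)
      exact (h.bestResponse (hm k hk)).value_antitone hv hv' hle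
  have := binomialMean_mono hrej key
  nlinarith [mul_nonneg (pow_nonneg hrej.1 (N - 1)) (sub_nonneg.2 (key (N - 1) le_rfl))]

omit [NullSingletonClass μ] hr1 hsupp hF hc hc1 in
-- Each auction payoff falls with slope at least -1 in the value. The slack at the history where
-- nobody sold is retained to exclude indifference of many types.
lemma rejectValue_sub_le (hrej : rejProb μ σ ∈ Icc (0 : ℝ) 1)
    (hacc : accProb μ σ = 1 - rejProb μ σ) {v v' : ℝ} (hv : v ∈ Icc (0 : ℝ) 1)
    (hv' : v' ∈ Icc (0 : ℝ) 1) (hle : v ≤ v') :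
    rejectValue N r μ τ σ bel v - rejectValue N r μ τ σ bel v' +
      rejProb μ σ ^ (N - 1) *
        (v' - v - (sellerValue N r τ σ bel N v - sellerValue N r τ σ bel N v')) ≤ v' - v := by
  rw [h.rejectValue_eq hN hacc, h.rejectValue_eq hN hacc]
  have hm : ∀ k ≤ N - 1, k + 1 ∈ Icc 1 N := fun k hk => ⟨by omega, by omega⟩
  have key : ∀ k ≤ N - 1, sellerValue N r τ σ bel (k + 1) v ≤
      sellerValue N r τ σ bel (k + 1) v' + (v' - v) := fun k hk => by
      have := h.bid_markov _ (hm k hk)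
      linarith [(h.bestResponse (hm k hk)).value_sub_le_sub hv hv' hle]
  have := binomialMean_mono hrej key
  rw [binomialMean_add_const, Nat.sub_add_cancel (show 1 ≤ N by omega)] at this
  linarith

omit [NullSingletonClass μ] hr1 hsupp hF hc hc1 in
lemma rejectValue_sub_le_sub (hrej : rejProb μ σ ∈ Icc (0 : ℝ) 1)
    (hacc : accProb μ σ = 1 - rejProb μ σ) {v v' : ℝ} (hv : v ∈ Icc (0 : ℝ) 1)
    (hv' : v' ∈ Icc (0 : ℝ) 1) (hle : v ≤ v') :
    rejectValue N r μ τ σ bel v - rejectValue N r μ τ σ bel v' ≤ v' - v := by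
  have hNm : N ∈ Icc 1 N := ⟨by omega, le_rfl⟩
  have := h.bid_markov N hNm
  have h1 := (h.bestResponse hNm).value_sub_le_sub hv hv' hle
  have h2 := h.rejectValue_sub_le hN hrej hacc hv hv' hle
  nlinarith [mul_nonneg (pow_nonneg hrej.1 (N - 1)) (sub_nonneg.2 h1)]

omit [NullSingletonClass μ] hr1 hsupp hF hc hc1 in
lemma rejectValue_nonneg (hrej : rejProb μ σ ∈ Icc (0 : ℝ) 1)
    (hacc : accProb μ σ = 1 - rejProb μ σ) {v : ℝ} (hv : v ∈ Icc (0 : ℝ) 1) :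
    0 ≤ rejectValue N r μ τ σ bel v := by
  rw [h.rejectValue_eq hN hacc]
  have key : ∀ k ≤ N - 1, (0 : ℝ) ≤ sellerValue N r τ σ bel (k + 1) v := fun k hk =>
    (h.bestResponse (m := k + 1) ⟨by omega, by omega⟩).value_nonneg hv
  have := binomialMean_mono hrej key
  rw [binomialMean_const] at this
  nlinarith [mul_nonneg (pow_nonneg hrej.1 (N - 1)) (key (N - 1) le_rfl)]

end BiddingEquilibrium

/-- Almost every bid has positive mass of the bid law weakly below it, and by the absence of atoms
this mass wins against it. -/
lemma ae_winAlone_lt_one {r c : ℝ} {κ : Kernel ℝ ℝ} {V : ℝ → ℝ} {k : ℕ} {H : Measure ℝ}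
    [IsProbabilityMeasure H] [NullSingletonClass H] [IsMarkovKernel κ] (hk : 1 ≤ k) (hc : 0 ≤ c)
    (hH : ∀ᵐ v ∂H, v ∈ Icc c 1) (h : BestResponse r κ (winAlone r k (H.bind κ)) V) :
    ∀ᵐ b ∂(H.bind κ), winAlone r k (H.bind κ) b < 1 := by
  filter_upwards [ae_pos_Iic (H.bind κ)] with b hb
  rcases le_or_gt b r with hbr | hbr
  · rw [winAlone_of_atomless hbr (bind_singleton_eq_zero hk hc hH h hbr)]
    refine pow_lt_one₀ measureReal_nonneg ?_ (by omega)
    rw [← compl_Iic, probReal_compl_eq_one_sub measurableSet_Iic]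
    have : 0 < (H.bind κ).real (Iic b) := ENNReal.toReal_pos hb (measure_ne_top _ _)
    linarith
  · rw [winAlone_eq_zero hbr]; exact zero_lt_one

/-! ### Acceptance probabilities and posteriors -/

section Acceptance

variable {c : ℝ} {μ : Measure ℝ} [IsProbabilityMeasure μ] {σ : Profile}

lemma integrable_accept (hm : Measurable σ.accept) (h : ∀ᵐ v ∂μ, σ.accept v ∈ Icc (0 : ℝ) 1) :
    Integrable σ.accept μ :=
  Integrable.of_bound hm.aestronglyMeasurable 1
    (h.mono fun v hv => by rw [Real.norm_of_nonneg hv.1]; exact hv.2)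

lemma rejProb_eq (hm : Measurable σ.accept) (h : ∀ᵐ v ∂μ, σ.accept v ∈ Icc (0 : ℝ) 1) :
    rejProb μ σ = 1 - accProb μ σ := by
  unfold rejProb accProb
  rw [integral_sub (integrable_const _) (integrable_accept hm h)]
  simp

variable [NullSingletonClass μ]

lemma accProb_of_cutoff (h : ∀ᵐ v ∂μ, σ.accept v = if v < c then 1 else 0) :
    accProb μ σ = cdf μ c := by
  have h1 : accProb μ σ = ∫ v, (Iio c).indicator 1 v ∂μ :=
    integral_congr_ae (h.mono fun v hv => by
      rw [hv]; by_cases hvc : v < c <;> simp [indicator, hvc])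
  rw [h1, integral_indicator_one measurableSet_Iio, cdf_eq_real]
  exact measureReal_congr Iio_ae_eq_Iic

lemma posterior_of_cutoff (h : ∀ᵐ v ∂μ, σ.accept v = if v < c then 1 else 0) :
    posterior μ σ = cond μ (Ici c) := by
  have h1 : (fun v => ENNReal.ofReal (1 - σ.accept v)) =ᵐ[μ] (Ici c).indicator 1 :=
    h.mono fun v hv => by
      simp only [hv]; by_cases hvc : v < c <;> simp [indicator, hvc, not_le.2, not_lt.1]
  unfold posterior
  rw [lintegral_congr_ae h1, withDensity_congr_ae h1, lintegral_indicator_one measurableSet_Ici,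
    withDensity_indicator_one measurableSet_Ici]
  rfl

lemma posterior_absolutelyContinuous : posterior μ σ ≪ μ :=
  (withDensity_absolutelyContinuous _ _).smul_left _

/-- The posterior has a density positive exactly on the types that reject with positive probability.
Finiteness of the normalizing integral keeps its inverse from being zero. -/
lemma ae_posterior_iff (hm : Measurable σ.accept)
    (hrej : ∫⁻ v, ENNReal.ofReal (1 - σ.accept v) ∂μ ≠ ⊤) {q : ℝ → Prop}
    (hq : ∀ᵐ v ∂(posterior μ σ), q v) : ∀ᵐ v ∂μ, σ.accept v < 1 → q v := by
  unfold posterior at hq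
  have h1 := (Measure.ae_ennreal_smul_measure_iff (ENNReal.inv_ne_zero.2 hrej)).1 hq
  rw [ae_withDensity_iff (by fun_prop)] at h1
  filter_upwards [h1] with v hv hv'
  exact hv (by simpa using hv')

end Acceptance

/-! ### Every symmetric equilibrium uses the cutoff -/

lemma IsSymmetricPBE.biddingEquilibrium {N : ℕ} {r p : ℝ} {μ : Measure ℝ} {τ : ℕ → ℝ} {σ : Profile}
    {bel : ℕ → Measure ℝ} (h : IsSymmetricPBE N r p μ τ σ bel) (hu : UndominatedBidding N σ)
    (hτ : ∀ k, τ k ∈ Icc (0 : ℝ) 1) : BiddingEquilibrium N r τ σ bel :=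
  ⟨hτ, h.bid_markov, h.spec_prob, h.bel_prob, h.bid_optimal, h.spec_optimal, hu⟩

section Uniqueness

variable {N : ℕ} {r p : ℝ} {μ : Measure ℝ} [IsProbabilityMeasure μ] [NullSingletonClass μ]
  {τ : ℕ → ℝ} {σ : Profile} {bel : ℕ → Measure ℝ}
  (hN : 2 ≤ N) (hr0 : 0 < r) (hr1 : r ≤ 1) (hsupp : μ (Icc 0 1) = 1)
  (hF : StrictMonoOn (cdf μ) (Icc 0 r)) (hp : p ∈ Icc 0 r) (hτ : ∀ k, τ k ∈ Icc (0 : ℝ) 1)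

include hsupp in
lemma cdf_zero_eq_zero : cdf μ 0 = 0 := by
  have h1 : ∀ᵐ v ∂μ, v ∈ Icc (0 : ℝ) 1 := (mem_ae_iff_prob_eq_one measurableSet_Icc).2 hsupp
  have h2 : μ (Iio 0) = 0 := measure_eq_zero_iff_ae_notMem.2
    (h1.mono fun v hv hv' => absurd hv.1 (not_le.2 hv'))
  rw [cdf_eq_real, Measure.real, ← measure_congr (Iio_ae_eq_Iic (μ := μ) (a := 0)), h2]
  rfl

lemma accept_eq_one (h : IsSymmetricPBE N r p μ τ σ bel) {v : ℝ} (hv : v ∈ Icc (0 : ℝ) 1)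
    (hD : 0 < p - v - rejectValue N r μ τ σ bel v) : σ.accept v = 1 := by
  have h1 := h.accept_optimal v hv 1 ⟨zero_le_one, le_rfl⟩
  have h2 := h.accept_mem v hv
  refine le_antisymm h2.2 ?_
  nlinarith

lemma accept_eq_zero (h : IsSymmetricPBE N r p μ τ σ bel) {v : ℝ} (hv : v ∈ Icc (0 : ℝ) 1)
    (hD : p - v - rejectValue N r μ τ σ bel v < 0) : σ.accept v = 0 := by
  have h1 := h.accept_optimal v hv 0 ⟨le_rfl, zero_le_one⟩
  have h2 := h.accept_mem v hv
  refine le_antisymm ?_ h2.1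
  nlinarith

include hN hr0 hr1 hsupp hF hp hτ

/-- If all sellers sell, the price and the cutoff are at the reserve price. -/
lemma exists_cutoff_of_rejProb_eq_zero (h : IsSymmetricPBE N r p μ τ σ bel)
    (hu : UndominatedBidding N σ) (hrej : rejProb μ σ = 0) :
    ∃ c, IsCutoff N r p μ c ∧ ∀ᵐ v ∂μ, σ.accept v = if v < c then 1 else 0 := by
  have hB := h.biddingEquilibrium hu hτ
  have hmem : ∀ᵐ v ∂μ, v ∈ Icc (0 : ℝ) 1 := (mem_ae_iff_prob_eq_one measurableSet_Icc).2 hsupp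
  have hacc_mem : ∀ᵐ v ∂μ, σ.accept v ∈ Icc (0 : ℝ) 1 := hmem.mono h.accept_mem
  have hsum := rejProb_eq h.accept_measurable hacc_mem
  have hacc : accProb μ σ = 1 - rejProb μ σ := by linarith
  have hone : ∀ᵐ v ∂μ, σ.accept v = 1 := by
    have := (integral_eq_zero_iff_of_nonneg_ae (μ := μ) (f := fun v => 1 - σ.accept v)
      (hacc_mem.mono fun v hv => sub_nonneg.2 hv.2)
      ((integrable_const _).sub (integrable_accept h.accept_measurable hacc_mem))).1 hrej
    exact this.mono fun v hv => by simp only [Pi.zero_apply] at hv; linarith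
  have hle : ∀ᵐ v ∂μ, v ≤ p := by
    filter_upwards [hmem, hone] with v hv hv1
    by_contra hvp
    have hR := hB.rejectValue_nonneg (μ := μ) hN (by rw [hrej]; exact ⟨le_rfl, zero_le_one⟩) hacc hv
    rw [accept_eq_zero h hv (by linarith)] at hv1
    exact zero_ne_one hv1
  have hFp : cdf μ p = 1 := by
    rw [cdf_eq_real, measureReal_def, (mem_ae_iff_prob_eq_one measurableSet_Iic).1 hle]
    rfl
  -- Values are almost surely at most `p`, while `F` stays below 1 before `r`.
  have hpr : p = r := by
    by_contra hne
    exact (cdf_lt_one hF hp.1 (lt_of_le_of_ne hp.2 hne)).ne hFp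
  subst hpr
  refine ⟨p, ⟨⟨hr0.le, le_rfl⟩, fun h0 => ?_, fun _ => indifference_iff.2
    (cutoffPrice_reserve hr0)⟩, ?_⟩
  · have := cutoffPrice_strictMonoOn (N := N) hN hF ⟨le_rfl, hr0.le⟩ ⟨hr0.le, le_rfl⟩ hr0
    rw [cutoffPrice_zero hN (cdf_zero_eq_zero hsupp), cutoffPrice_reserve hr0] at this
    linarith
  · have hne : ∀ᵐ v ∂μ, v ≠ p := by simp [ae_iff]
    filter_upwards [hone, hle, hne] with v h1 h2 h3
    rw [h1, if_pos (lt_of_le_of_ne h2 h3)]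

/-- If no seller sells, the cutoff vanishes. -/
lemma exists_cutoff_of_accProb_eq_zero (h : IsSymmetricPBE N r p μ τ σ bel)
    (hu : UndominatedBidding N σ) (hacc0 : accProb μ σ = 0) :
    ∃ c, IsCutoff N r p μ c ∧ ∀ᵐ v ∂μ, σ.accept v = if v < c then 1 else 0 := by
  have hB := h.biddingEquilibrium hu hτ
  have hmem : ∀ᵐ v ∂μ, v ∈ Icc (0 : ℝ) 1 := (mem_ae_iff_prob_eq_one measurableSet_Icc).2 hsupp
  have hacc_mem : ∀ᵐ v ∂μ, σ.accept v ∈ Icc (0 : ℝ) 1 := hmem.mono h.accept_mem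
  have hsum := rejProb_eq h.accept_measurable hacc_mem
  have hacc : accProb μ σ = 1 - rejProb μ σ := by linarith
  have hrej1 : rejProb μ σ = 1 := by linarith
  have hzero : ∀ᵐ v ∂μ, σ.accept v = 0 :=
    (integral_eq_zero_iff_of_nonneg_ae (hacc_mem.mono fun v hv => hv.1)
      (integrable_accept h.accept_measurable hacc_mem)).1 hacc0
  have hcut : ∀ᵐ v ∂μ, σ.accept v = if v < 0 then 1 else 0 := by
    filter_upwards [hmem, hzero] with v hv hv0
    rw [hv0, if_neg (not_lt.2 hv.1)]
  have h0 := cdf_zero_eq_zero hsupp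
  have hpost := posterior_of_cutoff hcut
  have hR := hB.rejectValue_cutoff (c := 0) (μ := μ) hN hr1 hsupp hF ⟨le_rfl, hr0.le⟩
    (by rw [h0]; exact zero_lt_one) (by rw [h0, hrej1, sub_zero]) (by rw [h0, hacc0])
    (fun m hm hm' => by
      rw [← hpost]
      exact h.bayes m hm (by rw [hrej1]; exact zero_lt_one) fun hlt => by
        have := hm' hlt; rw [h0] at this; exact absurd this (lt_irrefl _))
  rw [cutoffPrice_zero hN h0, zero_add] at hR
  have hp0 : p ≤ piZero N r μ := by
    by_contra hlt
    push Not at hlt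
    -- Types below `p - piZero` strictly prefer to sell, since rejecting is worth at most `piZero`.
    -- The minimum with `r` keeps `e` where `F` is strictly increasing, so that these types have
    -- positive probability.
    set e := min (p - piZero N r μ) r with he
    have he0 : 0 < e := lt_min (sub_pos.2 hlt) hr0
    have hnull : ∀ᵐ v ∂μ, v ∉ Iio e := by
      filter_upwards [hmem, hzero] with v hv hv0 hve
      have h1 := hB.rejectValue_antitone (μ := μ) hN
        (by rw [hrej1]; exact ⟨zero_le_one, le_rfl⟩) hacc (v := 0) ⟨le_rfl, zero_le_one⟩ hv hv.1
      rw [hR] at h1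
      have h2 : v < p - piZero N r μ := lt_of_lt_of_le hve (min_le_left _ _)
      rw [accept_eq_one h hv (by linarith)] at hv0
      exact one_ne_zero hv0
    have h1 : cdf μ e = 0 := by
      rw [cdf_eq_real, measureReal_def, ← measure_congr (Iio_ae_eq_Iic (μ := μ) (a := e)),
        measure_eq_zero_iff_ae_notMem.2 hnull]
      rfl
    have h2 := hF ⟨le_rfl, hr0.le⟩ ⟨he0.le, min_le_right _ _⟩ he0
    rw [h0, h1] at h2
    exact lt_irrefl _ h2
  exact ⟨0, ⟨⟨le_rfl, hr0.le⟩, fun _ => rfl, fun h' => absurd h' (not_lt.2 hp0)⟩, hcut⟩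

/-- Almost all indifferent types accept. -/
lemma ae_accept_of_indifferent (h : IsSymmetricPBE N r p μ τ σ bel)
    (hu : UndominatedBidding N σ) (hrej : 0 < rejProb μ σ) :
    ∀ᵐ v ∂μ, p - v - rejectValue N r μ τ σ bel v = 0 → σ.accept v = 1 := by
  have hB := h.biddingEquilibrium hu hτ
  have hmem : ∀ᵐ v ∂μ, v ∈ Icc (0 : ℝ) 1 := (mem_ae_iff_prob_eq_one measurableSet_Icc).2 hsupp
  have hacc_mem : ∀ᵐ v ∂μ, σ.accept v ∈ Icc (0 : ℝ) 1 := hmem.mono h.accept_mem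
  have hsum := rejProb_eq h.accept_measurable hacc_mem
  have hacc : accProb μ σ = 1 - rejProb μ σ := by linarith
  have hacc0 : 0 ≤ accProb μ σ := integral_nonneg_of_ae (hacc_mem.mono fun v hv => hv.1)
  have hrejm : rejProb μ σ ∈ Icc (0 : ℝ) 1 := ⟨hrej.le, by linarith⟩
  have hNm : N ∈ Icc 1 N := ⟨by omega, le_rfl⟩
  have hbel := h.bayes N hNm hrej fun h' => absurd h' (lt_irrefl N)
  have := h.bid_markov N hNm
  have := h.bel_prob N hNm
  have hb := hB.bestResponse hNm
  rw [show sellerWin N r τ σ bel N = winAlone r (N - 1) ((bel N).bind (σ.bid N)) from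
    funext fun b => by rw [sellerWin_self, bidLaw]] at hb
  have hac : bel N ≪ μ := hbel ▸ posterior_absolutelyContinuous
  have : NullSingletonClass (bel N) := ⟨fun x => hac (measure_singleton x)⟩
  have hmemB : ∀ᵐ v ∂(bel N), v ∈ Icc (0 : ℝ) 1 := hac.ae_le hmem
  have hlt := Measure.ae_ae_of_ae_comp (ae_winAlone_lt_one (by omega) le_rfl hmemB hb)
  -- Two indifferent types `v < v'` would make the value of rejecting fall with slope exactly -1
  -- between them. The optimal bid of almost every `v` wins with probability below 1 when nobody
  -- sold, so the slope is strictly larger.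
  have hstrict : ∀ᵐ v ∂(bel N), ∀ v' ∈ Icc (0 : ℝ) 1, v < v' →
      p - v - rejectValue N r μ τ σ bel v = 0 →
      p - v' - rejectValue N r μ τ σ bel v' = 0 → False := by
    filter_upwards [hmemB, hlt] with v hv hvlt v' hv' hvv' h0 h0'
    obtain ⟨b, hb1, -, ho⟩ := (hvlt.and (hb.ae_opt v hv)).exists
    have h1 := hb.value_sub_le hv' ho
    have h2 := hB.rejectValue_sub_le hN hrejm hacc hv hv' hvv'.le
    have h3 : 0 < v' - v - (sellerValue N r τ σ bel N v - sellerValue N r τ σ bel N v') := by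
      nlinarith
    have h4 := mul_pos (pow_pos hrej (N - 1)) h3
    linarith
  have hne : ∀ᵐ v ∂(bel N), p - v - rejectValue N r μ τ σ bel v ≠ 0 := by
    -- Strictness handles every indifferent type that has a larger indifferent one. Only a largest
    -- indifferent type can remain, and a single point is null.
    by_cases hex : ∃ z ∈ Icc (0 : ℝ) 1, p - z - rejectValue N r μ τ σ bel z = 0 ∧
        ∀ v' ∈ Icc (0 : ℝ) 1, z < v' → p - v' - rejectValue N r μ τ σ bel v' ≠ 0
    · obtain ⟨z, hz, hz0, hzmax⟩ := hex
      have hvz : ∀ᵐ v ∂(bel N), v ≠ z := by simp [ae_iff]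
      filter_upwards [hmemB, hstrict, hvz] with v hv hs hvz h0
      rcases lt_or_gt_of_ne hvz with hlt | hgt
      · exact hs z hz hlt h0 hz0
      · exact hzmax v hv hgt h0
    · push Not at hex
      filter_upwards [hmemB, hstrict] with v hv hs h0
      obtain ⟨v', hv', hlt, h0'⟩ := hex v hv h0
      exact hs v' hv' hlt h0 h0'
  rw [hbel] at hne
  have hfin : ∫⁻ v, ENNReal.ofReal (1 - σ.accept v) ∂μ ≠ ⊤ :=
    ((integrable_const (1 : ℝ)).sub
      (integrable_accept h.accept_measurable hacc_mem)).lintegral_lt_top.ne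
  filter_upwards [hacc_mem, ae_posterior_iff h.accept_measurable hfin hne] with v hv hv' h0
  by_contra h1
  exact hv' (lt_of_le_of_ne hv.2 h1) h0

/-- The gain from accepting is decreasing because the value of rejecting has slope at least -1. The
cutoff is the supremum of the types willing to sell; monotonicity of the value of rejecting passes
both inequalities to this point, giving exact indifference and hence `cutoffPrice` equal to `p`. -/
lemma exists_cutoff_of_interior (h : IsSymmetricPBE N r p μ τ σ bel)
    (hu : UndominatedBidding N σ) (hrej : 0 < rejProb μ σ) (hacc0 : 0 < accProb μ σ) :
    ∃ c, IsCutoff N r p μ c ∧ ∀ᵐ v ∂μ, σ.accept v = if v < c then 1 else 0 := by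
  have hB := h.biddingEquilibrium hu hτ
  have hmem : ∀ᵐ v ∂μ, v ∈ Icc (0 : ℝ) 1 := (mem_ae_iff_prob_eq_one measurableSet_Icc).2 hsupp
  have hacc_mem : ∀ᵐ v ∂μ, σ.accept v ∈ Icc (0 : ℝ) 1 := hmem.mono h.accept_mem
  have hsum := rejProb_eq h.accept_measurable hacc_mem
  have hacc : accProb μ σ = 1 - rejProb μ σ := by linarith
  have hrejm : rejProb μ σ ∈ Icc (0 : ℝ) 1 := ⟨hrej.le, by linarith⟩
  set R := rejectValue N r μ τ σ bel with hR
  have hanti : ∀ v ∈ Icc (0 : ℝ) 1, ∀ v' ∈ Icc (0 : ℝ) 1, v ≤ v' → R v' ≤ R v :=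
    fun v hv v' hv' hle => hB.rejectValue_antitone hN hrejm hacc hv hv' hle
  have hlip : ∀ v ∈ Icc (0 : ℝ) 1, ∀ v' ∈ Icc (0 : ℝ) 1, v ≤ v' → R v - R v' ≤ v' - v :=
    fun v hv v' hv' hle => hB.rejectValue_sub_le_sub hN hrejm hacc hv hv' hle
  have hnn : ∀ v ∈ Icc (0 : ℝ) 1, 0 ≤ R v := fun v hv => hB.rejectValue_nonneg hN hrejm hacc hv
  set S := {v : ℝ | v ∈ Icc (0 : ℝ) 1 ∧ 0 ≤ p - v - R v} with hS
  have hSne : S.Nonempty := by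
    by_contra hemp
    rw [not_nonempty_iff_eq_empty] at hemp
    have : accProb μ σ = 0 := by
      refine integral_eq_zero_of_ae (hmem.mono fun v hv => accept_eq_zero h hv ?_)
      by_contra hcon
      have : v ∈ S := ⟨hv, not_lt.1 hcon⟩
      rw [hemp] at this
      exact this
    linarith
  have hbdd : BddAbove S := ⟨1, fun v hv => hv.1.2⟩
  set c := sSup S with hc
  have hc01 : c ∈ Icc (0 : ℝ) 1 := by
    obtain ⟨v, hv⟩ := hSne
    exact ⟨hv.1.1.trans (le_csSup hbdd hv), csSup_le ⟨v, hv⟩ fun v hv => hv.1.2⟩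
  have hbelow : ∀ v ∈ Icc (0 : ℝ) 1, v < c → 0 ≤ p - v - R v := fun v hv hvc => by
    obtain ⟨u, hu', hvu⟩ := exists_lt_of_lt_csSup hSne hvc
    have := hlip v hv u hu'.1 hvu.le
    linarith [hu'.2]
  have habove : ∀ v ∈ Icc (0 : ℝ) 1, c < v → p - v - R v < 0 := fun v hv hvc => by
    by_contra hcon
    exact absurd (le_csSup hbdd ⟨hv, not_lt.1 hcon⟩) (not_le.2 hvc)
  have hcut : ∀ᵐ v ∂μ, σ.accept v = if v < c then 1 else 0 := by
    have hne : ∀ᵐ v ∂μ, v ≠ c := by simp [ae_iff]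
    filter_upwards [hmem, hne, ae_accept_of_indifferent hN hr0 hr1 hsupp hF hp hτ h hu hrej] with
      v hv hvc hv0
    rcases lt_or_gt_of_ne hvc with hlt | hgt
    · rw [if_pos hlt]
      rcases (hbelow v hv hlt).lt_or_eq with hpos | heq
      · exact accept_eq_one h hv hpos
      · exact hv0 heq.symm
    · rw [if_neg (not_lt.2 hgt.le)]
      exact accept_eq_zero h hv (habove v hv hgt)
  have hFc := accProb_of_cutoff hcut
  have hpost := posterior_of_cutoff hcut
  have hDc0 : 0 ≤ p - c - R c := by
    refine le_of_forall_pos_le_add fun ε hε => ?_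
    obtain ⟨u, hu', hcu⟩ := exists_lt_of_lt_csSup hSne (sub_lt_self c hε)
    have := hanti u hu'.1 c hc01 (le_csSup hbdd hu')
    linarith [hu'.2, le_csSup hbdd hu']
  have hDc1 : p - c - R c ≤ 0 := by
    -- At `c = 1` there are no higher types to approach from, but `p ≤ r ≤ 1` settles the sign.
    rcases hc01.2.eq_or_lt with h1 | h1
    · have := hnn c hc01
      linarith [hp.2]
    · refine le_of_forall_pos_le_add fun ε hε => ?_
      have hv : min 1 (c + ε) ∈ Icc (0 : ℝ) 1 :=
        ⟨le_min zero_le_one (by linarith [hc01.1]), min_le_left _ _⟩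
      have hlt : c < min 1 (c + ε) := lt_min h1 (by linarith)
      have := hanti c hc01 _ hv hlt.le
      linarith [habove _ hv hlt, min_le_right 1 (c + ε)]
  have hDc : p - c - R c = 0 := le_antisymm hDc1 hDc0
  have hcp : c ≤ p := by linarith [hnn c hc01]
  have hcr : c ∈ Icc 0 r := ⟨hc01.1, hcp.trans hp.2⟩
  have h0 := cdf_zero_eq_zero hsupp
  have hprice := hB.rejectValue_cutoff (c := c) (μ := μ) hN hr1 hsupp hF hcr (by linarith)
    (by linarith) hFc (fun m hm hm' => by
      rw [← hpost]
      exact h.bayes m hm hrej fun hlt => hacc0)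
  have hcpos : 0 < c := by
    refine lt_of_le_of_ne hc01.1 fun h' => ?_
    rw [← h', h0] at hFc
    linarith
  have hprice' : cutoffPrice N r μ c = p := by rw [← hprice]; linarith
  refine ⟨c, ⟨hcr, fun h' => ?_, fun _ => indifference_iff.2 hprice'⟩, hcut⟩
  have := cutoffPrice_strictMonoOn (N := N) hN hF ⟨le_rfl, hr0.le⟩ hcr hcpos
  rw [cutoffPrice_zero hN h0, hprice'] at this
  linarith

theorem exists_cutoff_of_isSymmetricPBE (h : IsSymmetricPBE N r p μ τ σ bel)
    (hu : UndominatedBidding N σ) :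
    ∃ c, IsCutoff N r p μ c ∧ ∀ᵐ v ∂μ, σ.accept v = if v < c then 1 else 0 := by
  have hmem : ∀ᵐ v ∂μ, v ∈ Icc (0 : ℝ) 1 := (mem_ae_iff_prob_eq_one measurableSet_Icc).2 hsupp
  have hacc_mem : ∀ᵐ v ∂μ, σ.accept v ∈ Icc (0 : ℝ) 1 := hmem.mono h.accept_mem
  have hacc0 : 0 ≤ accProb μ σ := integral_nonneg_of_ae (hacc_mem.mono fun v hv => hv.1)
  have hrej0 : 0 ≤ rejProb μ σ :=
    integral_nonneg_of_ae (hacc_mem.mono fun v hv => sub_nonneg.2 hv.2)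
  rcases hrej0.eq_or_lt with hrej | hrej
  · exact exists_cutoff_of_rejProb_eq_zero hN hr0 hr1 hsupp hF hp hτ h hu hrej.symm
  rcases hacc0.eq_or_lt with hacc | hacc
  · exact exists_cutoff_of_accProb_eq_zero hN hr0 hr1 hsupp hF hp hτ h hu hacc.symm
  · exact exists_cutoff_of_interior hN hr0 hr1 hsupp hF hp hτ h hu hrej hacc

end Uniqueness

/-! ### Increasing bidding functions -/

section BidFunction

variable {H : Measure ℝ} [IsProbabilityMeasure H] {κ : Kernel ℝ ℝ} [IsMarkovKernel κ] {f : ℝ → ℝ}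
  {c : ℝ}

lemma bind_dirac_real (hκ : ∀ᵐ v ∂H, κ v = Measure.dirac (f v)) {S A : Set ℝ}
    (hS : MeasurableSet S) (hA : MeasurableSet A) (h : ∀ᵐ v ∂H, f v ∈ S ↔ v ∈ A) :
    (H.bind κ).real S = H.real A := by
  rw [measureReal_def, Measure.bind_apply hS κ.measurable.aemeasurable, measureReal_def,
    ← lintegral_indicator_one hA]
  congr 1
  refine lintegral_congr_ae ?_
  filter_upwards [hκ, h] with v hv hv'
  rw [hv, Measure.dirac_apply' _ hS]
  by_cases hvA : v ∈ A
  · rw [indicator_of_mem hvA, indicator_of_mem (hv'.2 hvA)]; rfl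
  · rw [indicator_of_notMem hvA, indicator_of_notMem fun h => hvA (hv'.1 h)]

variable (hκ : ∀ᵐ v ∂H, κ v = Measure.dirac (f v)) (hH : ∀ᵐ v ∂H, v ∈ Icc c 1)
  (hf : StrictMonoOn f (Ici c))
include hκ hH hf

lemma bind_strictMono_Ioi {x : ℝ} (hx : c ≤ x) : (H.bind κ).real (Ioi (f x)) = H.real (Ioi x) :=
  bind_dirac_real hκ measurableSet_Ioi measurableSet_Ioi
    (hH.mono fun v hv => hf.lt_iff_lt hx hv.1)

lemma bind_strictMono_singleton [NullSingletonClass H] (b : ℝ) : (H.bind κ).real {b} = 0 := by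
  by_cases h : ∃ x, c ≤ x ∧ f x = b
  · obtain ⟨x, hx, rfl⟩ := h
    rw [bind_dirac_real hκ (measurableSet_singleton _) (measurableSet_singleton x)
      (hH.mono fun v hv => hf.injOn.eq_iff hv.1 hx)]
    simp [Measure.real]
  · push Not at h
    rw [bind_dirac_real hκ (measurableSet_singleton _) MeasurableSet.empty
      (hH.mono fun v hv => ⟨fun h' => h v hv.1 h', fun h' => h'.elim⟩)]
    simp

lemma winAlone_strictMono [NullSingletonClass H] {r : ℝ} {k : ℕ} {x : ℝ} (hx : c ≤ x)
    (hxr : f x ≤ r) : winAlone r k (H.bind κ) (f x) = H.real (Ioi x) ^ k := by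
  rw [winAlone_of_atomless hxr (bind_strictMono_singleton hκ hH hf _),
    bind_strictMono_Ioi hκ hH hf hx]

end BidFunction

/-! ### The conditional distribution on the bidding range -/

section CondDist

variable {r c : ℝ} {μ : Measure ℝ} [IsProbabilityMeasure μ] [NullSingletonClass μ]

lemma G_mono (c : ℝ) : Monotone (G μ c) := fun _ _ h =>
  div_le_div_of_nonneg_right (sub_le_sub_right (monotone_cdf μ h) _)
    (sub_nonneg.2 (cdf_le_one μ c))

variable (hF : StrictMonoOn (cdf μ) (Icc 0 r)) (hc0 : 0 ≤ c) (hc1 : cdf μ c < 1)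
include hF hc0 hc1

lemma G_strictMonoOn : StrictMonoOn (G μ c) (Icc c r) := fun x hx y hy h =>
  div_lt_div_of_pos_right (sub_lt_sub_right (hF ⟨hc0.trans hx.1, hx.2⟩ ⟨hc0.trans hy.1, hy.2⟩ h) _)
    (sub_pos.2 hc1)

lemma one_sub_G_pos {x : ℝ} (hx : c ≤ x) (hxr : x < r) : 0 < 1 - G μ c x := by
  rw [one_sub_G hc1]
  exact div_pos (sub_pos.2 (cdf_lt_one hF (hc0.trans hx) hxr)) (sub_pos.2 hc1)

/-- The probability integral transform on a piece of the support. It turns integrals against the law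
of values into Lebesgue integrals in `u = G(x; c)` without using a density. -/
lemma map_G_restrict {x y : ℝ} (hx : c ≤ x) (hxy : x ≤ y) (hy : y ≤ r) :
    ((cond μ (Ici c)).restrict (Ioc x y)).map (G μ c) =
      volume.restrict (Ioc (G μ c x) (G μ c y)) := by
  have := isProbabilityMeasure_belief hc1
  have hGm : Measurable (G μ c) := continuous_G.measurable
  have hG : ∀ s t, c ≤ s → s ≤ t →
      (cond μ (Ici c)) (Ioc s t) = ENNReal.ofReal (G μ c t - G μ c s) := fun s t hs hst => by
    rw [← ofReal_measureReal, ← Ioi_sdiff_Ioi,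
      measureReal_sdiff (Ioi_subset_Ioi hst) measurableSet_Ioi, belief_real_Ioi hc1 hs,
      belief_real_Ioi hc1 (hs.trans hst)]
    congr 1; ring
  refine Measure.ext_of_Iic _ _ fun a => ?_
  rw [Measure.map_apply hGm measurableSet_Iic, Measure.restrict_apply measurableSet_Iic,
    Measure.restrict_apply (hGm measurableSet_Iic)]
  have hG0 := G_strictMonoOn hF hc0 hc1
  rcases lt_or_ge a (G μ c x) with h1 | h1
  · have e1 : G μ c ⁻¹' Iic a ∩ Ioc x y = ∅ := by
      ext t
      simp only [mem_inter_iff, mem_preimage, mem_Iic, mem_empty_iff_false, iff_false, not_and]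
      exact fun h2 h3 => absurd (G_mono c h3.1.le) (not_le.2 (h2.trans_lt h1))
    have e2 : Iic a ∩ Ioc (G μ c x) (G μ c y) = ∅ := by
      ext t
      simp only [mem_inter_iff, mem_Iic, mem_empty_iff_false, iff_false, not_and]
      exact fun h2 h3 => absurd h3.1 (not_lt.2 (h2.trans h1.le))
    rw [e1, e2, measure_empty, measure_empty]
  · rcases lt_or_ge a (G μ c y) with h2 | h2
    · obtain ⟨s, hs, rfl⟩ := intermediate_value_Icc hxy continuous_G.continuousOn ⟨h1, h2.le⟩
      have e1 : G μ c ⁻¹' Iic (G μ c s) ∩ Ioc x y = Ioc x s := by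
        ext t
        simp only [mem_inter_iff, mem_preimage, mem_Iic, mem_Ioc]
        refine ⟨fun ⟨h3, h4, h5⟩ => ⟨h4, ?_⟩, fun ⟨h3, h4⟩ => ⟨G_mono c h4, h3, h4.trans hs.2⟩⟩
        exact (hG0.le_iff_le ⟨hx.trans h4.le, h5.trans hy⟩ ⟨hx.trans hs.1, hs.2.trans hy⟩).1 h3
      have e2 : Iic (G μ c s) ∩ Ioc (G μ c x) (G μ c y) = Ioc (G μ c x) (G μ c s) := by
        ext t
        simp only [mem_inter_iff, mem_Iic, mem_Ioc]
        exact ⟨fun ⟨h3, h4, _⟩ => ⟨h4, h3⟩, fun ⟨h3, h4⟩ => ⟨h4, h3, h4.trans h2.le⟩⟩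
      rw [e1, e2, hG x s hx hs.1, Real.volume_Ioc]
    · have e1 : G μ c ⁻¹' Iic a ∩ Ioc x y = Ioc x y :=
        inter_eq_right.2 fun t ht => (G_mono c ht.2).trans h2
      have e2 : Iic a ∩ Ioc (G μ c x) (G μ c y) = Ioc (G μ c x) (G μ c y) :=
        inter_eq_right.2 fun t ht => ht.2.trans h2
      rw [e1, e2, hG x y hx hxy, Real.volume_Ioc]

/-- The conditional distribution function is uniformly distributed. -/
lemma integral_comp_G {x y : ℝ} (hx : c ≤ x) (hxy : x ≤ y) (hy : y ≤ r) {g : ℝ → ℝ}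
    (hg : ContinuousOn g (Icc (G μ c x) (G μ c y))) :
    ∫ t in Ioc x y, g (G μ c t) ∂(cond μ (Ici c)) = ∫ u in (G μ c x)..(G μ c y), g u := by
  rw [intervalIntegral.integral_of_le (G_mono c hxy), ← map_G_restrict hF hc0 hc1 hx hxy hy,
    integral_map continuous_G.measurable.aemeasurable]
  rw [map_G_restrict hF hc0 hc1 hx hxy hy]
  exact (hg.mono Ioc_subset_Icc_self).aestronglyMeasurable measurableSet_Ioc

end CondDist

/-! ### The symmetric auction: explicit equilibrium -/

section SymmetricExplicit

variable {N : ℕ} {r c : ℝ} {μ : Measure ℝ} [IsProbabilityMeasure μ] [NullSingletonClass μ]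
  (hN : 2 ≤ N) (hr1 : r ≤ 1) (hsupp : μ (Icc 0 1) = 1) (hF : StrictMonoOn (cdf μ) (Icc 0 r))
  (hc : c ∈ Icc 0 r) (hc1 : cdf μ c < 1)

lemma continuous_surplus (N : ℕ) (c : ℝ) : Continuous fun x => (1 - G μ c x) ^ (N - 1) :=
  (continuous_const.sub continuous_G).pow _

lemma surplus_nonneg (x : ℝ) : 0 ≤ (1 - G μ c x) ^ (N - 1) := pow_nonneg (sub_nonneg.2 G_le_one) _

lemma surplus_antitone (N : ℕ) (c : ℝ) : Antitone fun x => (1 - G μ c x) ^ (N - 1) := fun _ _ h =>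
  pow_le_pow_left₀ (sub_nonneg.2 G_le_one) (sub_le_sub_left (G_mono c h) _) _

lemma le_betaSym (x : ℝ) : x ≤ betaSym N r μ c x := by
  unfold betaSym
  split_ifs with h
  · exact le_add_of_nonneg_right (div_nonneg
      (intervalIntegral.integral_nonneg h fun t _ => surplus_nonneg t) (surplus_nonneg x))
  · exact le_rfl

include hF hc hc1

/-- The multiplied form also holds at `x = r`, where the denominator in `betaSym` may be zero. -/
lemma betaSym_mul {x : ℝ} (hx : x ∈ Icc c r) :
    betaSym N r μ c x * (1 - G μ c x) ^ (N - 1) =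
      x * (1 - G μ c x) ^ (N - 1) + ∫ t in x..r, (1 - G μ c t) ^ (N - 1) := by
  unfold betaSym
  rw [if_pos hx.2]
  rcases hx.2.eq_or_lt with rfl | hlt
  · simp
  · rw [add_mul, div_mul_cancel₀ _ (pow_pos (one_sub_G_pos hF hc.1 hc1 hx.1 hlt) _).ne']

omit [NullSingletonClass μ] hF hc hc1 in
lemma betaSym_reserve : betaSym N r μ c r = r := by simp [betaSym]

omit [NullSingletonClass μ] hF hc hc1 in
lemma betaSym_of_gt {x : ℝ} (hx : r < x) : betaSym N r μ c x = x := if_neg (not_le.2 hx)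

include hN in
lemma betaSym_strictMonoOn_Icc : StrictMonoOn (betaSym N r μ c) (Icc c r) := by
  intro x hx y hy hxy
  have hxr := hxy.trans_le hy.2
  have hypos := pow_pos (one_sub_G_pos hF hc.1 hc1 hx.1 hxr) (N - 1)
  have h1 := betaSym_mul (N := N) hF hc hc1 hx
  have h2 := betaSym_mul (N := N) hF hc hc1 hy
  have hcont := continuous_surplus (μ := μ) N c
  have h3 := intervalIntegral.integral_add_adjacent_intervals
    (hcont.intervalIntegrable (μ := volume) x y) (hcont.intervalIntegrable y r)
  have h4 : ∫ t in x..y, (1 - G μ c t) ^ (N - 1) < (y - x) * (1 - G μ c x) ^ (N - 1) := by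
    have : ∫ t in x..y, (1 - G μ c t) ^ (N - 1) < ∫ t in x..y, (1 - G μ c x) ^ (N - 1) := by
      refine intervalIntegral.integral_lt_integral_of_continuousOn_of_le_of_exists_lt hxy
        hcont.continuousOn continuousOn_const (fun t ht => surplus_antitone N c ht.1.le)
        ⟨y, ⟨hxy.le, le_rfl⟩, ?_⟩
      exact pow_lt_pow_left₀ (sub_lt_sub_left (G_strictMonoOn hF hc.1 hc1 hx hy hxy) _)
        (sub_nonneg.2 G_le_one) (by omega)
    simpa using this
  have h5 : y ≤ betaSym N r μ c y := le_betaSym y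
  have h6 := surplus_antitone (μ := μ) N c hxy.le
  simp only at h6
  refine lt_of_mul_lt_mul_right (a := (1 - G μ c x) ^ (N - 1)) ?_ hypos.le
  nlinarith [mul_nonneg (sub_nonneg.2 h5) (sub_nonneg.2 h6)]

include hN in
lemma betaSym_strictMonoOn : StrictMonoOn (betaSym N r μ c) (Ici c) := by
  intro x hx y hy hxy
  rcases le_or_gt y r with hyr | hyr
  · exact betaSym_strictMonoOn_Icc hN hF hc hc1 ⟨hx, hxy.le.trans hyr⟩ ⟨hy, hyr⟩ hxy
  · rw [betaSym_of_gt hyr]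
    rcases le_or_gt x r with hxr | hxr
    · refine lt_of_le_of_lt ?_ hyr
      exact ((betaSym_strictMonoOn_Icc hN hF hc hc1).monotoneOn ⟨hx, hxr⟩ ⟨hc.2, le_rfl⟩ hxr).trans
        betaSym_reserve.le
    · rwa [betaSym_of_gt hxr]

/-- For `b < r` the intermediate value theorem is applied on `[c, b]`, where the denominators are
positive; the upper end is covered since the bid of type `b` is at least `b`. -/
lemma exists_betaSym_eq {b : ℝ} (hb : betaSym N r μ c c ≤ b) (hbr : b ≤ r) :
    ∃ x ∈ Icc c r, betaSym N r μ c x = b := by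
  rcases hbr.eq_or_lt with rfl | hbr
  · exact ⟨b, ⟨hc.2, le_rfl⟩, betaSym_reserve⟩
  · have hcb : c ≤ b := (le_betaSym c).trans hb
    have hcont : ContinuousOn (betaSym N r μ c) (Icc c b) := by
      have heq : EqOn (betaSym N r μ c) (fun x => x + (-∫ t in r..x, (1 - G μ c t) ^ (N - 1)) /
          (1 - G μ c x) ^ (N - 1)) (Icc c b) := fun x hx => by
        simp only [betaSym, if_pos (hx.2.trans hbr.le), intervalIntegral.integral_symm r x]
      refine ContinuousOn.congr ?_ heq
      have hcont := continuous_surplus (μ := μ) N c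
      refine continuousOn_id.add (ContinuousOn.div ?_ hcont.continuousOn fun x hx =>
        (pow_pos (one_sub_G_pos hF hc.1 hc1 hx.1 (hx.2.trans_lt hbr)) _).ne')
      exact (intervalIntegral.continuous_primitive (fun a b => hcont.intervalIntegrable a b)
        r).neg.continuousOn
    obtain ⟨x, hx, hxb⟩ := intermediate_value_Icc hcb hcont ⟨hb, le_betaSym b⟩
    exact ⟨x, ⟨hx.1, hx.2.trans hbr.le⟩, hxb⟩

include hN hr1 hsupp in
/-- No type gains by deviating from the symmetric bidding strategy. -/
lemma betaSym_optimal {κ : Kernel ℝ ℝ} [IsMarkovKernel κ]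
    (hκ : ∀ᵐ v ∂(cond μ (Ici c)), κ v = Measure.dirac (betaSym N r μ c v)) {v : ℝ}
    (hv : v ∈ Icc (0 : ℝ) 1) (b : ℝ) :
    (b - v) * winAlone r (N - 1) ((cond μ (Ici c)).bind κ) b ≤
      (betaSym N r μ c (max v c) - v) *
        winAlone r (N - 1) ((cond μ (Ici c)).bind κ) (betaSym N r μ c (max v c)) := by
  have := isProbabilityMeasure_belief hc1
  set W := winAlone r (N - 1) ((cond μ (Ici c)).bind κ) with hW
  have hmono := betaSym_strictMonoOn hN hF hc hc1
  have hmonoI := betaSym_strictMonoOn_Icc hN hF hc hc1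
  have hle_r : ∀ x ∈ Icc c r, betaSym N r μ c x ≤ r := fun x hx => by
    conv_rhs => rw [← betaSym_reserve (N := N) (r := r) (c := c) (μ := μ)]
    exact hmonoI.monotoneOn hx ⟨hc.2, le_rfl⟩ hx.2
  have hwin : ∀ x ∈ Icc c r, W (betaSym N r μ c x) = (1 - G μ c x) ^ (N - 1) := fun x hx => by
    rw [hW, winAlone_strictMono hκ (ae_belief_mem hsupp) hmono hx.1 (hle_r x hx),
      belief_real_Ioi hc1 hx.1]
  have hge : 0 ≤ (betaSym N r μ c (max v c) - v) * W (betaSym N r μ c (max v c)) :=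
    mul_nonneg (sub_nonneg.2 ((le_max_left _ _).trans (le_betaSym _))) (winAlone_nonneg _)
  rcases le_or_gt b v with hbv | hbv
  · exact (mul_nonpos_of_nonpos_of_nonneg (sub_nonpos.2 hbv) (winAlone_nonneg b)).trans hge
  rcases lt_or_ge r b with hrb | hbr
  · rw [hW, winAlone_eq_zero hrb, mul_zero]; exact hge
  have hm : max v c ∈ Icc c r := ⟨le_max_right _ _, max_le (hbv.le.trans hbr) hc.2⟩
  have hcm : c ∈ Icc c r := ⟨le_rfl, hc.2⟩
  set x₀ := max v c with hx₀
  -- Imitating `x` yields `(x - v) z(x)` plus the area under `z` from `x` to `r`, with `z` the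
  -- winning probability. As `z` is decreasing, the rectangle between `x₀` and `x` never outweighs
  -- the area between them.
  have key : ∀ x ∈ Icc c r, (betaSym N r μ c x - v) * W (betaSym N r μ c x) ≤
      (betaSym N r μ c x₀ - v) * W (betaSym N r μ c x₀) := fun x hx => by
    rw [hwin x hx, hwin x₀ hm, sub_mul, sub_mul, betaSym_mul hF hc hc1 hx,
      betaSym_mul hF hc hc1 hm]
    have hcont := continuous_surplus (μ := μ) N c
    have h1 := intervalIntegral.integral_add_adjacent_intervals
      (hcont.intervalIntegrable (μ := volume) x₀ x) (hcont.intervalIntegrable x r)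
    have hanti := surplus_antitone (μ := μ) N c
    have h2 : (x - x₀) * (1 - G μ c x) ^ (N - 1) ≤ ∫ t in x₀..x, (1 - G μ c t) ^ (N - 1) := by
      rcases le_total x₀ x with h | h
      · have := intervalIntegral.integral_mono_on h
          (intervalIntegrable_const (c := (1 - G μ c x) ^ (N - 1)))
          (hcont.intervalIntegrable (μ := volume) x₀ x) fun t ht => hanti ht.2
        simpa using this
      · have := intervalIntegral.integral_mono_on h (hcont.intervalIntegrable (μ := volume) x x₀)
          (intervalIntegrable_const (c := (1 - G μ c x) ^ (N - 1))) fun t ht => hanti ht.1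
        rw [intervalIntegral.integral_symm]
        simp only [intervalIntegral.integral_const, smul_eq_mul] at this
        linarith
    have h3 : 0 ≤ (x₀ - v) * ((1 - G μ c x₀) ^ (N - 1) - (1 - G μ c x) ^ (N - 1)) := by
      rcases le_total v c with h | h
      · have h4 : x₀ = c := max_eq_right h
        rw [h4]
        exact mul_nonneg (sub_nonneg.2 h) (sub_nonneg.2 (hanti hx.1))
      · have h4 : x₀ = v := max_eq_left h
        rw [h4]; simp
    nlinarith
  rcases lt_or_ge b (betaSym N r μ c c) with hbc | hbc
  · refine le_trans ?_ (key c hcm)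
    rw [hwin c hcm, G_self, sub_zero, one_pow, mul_one]
    have := winAlone_le_one (r := r) (k := N - 1) (β := (cond μ (Ici c)).bind κ) b
    rw [← hW] at this
    nlinarith
  · obtain ⟨x, hx, rfl⟩ := exists_betaSym_eq (N := N) hF hc hc1 hbc hbr
    exact key x hx

end SymmetricExplicit

/-! ### The auction against the speculator: explicit equilibrium -/

section SpeculatorExplicit

variable {m k : ℕ} {r c : ℝ} {μ : Measure ℝ} [IsProbabilityMeasure μ] [NullSingletonClass μ]
  (hm : 1 ≤ m) (hr0 : 0 < r) (hr1 : r ≤ 1) (hsupp : μ (Icc 0 1) = 1)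
  (hF : StrictMonoOn (cdf μ) (Icc 0 r)) (hc : c ∈ Icc 0 r) (hc1 : cdf μ c < 1)

include hc in
lemma bHigh_mem : bHigh r μ m c ∈ Icc c r ∧
    IsMaxOn (revenue μ m c) (Icc c r) (bHigh r μ m c) := by
  obtain ⟨b, hb, hmax⟩ := isCompact_Icc.exists_isMaxOn (nonempty_Icc.2 hc.2)
    (continuous_revenue (μ := μ) (m := m) (c := c)).continuousOn
  have hset : {b ∈ Icc c r | IsMaxOn (revenue μ m c) (Icc c r) b} =
      Icc c r ∩ revenue μ m c ⁻¹' Ici (revenue μ m c b) := by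
    ext x
    refine ⟨fun hx => ⟨hx.1, hx.2 hb⟩, fun hx => ⟨hx.1, fun y hy => ?_⟩⟩
    exact le_trans (show revenue μ m c y ≤ revenue μ m c b from hmax hy)
      (show revenue μ m c b ≤ revenue μ m c x from hx.2)
  have hcomp : IsCompact {b ∈ Icc c r | IsMaxOn (revenue μ m c) (Icc c r) b} := by
    rw [hset]
    exact isCompact_Icc.inter_right (isClosed_Ici.preimage continuous_revenue)
  exact hcomp.sInf_mem ⟨b, hb, hmax⟩

include hc in
lemma revenue_bHigh : revenue μ m c (bHigh r μ m c) = bLow r μ m c := by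
  have h := bHigh_mem (m := m) (μ := μ) hc
  refine le_antisymm (revenue_le_bLow hc.1 h.1) (csSup_le ((nonempty_Icc.2 hc.2).image _) ?_)
  rintro _ ⟨b, hb, rfl⟩
  exact h.2 hb

include hc in
-- This is where the choice of the least maximizer matters: it makes `beta` strictly exceed the
-- value below `bHigh`, so that the hazard rate is finite there.
lemma revenue_lt_bLow {x : ℝ} (hx : c ≤ x) (hlt : x < bHigh r μ m c) :
    revenue μ m c x < bLow r μ m c := by
  have h := bHigh_mem (m := m) (μ := μ) hc
  have hxm : x ∈ Icc c r := ⟨hx, hlt.le.trans h.1.2⟩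
  refine lt_of_le_of_ne (revenue_le_bLow hc.1 hxm) fun heq => ?_
  refine absurd (csInf_le ⟨c, fun b hb => hb.1.1⟩ ?_) (not_le.2 hlt)
  exact ⟨hxm, fun y hy => (revenue_le_bLow hc.1 hy).trans heq.ge⟩

include hr0 hF hc hc1 in
lemma bLow_pos : 0 < bLow r μ m c := by
  rcases hc.1.eq_or_lt with h0 | h0
  · subst h0
    have hr2 : r / 2 ∈ Icc 0 r := ⟨by linarith, by linarith⟩
    refine lt_of_lt_of_le ?_ (revenue_le_bLow le_rfl hr2)
    exact mul_pos (by linarith) (pow_pos (one_sub_G_pos hF le_rfl hc1 hr2.1 (by linarith)) _)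
  · exact h0.trans_le (le_bLow hc.1 hc.2)

include hm hr0 hF hc hc1

/-- A price that no value exceeds earns nothing, whereas the maximal revenue is positive; so `G`
stays below 1 up to the maximizer, even if it equals `r`. -/
lemma one_sub_G_pos_of_le_bHigh {x : ℝ} (hx : x ≤ bHigh r μ m c) : 0 < 1 - G μ c x := by
  have h := bHigh_mem (m := m) (μ := μ) hc
  have h1 : 0 < 1 - G μ c (bHigh r μ m c) := by
    refine lt_of_le_of_ne (sub_nonneg.2 G_le_one) fun h0 => ?_
    have := bLow_pos (m := m) hr0 hF hc hc1
    rw [← revenue_bHigh hc, revenue, ← h0, zero_pow (by omega), mul_zero] at this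
    exact lt_irrefl _ this
  linarith [G_mono (μ := μ) c hx]

/-- The speculator's indifference: against these bids, each bid `beta x` earns him the same amount.
-/
lemma beta_mul {x : ℝ} (hx : x ≤ bHigh r μ m c) :
    beta r μ m c x * (1 - G μ c x) ^ m = bLow r μ m c := by
  unfold beta
  rw [if_pos hx, div_mul_cancel₀ _
    (pow_pos (one_sub_G_pos_of_le_bHigh hm hr0 hF hc hc1 hx) m).ne']

lemma lt_beta {x : ℝ} (hx : c ≤ x) (hlt : x < bHigh r μ m c) : x < beta r μ m c x := by
  have h1 := beta_mul hm hr0 hF hc hc1 hlt.le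
  have h2 := revenue_lt_bLow (m := m) hc hx hlt
  have h3 := pow_pos (one_sub_G_pos_of_le_bHigh hm hr0 hF hc hc1 hlt.le) m
  rw [← h1] at h2
  exact lt_of_mul_lt_mul_right h2 h3.le

lemma beta_bHigh : beta r μ m c (bHigh r μ m c) = bHigh r μ m c := by
  have h1 := beta_mul hm hr0 hF hc hc1 (le_refl (bHigh r μ m c))
  have h3 := pow_pos (one_sub_G_pos_of_le_bHigh hm hr0 hF hc hc1 (le_refl (bHigh r μ m c))) m
  rw [← revenue_bHigh hc, revenue] at h1
  exact mul_right_cancel₀ h3.ne' h1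

omit [NullSingletonClass μ] hm hr0 hF hc hc1 in
lemma beta_of_gt {x : ℝ} (hx : bHigh r μ m c < x) : beta r μ m c x = x := if_neg (not_le.2 hx)

lemma beta_lowest : beta r μ m c c = bLow r μ m c := by
  have := beta_mul hm hr0 hF hc hc1 (bHigh_mem (m := m) (μ := μ) hc).1.1
  rwa [G_self, sub_zero, one_pow, mul_one] at this

lemma le_beta {x : ℝ} (hx : c ≤ x) : x ≤ beta r μ m c x := by
  rcases lt_trichotomy x (bHigh r μ m c) with h | h | h
  · exact (lt_beta hm hr0 hF hc hc1 hx h).le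
  · rw [h, beta_bHigh hm hr0 hF hc hc1]
  · rw [beta_of_gt h]

lemma beta_strictMonoOn_Icc : StrictMonoOn (beta r μ m c) (Icc c (bHigh r μ m c)) := by
  intro x hx y hy hxy
  have hB := (bHigh_mem (m := m) (μ := μ) hc).1
  have hL := bLow_pos (m := m) hr0 hF hc hc1
  have hzx := one_sub_G_pos_of_le_bHigh hm hr0 hF hc hc1 hx.2
  have hzy := one_sub_G_pos_of_le_bHigh hm hr0 hF hc hc1 hy.2
  have hG := G_strictMonoOn hF hc.1 hc1 ⟨hx.1, hx.2.trans hB.2⟩ ⟨hy.1, hy.2.trans hB.2⟩ hxy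
  unfold beta
  rw [if_pos hx.2, if_pos hy.2]
  exact div_lt_div_of_pos_left hL (pow_pos hzy m)
    (pow_lt_pow_left₀ (sub_lt_sub_left hG 1) hzy.le (by omega))

lemma beta_strictMonoOn : StrictMonoOn (beta r μ m c) (Ici c) := by
  intro x hx y hy hxy
  have hB := (bHigh_mem (m := m) (μ := μ) hc).1
  have hI := beta_strictMonoOn_Icc hm hr0 hF hc hc1
  rcases le_or_gt y (bHigh r μ m c) with hyB | hyB
  · exact hI ⟨hx, hxy.le.trans hyB⟩ ⟨hy, hyB⟩ hxy
  · rw [beta_of_gt hyB]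
    rcases le_or_gt x (bHigh r μ m c) with hxB | hxB
    · refine lt_of_le_of_lt ?_ hyB
      exact (hI.monotoneOn ⟨hx, hxB⟩ ⟨hB.1, le_rfl⟩ hxB).trans (beta_bHigh hm hr0 hF hc hc1).le
    · rwa [beta_of_gt hxB]

lemma beta_continuousOn : ContinuousOn (beta r μ m c) (Icc c (bHigh r μ m c)) := by
  have heq : EqOn (beta r μ m c) (fun x => bLow r μ m c / (1 - G μ c x) ^ m)
      (Icc c (bHigh r μ m c)) := fun x hx => if_pos hx.2
  refine ContinuousOn.congr ?_ heq
  exact continuousOn_const.div ((continuous_const.sub continuous_G).pow m).continuousOn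
    fun x hx => (pow_pos (one_sub_G_pos_of_le_bHigh hm hr0 hF hc hc1 hx.2) m).ne'

lemma exists_beta_eq {b : ℝ} (hb : b ∈ Icc (bLow r μ m c) (bHigh r μ m c)) :
    ∃ x ∈ Icc c (bHigh r μ m c), beta r μ m c x = b := by
  have h := intermediate_value_Icc (bHigh_mem (m := m) (μ := μ) hc).1.1
    (beta_continuousOn hm hr0 hF hc hc1)
  rw [beta_lowest hm hr0 hF hc hc1, beta_bHigh hm hr0 hF hc hc1] at h
  exact h hb

lemma beta_mem {x : ℝ} (hx : x ∈ Icc c (bHigh r μ m c)) :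
    beta r μ m c x ∈ Icc (bLow r μ m c) (bHigh r μ m c) := by
  have hI := (beta_strictMonoOn_Icc hm hr0 hF hc hc1).monotoneOn
  have hB := (bHigh_mem (m := m) (μ := μ) hc).1
  constructor
  · rw [← beta_lowest hm hr0 hF hc hc1]; exact hI ⟨le_rfl, hB.1⟩ hx hx.1
  · exact (hI hx ⟨hB.1, le_rfl⟩ hx.2).trans (beta_bHigh hm hr0 hF hc hc1).le

lemma bLow_le_bHigh : bLow r μ m c ≤ bHigh r μ m c :=
  have h := beta_mem hm hr0 hF hc hc1 ⟨le_rfl, (bHigh_mem (m := m) (μ := μ) hc).1.1⟩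
  h.1.trans h.2

/-! ### The speculator's payoff against sellers who bid according to `beta`. -/

section Law

variable {κ : Kernel ℝ ℝ} [IsMarkovKernel κ]
  (hκ : ∀ᵐ v ∂(cond μ (Ici c)), κ v = Measure.dirac (beta r μ m c v))
include hsupp hκ

lemma beta_law_Ioi {x : ℝ} (hx : c ≤ x) :
    ((cond μ (Ici c)).bind κ).real (Ioi (beta r μ m c x)) = 1 - G μ c x := by
  have := isProbabilityMeasure_belief hc1
  rw [bind_strictMono_Ioi hκ (ae_belief_mem hsupp) (beta_strictMonoOn hm hr0 hF hc hc1) hx,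
    belief_real_Ioi hc1 hx]

lemma specWin_beta {x : ℝ} (hx : c ≤ x) (hxr : beta r μ m c x ≤ r) :
    specWin r (fun _ => 0) m ((cond μ (Ici c)).bind κ) (beta r μ m c x) = (1 - G μ c x) ^ m := by
  have := isProbabilityMeasure_belief hc1
  rw [← beta_law_Ioi hm hr0 hsupp hF hc hc1 hκ hx]
  refine le_antisymm ?_ (le_specWin (by simp) hxr)
  have h := specWin_le (r := r) (τ := fun _ => 0) (m := m) (β := (cond μ (Ici c)).bind κ)
    (by simp) (beta r μ m c x)
  rwa [real_Ici_add, bind_strictMono_singleton hκ (ae_belief_mem hsupp)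
    (beta_strictMonoOn hm hr0 hF hc hc1), add_zero] at h

lemma specPayoff_of_mem {s : ℝ} (hs : s ∈ Icc (bLow r μ m c) (bHigh r μ m c)) :
    s * specWin r (fun _ => 0) m ((cond μ (Ici c)).bind κ) s = bLow r μ m c := by
  obtain ⟨x, hx, rfl⟩ := exists_beta_eq hm hr0 hF hc hc1 hs
  rw [specWin_beta hm hr0 hsupp hF hc hc1 hκ hx.1
    (hs.2.trans (bHigh_mem (m := m) (μ := μ) hc).1.2), beta_mul hm hr0 hF hc hc1 hx.2]

/-- Below `bLow` even a sure win earns too little, on the support there is indifference, between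
`bHigh` and `r` the sellers bid their values and he earns the posted-price revenue, and above `r` he
cannot win. -/
lemma specPayoff_le_bLow (s : ℝ) :
    s * specWin r (fun _ => 0) m ((cond μ (Ici c)).bind κ) s ≤ bLow r μ m c := by
  have := isProbabilityMeasure_belief hc1
  have hL := bLow_pos (m := m) hr0 hF hc hc1
  have hle1 : specWin r (fun _ => 0) m ((cond μ (Ici c)).bind κ) s ≤ 1 :=
    (specWin_le (by simp) s).trans (pow_le_one₀ measureReal_nonneg measureReal_le_one)
  have hge0 : 0 ≤ specWin r (fun _ => 0) m ((cond μ (Ici c)).bind κ) s :=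
    specWin_nonneg (by simp) s
  have hB := (bHigh_mem (m := m) (μ := μ) hc).1
  rcases lt_or_ge s (bLow r μ m c) with h1 | h1
  · nlinarith
  rcases le_or_gt s (bHigh r μ m c) with h2 | h2
  · exact (specPayoff_of_mem hm hr0 hsupp hF hc hc1 hκ ⟨h1, h2⟩).le
  rcases le_or_gt s r with h3 | h3
  · have h4 : c ≤ s := hB.1.trans h2.le
    have h5 := specWin_beta hm hr0 hsupp hF hc hc1 hκ h4 (by rwa [beta_of_gt h2])
    rw [beta_of_gt h2] at h5
    rw [h5]
    exact revenue_le_bLow hc.1 ⟨h4, h3⟩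
  · rw [specWin_eq_zero h3, mul_zero]; exact hL.le

end Law

/-! #### The speculator's mixed strategy -/

/-- The hazard rate of the speculator's bid in terms of the seller's type. -/
def hazard (r : ℝ) (μ : Measure ℝ) (m : ℕ) (c x : ℝ) : ℝ :=
  (beta r μ m c x + ((m : ℝ) - 1) * x) / ((beta r μ m c x - x) * (1 - G μ c x))

/-- The cumulative hazard of the speculator's bid. -/
def cumHazard (r : ℝ) (μ : Measure ℝ) (m : ℕ) (c x : ℝ) : ℝ :=
  ∫ t in Icc c x, hazard r μ m c t ∂(cond μ (Ici c))

lemma hazard_continuousOn {y : ℝ} (hy : y < bHigh r μ m c) :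
    ContinuousOn (hazard r μ m c) (Icc c y) := by
  have hb := (beta_continuousOn hm hr0 hF hc hc1).mono (Icc_subset_Icc_right hy.le)
  refine ContinuousOn.div (hb.add (by fun_prop)) ((hb.sub continuousOn_id).mul
    (continuous_const.sub continuous_G).continuousOn) fun x hx => ?_
  exact (mul_pos (sub_pos.2 (lt_beta hm hr0 hF hc hc1 hx.1 (hx.2.trans_lt hy)))
    (one_sub_G_pos_of_le_bHigh hm hr0 hF hc hc1 (hx.2.trans hy.le))).ne'

lemma hazard_nonneg {x : ℝ} (hx : c ≤ x) (hlt : x < bHigh r μ m c) : 0 ≤ hazard r μ m c x := by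
  have h1 := lt_beta hm hr0 hF hc hc1 hx hlt
  have h2 := one_sub_G_pos_of_le_bHigh hm hr0 hF hc hc1 hlt.le
  have h3 : (1 : ℝ) ≤ m := by exact_mod_cast hm
  have hx0 : 0 ≤ x := hc.1.trans hx
  refine div_nonneg (add_nonneg (hx0.trans h1.le) (mul_nonneg (by linarith) hx0))
    (mul_nonneg (sub_nonneg.2 h1.le) h2.le)

lemma hazard_integrableOn {y : ℝ} (hy : y < bHigh r μ m c) :
    IntegrableOn (hazard r μ m c) (Icc c y) (cond μ (Ici c)) := by
  have := isProbabilityMeasure_belief hc1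
  exact (hazard_continuousOn hm hr0 hF hc hc1 hy).integrableOn_compact isCompact_Icc

lemma cumHazard_sub {x y : ℝ} (hx : c ≤ x) (hxy : x ≤ y) (hy : y < bHigh r μ m c) :
    cumHazard r μ m c y - cumHazard r μ m c x =
      ∫ t in Ioc x y, hazard r μ m c t ∂(cond μ (Ici c)) := by
  have hi := hazard_integrableOn hm hr0 hF hc hc1 hy
  unfold cumHazard
  rw [← Icc_union_Ioc_eq_Icc hx hxy, setIntegral_union
    (Set.disjoint_left.2 fun t ht ht' => absurd ht.2 (not_le.2 ht'.1)) measurableSet_Ioc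
    (hi.mono_set (Icc_subset_Icc_right hxy))
    (hi.mono_set (Ioc_subset_Icc_self.trans (Icc_subset_Icc_left hx)))]
  ring

omit [IsProbabilityMeasure μ] hm hr0 hF hc hc1 in
lemma cumHazard_lowest : cumHazard r μ m c c = 0 := by
  unfold cumHazard
  rw [Icc_self, Measure.restrict_singleton, measure_singleton, zero_smul, integral_zero_measure]

lemma cumHazard_mono {x y : ℝ} (hx : c ≤ x) (hxy : x ≤ y) (hy : y < bHigh r μ m c) :
    cumHazard r μ m c x ≤ cumHazard r μ m c y := by
  have h := cumHazard_sub hm hr0 hF hc hc1 hx hxy hy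
  have h2 : 0 ≤ ∫ t in Ioc x y, hazard r μ m c t ∂(cond μ (Ici c)) :=
    setIntegral_nonneg measurableSet_Ioc fun t ht =>
      hazard_nonneg hm hr0 hF hc hc1 (hx.trans ht.1.le) (ht.2.trans_lt hy)
  linarith

lemma Psi_beta {x : ℝ} (hx : x ∈ Icc c (bHigh r μ m c)) :
    Psi r μ m c (beta r μ m c x) = 1 - Real.exp (-cumHazard r μ m c x) := by
  have : Function.invFunOn (beta r μ m c) (Icc c (bHigh r μ m c)) (beta r μ m c x) = x :=
    (beta_strictMonoOn_Icc hm hr0 hF hc hc1).injOn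
      (Function.invFunOn_mem ⟨x, hx, rfl⟩) hx (Function.invFunOn_eq ⟨x, hx, rfl⟩)
  unfold Psi
  rw [this]
  rfl

/-- Gain of type `v` from imitating type `x`, conditional on beating the speculator. -/
def imitation (r : ℝ) (μ : Measure ℝ) (m : ℕ) (c v x : ℝ) : ℝ :=
  (beta r μ m c x - v) * (1 - G μ c x) ^ (m - 1)

lemma imitation_eq {v x : ℝ} (hx : x ≤ bHigh r μ m c) : imitation r μ m c v x =
    (bLow r μ m c - v * (1 - G μ c x) ^ m) / (1 - G μ c x) := by
  have hz := one_sub_G_pos_of_le_bHigh hm hr0 hF hc hc1 hx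
  rw [imitation, ← beta_mul hm hr0 hF hc hc1 hx, eq_div_iff hz.ne']
  obtain ⟨n, rfl⟩ : ∃ n, m = n + 1 := ⟨m - 1, by omega⟩
  rw [Nat.add_sub_cancel, pow_succ]
  ring

/-- The hazard rate at which type `v` would be indifferent between all bids. -/
def indiffHazard (r : ℝ) (μ : Measure ℝ) (m : ℕ) (c v u : ℝ) : ℝ :=
  m * v * (1 - u) ^ (m - 1) / (bLow r μ m c - v * (1 - u) ^ m) + 1 / (1 - u)

lemma imitation_pos_aux {v x y u : ℝ} (hv : 0 ≤ v) (hx : c ≤ x) (hxy : x ≤ y)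
    (hy : y < bHigh r μ m c) (hvx : v < beta r μ m c x) (hu : u ∈ Icc (G μ c x) (G μ c y)) :
    0 < 1 - u ∧ 0 < bLow r μ m c - v * (1 - u) ^ m := by
  have h1 : 0 < 1 - u := by
    linarith [one_sub_G_pos_of_le_bHigh hm hr0 hF hc hc1 hy.le, hu.2]
  refine ⟨h1, ?_⟩
  have h2 := beta_mul hm hr0 hF hc hc1 (hxy.trans hy.le)
  have h3 := pow_pos (one_sub_G_pos_of_le_bHigh hm hr0 hF hc hc1 (hxy.trans hy.le)) m
  have h4 : (1 - u) ^ m ≤ (1 - G μ c x) ^ m :=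
    pow_le_pow_left₀ h1.le (by linarith [hu.1]) m
  nlinarith

/-- In the variable `u = G` the gain is `(L - v (1 - u) ^ m) / (1 - u)` with `L = bLow`, and
`indiffHazard` is its logarithmic derivative: the rate at which the risk of losing to the speculator
must grow to offset the higher gain. -/
lemma integral_indiffHazard {v x y : ℝ} (hv : 0 ≤ v) (hx : c ≤ x) (hxy : x ≤ y)
    (hy : y < bHigh r μ m c) (hvx : v < beta r μ m c x) :
    ∫ t in Ioc x y, indiffHazard r μ m c v (G μ c t) ∂(cond μ (Ici c)) =
      Real.log (imitation r μ m c v y) - Real.log (imitation r μ m c v x) := by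
  have hB := (bHigh_mem (m := m) (μ := μ) hc).1
  have haux := fun u => imitation_pos_aux (u := u) hm hr0 hF hc hc1 hv hx hxy hy hvx
  have hcont : ContinuousOn (indiffHazard r μ m c v) (Icc (G μ c x) (G μ c y)) := by
    refine ContinuousOn.add (ContinuousOn.div (by fun_prop) (by fun_prop)
      fun u hu => (haux u hu).2.ne') (ContinuousOn.div (by fun_prop) (by fun_prop)
      fun u hu => (haux u hu).1.ne')
  rw [integral_comp_G hF hc.1 hc1 hx hxy (hy.le.trans hB.2) hcont]
  have hGxy := G_mono (μ := μ) c hxy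
  rw [intervalIntegral.integral_eq_sub_of_hasDerivAt
    (f := fun u => Real.log (bLow r μ m c - v * (1 - u) ^ m) - Real.log (1 - u))
    (fun u hu => ?_) ((hcont.mono (by rw [uIcc_of_le hGxy])).intervalIntegrable)]
  · have e : ∀ u ∈ Icc (G μ c x) (G μ c y), Real.log (bLow r μ m c - v * (1 - u) ^ m) -
        Real.log (1 - u) = Real.log ((bLow r μ m c - v * (1 - u) ^ m) / (1 - u)) := fun u hu =>
      (Real.log_div (haux u hu).2.ne' (haux u hu).1.ne').symm
    rw [e _ ⟨hGxy, le_rfl⟩, e _ ⟨le_rfl, hGxy⟩, imitation_eq hm hr0 hF hc hc1 hy.le,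
      imitation_eq hm hr0 hF hc hc1 (hxy.trans hy.le)]
  · rw [uIcc_of_le hGxy] at hu
    have h1 : HasDerivAt (fun u : ℝ => 1 - u) (-1) u := by
      simpa using (hasDerivAt_id u).const_sub 1
    have h2 := (((h1.fun_pow m).const_mul v).const_sub (bLow r μ m c)).log (haux u hu).2.ne'
    have h3 := h2.fun_sub (h1.log (haux u hu).1.ne')
    convert h3 using 1
    unfold indiffHazard
    ring

/-- Put into the form of `indiffHazard_eq` with `v = t`: the actual hazard at `t` is the one that
makes type `t` itself indifferent to first order. -/
lemma hazard_eq {t : ℝ} (ht : c ≤ t) (hlt : t < bHigh r μ m c) : hazard r μ m c t =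
    1 / (1 - G μ c t) + m * t / ((beta r μ m c t - t) * (1 - G μ c t)) := by
  have h1 := lt_beta hm hr0 hF hc hc1 ht hlt
  have h2 := one_sub_G_pos_of_le_bHigh hm hr0 hF hc hc1 hlt.le
  have h3 : beta r μ m c t - t ≠ 0 := (sub_pos.2 h1).ne'
  unfold hazard
  field_simp
  ring

lemma indiffHazard_eq {v t : ℝ} (hlt : t ≤ bHigh r μ m c)
    (hv : v < beta r μ m c t) : indiffHazard r μ m c v (G μ c t) =
    1 / (1 - G μ c t) + m * v / ((beta r μ m c t - v) * (1 - G μ c t)) := by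
  have h2 := one_sub_G_pos_of_le_bHigh hm hr0 hF hc hc1 hlt
  have h3 : beta r μ m c t - v ≠ 0 := (sub_pos.2 hv).ne'
  unfold indiffHazard
  rw [← beta_mul hm hr0 hF hc hc1 hlt]
  obtain ⟨n, rfl⟩ : ∃ n, m = n + 1 := ⟨m - 1, by omega⟩
  rw [Nat.add_sub_cancel, ← sub_mul, pow_succ]
  field_simp
  ring

omit hm hr0 hF hc hc1 [NullSingletonClass μ] [IsProbabilityMeasure μ] in
lemma ratio_mono {a s t B z : ℝ} (ha : 0 ≤ a) (hz : 0 < z) (hs : 0 ≤ s) (hst : s ≤ t)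
    (htB : t < B) : 1 / z + a * s / ((B - s) * z) ≤ 1 / z + a * t / ((B - t) * z) := by
  have h1 : 0 < B - t := sub_pos.2 htB
  refine add_le_add_right (div_le_div₀ (mul_nonneg ha (hs.trans hst))
    (mul_le_mul_of_nonneg_left hst ha) (mul_pos h1 hz)
    (mul_le_mul_of_nonneg_right (by linarith) hz.le)) _

lemma indiffHazard_integrableOn {v x y : ℝ} (hv : 0 ≤ v) (hx : c ≤ x) (hxy : x ≤ y)
    (hy : y < bHigh r μ m c) (hvx : v < beta r μ m c x) :
    IntegrableOn (fun t => indiffHazard r μ m c v (G μ c t)) (Ioc x y) (cond μ (Ici c)) := by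
  have := isProbabilityMeasure_belief hc1
  have haux := fun u => imitation_pos_aux (u := u) hm hr0 hF hc hc1 hv hx hxy hy hvx
  have hcont : ContinuousOn (indiffHazard r μ m c v) (Icc (G μ c x) (G μ c y)) := by
    refine ContinuousOn.add (ContinuousOn.div (by fun_prop) (by fun_prop)
      fun u hu => (haux u hu).2.ne') (ContinuousOn.div (by fun_prop) (by fun_prop)
      fun u hu => (haux u hu).1.ne')
  exact ((hcont.comp continuous_G.continuousOn fun t ht => ⟨G_mono c ht.1,
    G_mono c ht.2⟩).integrableOn_compact isCompact_Icc).mono_set Ioc_subset_Icc_self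

/-- Payoff of type `v` from imitating type `x`. -/
def imitationPayoff (r : ℝ) (μ : Measure ℝ) (m : ℕ) (c v x : ℝ) : ℝ :=
  imitation r μ m c v x * Real.exp (-cumHazard r μ m c x)

lemma imitation_pos {v x : ℝ} (hx : x ≤ bHigh r μ m c) (hv : v < beta r μ m c x) :
    0 < imitation r μ m c v x :=
  mul_pos (sub_pos.2 hv) (pow_pos (one_sub_G_pos_of_le_bHigh hm hr0 hF hc hc1 hx) _)

omit hm hr0 hF hc hc1 [NullSingletonClass μ] [IsProbabilityMeasure μ] in
lemma mul_exp_le_of_log {a b s t : ℝ} (ha : 0 < a) (hb : 0 < b)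
    (h : s - t ≤ Real.log a - Real.log b) : b * Real.exp (-t) ≤ a * Real.exp (-s) := by
  rw [← Real.exp_log ha, ← Real.exp_log hb, ← Real.exp_add, ← Real.exp_add]
  exact Real.exp_le_exp.2 (by linarith)

/-- At types below `v` the actual hazard is smaller than the one that would leave `v` indifferent,
so moving up to his own bid pays. If the bid of `x` is at most `v`, imitation yields nothing
positive and logarithms are not needed. -/
lemma imitationPayoff_le_of_lt {v x : ℝ} (hx : c ≤ x) (hxv : x ≤ v) (hv : v < bHigh r μ m c) :
    imitationPayoff r μ m c v x ≤ imitationPayoff r μ m c v v := by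
  have hcv := hx.trans hxv
  have hv0 : 0 ≤ v := hc.1.trans hcv
  have hvv := lt_beta hm hr0 hF hc hc1 hcv hv
  have hpv := imitation_pos hm hr0 hF hc hc1 hv.le hvv
  rcases le_or_gt (beta r μ m c x) v with h | h
  · refine le_trans (mul_nonpos_of_nonpos_of_nonneg (mul_nonpos_of_nonpos_of_nonneg
      (sub_nonpos.2 h) (pow_nonneg (sub_nonneg.2 G_le_one) _)) (Real.exp_pos _).le)
      (mul_nonneg hpv.le (Real.exp_pos _).le)
  · refine mul_exp_le_of_log hpv (imitation_pos hm hr0 hF hc hc1 (hxv.trans hv.le) h) ?_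
    rw [cumHazard_sub hm hr0 hF hc hc1 hx hxv hv,
      ← integral_indiffHazard hm hr0 hF hc hc1 hv0 hx hxv hv h]
    refine setIntegral_mono_on ((hazard_integrableOn hm hr0 hF hc hc1 hv).mono_set
      (Ioc_subset_Icc_self.trans (Icc_subset_Icc_left hx)))
      (indiffHazard_integrableOn hm hr0 hF hc hc1 hv0 hx hxv hv h) measurableSet_Ioc fun t ht => ?_
    have htc := hx.trans ht.1.le
    have htB := ht.2.trans_lt hv
    have hvt : v < beta r μ m c t := h.trans (beta_strictMonoOn hm hr0 hF hc hc1 hx htc ht.1)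
    rw [hazard_eq hm hr0 hF hc hc1 htc htB, indiffHazard_eq hm hr0 hF hc hc1 htB.le hvt]
    exact ratio_mono (Nat.cast_nonneg m)
      (one_sub_G_pos_of_le_bHigh hm hr0 hF hc hc1 htB.le) (hc.1.trans htc) ht.2 hvt

/-- Above `v` the comparison of hazards is reversed. Allowing `v ≤ x` covers types below `c`, who
imitate `c`. -/
lemma imitationPayoff_le_of_gt {v x y : ℝ} (hv : 0 ≤ v) (hvx : v ≤ x) (hx : c ≤ x) (hxy : x ≤ y)
    (hy : y < bHigh r μ m c) :
    imitationPayoff r μ m c v y ≤ imitationPayoff r μ m c v x := by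
  have h : v < beta r μ m c x := hvx.trans_lt (lt_beta hm hr0 hF hc hc1 hx (hxy.trans_lt hy))
  have h' : v < beta r μ m c y :=
    (hvx.trans hxy).trans_lt (lt_beta hm hr0 hF hc hc1 (hx.trans hxy) hy)
  refine mul_exp_le_of_log (imitation_pos hm hr0 hF hc hc1 (hxy.trans hy.le) h)
    (imitation_pos hm hr0 hF hc hc1 hy.le h') ?_
  have h1 := cumHazard_sub hm hr0 hF hc hc1 hx hxy hy
  have h2 := integral_indiffHazard hm hr0 hF hc hc1 hv hx hxy hy h
  have h3 : ∫ t in Ioc x y, indiffHazard r μ m c v (G μ c t) ∂(cond μ (Ici c)) ≤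
      ∫ t in Ioc x y, hazard r μ m c t ∂(cond μ (Ici c)) := by
    refine setIntegral_mono_on (indiffHazard_integrableOn hm hr0 hF hc hc1 hv hx hxy hy h)
      ((hazard_integrableOn hm hr0 hF hc hc1 hy).mono_set
        (Ioc_subset_Icc_self.trans (Icc_subset_Icc_left hx))) measurableSet_Ioc fun t ht => ?_
    have htc := hx.trans ht.1.le
    have htB := ht.2.trans_lt hy
    have htt := lt_beta hm hr0 hF hc hc1 htc htB
    have hvt : v ≤ t := hvx.trans ht.1.le
    rw [hazard_eq hm hr0 hF hc hc1 htc htB,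
      indiffHazard_eq hm hr0 hF hc hc1 htB.le (hvt.trans_lt htt)]
    exact ratio_mono (Nat.cast_nonneg m)
      (one_sub_G_pos_of_le_bHigh hm hr0 hF hc hc1 htB.le) hv hvt htt
  linarith

lemma imitationPayoff_le {v x : ℝ} (hv : 0 ≤ v) (hvB : v < bHigh r μ m c)
    (hcB : c < bHigh r μ m c) (hx : c ≤ x) (hxB : x < bHigh r μ m c) :
    imitationPayoff r μ m c v x ≤ imitationPayoff r μ m c v (max v c) := by
  rcases le_total v c with h | h
  · rw [max_eq_right h]
    exact imitationPayoff_le_of_gt hm hr0 hF hc hc1 hv h le_rfl hx hxB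
  · rw [max_eq_left h]
    rcases le_total x v with h' | h'
    · exact imitationPayoff_le_of_lt hm hr0 hF hc hc1 hx h' hvB
    · exact imitationPayoff_le_of_gt hm hr0 hF hc hc1 hv le_rfl h h' hxB

end SpeculatorExplicit

/-! ### Optimality of `beta` and construction of the speculator's bid law. -/

section SpeculatorExplicit

variable {m : ℕ} {r c : ℝ} {μ : Measure ℝ} [IsProbabilityMeasure μ] [NullSingletonClass μ]
  (hm : 1 ≤ m) (hr0 : 0 < r) (hr1 : r ≤ 1) (hsupp : μ (Icc 0 1) = 1)
  (hF : StrictMonoOn (cdf μ) (Icc 0 r)) (hc : c ∈ Icc 0 r) (hc1 : cdf μ c < 1)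

/-- A speculator who loses ties. -/
lemma winSpec_zero {k : ℕ} {β ν : Measure ℝ} [IsProbabilityMeasure β] [IsProbabilityMeasure ν]
    (b : ℝ) : winSpec r (fun _ => 0) k β ν b = ν.real (Ici b) * winAlone r k β b := by
  rw [winSpec, winTied_zero, real_Ici_add, add_mul]

include hm hr0 hF hc hc1

lemma real_Ioi_eq_exp {ν : Measure ℝ} [IsProbabilityMeasure ν]
    (hν : ∀ b ∈ Ico (bLow r μ m c) (bHigh r μ m c), cdf ν b = Psi r μ m c b) {x : ℝ} (hx : c ≤ x)
    (hlt : x < bHigh r μ m c) :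
    ν.real (Ioi (beta r μ m c x)) = Real.exp (-cumHazard r μ m c x) := by
  have hB := (bHigh_mem (m := m) (μ := μ) hc).1
  have hb := beta_mem hm hr0 hF hc hc1 ⟨hx, hlt.le⟩
  have hbB : beta r μ m c x < bHigh r μ m c := by
    have := beta_strictMonoOn_Icc hm hr0 hF hc hc1 ⟨hx, hlt.le⟩ ⟨hB.1, le_rfl⟩ hlt
    rwa [beta_bHigh hm hr0 hF hc hc1] at this
  rw [real_Ioi_eq, hν _ ⟨hb.1, hbB⟩, Psi_beta hm hr0 hF hc hc1 ⟨hx, hlt.le⟩]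
  ring

include hr1 hsupp in
/-- No type gains by deviating from `beta` against the speculator. -/
lemma beta_optimal {κ : Kernel ℝ ℝ} [IsMarkovKernel κ]
    (hκ : ∀ᵐ v ∂(cond μ (Ici c)), κ v = Measure.dirac (beta r μ m c v)) {ν : Measure ℝ}
    [IsProbabilityMeasure ν] (hνs : ν (Icc (bLow r μ m c) (bHigh r μ m c)) = 1)
    (hν : ∀ b ∈ Ico (bLow r μ m c) (bHigh r μ m c), cdf ν b = Psi r μ m c b) {v : ℝ}
    (hv : v ∈ Icc (0 : ℝ) 1) (b : ℝ) :
    (b - v) * winSpec r (fun _ => 0) (m - 1) ((cond μ (Ici c)).bind κ) ν b ≤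
      (beta r μ m c (max v c) - v) *
        winSpec r (fun _ => 0) (m - 1) ((cond μ (Ici c)).bind κ) ν (beta r μ m c (max v c)) := by
  have := isProbabilityMeasure_belief hc1
  set β := (cond μ (Ici c)).bind κ with hβ
  set W := winSpec r (fun _ => 0) (m - 1) β ν with hW
  have hτ : ∀ k : ℕ, (fun _ : ℕ => (0 : ℝ)) k ∈ Icc (0 : ℝ) 1 := by simp
  have hB := (bHigh_mem (m := m) (μ := μ) hc).1
  have hmono := beta_strictMonoOn hm hr0 hF hc hc1
  have hW0 : ∀ b, 0 ≤ W b := winSpec_nonneg hτ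
  have hW1 : ∀ b, W b ≤ 1 := winSpec_le_one hτ
  have hQ : ∀ x, c ≤ x → x ≤ bHigh r μ m c →
      winAlone r (m - 1) β (beta r μ m c x) = (1 - G μ c x) ^ (m - 1) := fun x hx hxB => by
    rw [hβ, winAlone_strictMono hκ (ae_belief_mem hsupp) hmono hx
      ((beta_mem hm hr0 hF hc hc1 ⟨hx, hxB⟩).2.trans hB.2), belief_real_Ioi hc1 hx]
  have hνae : ∀ᵐ s ∂ν, s ∈ Icc (bLow r μ m c) (bHigh r μ m c) :=
    (mem_ae_iff_prob_eq_one measurableSet_Icc).2 hνs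
  have hge : 0 ≤ (beta r μ m c (max v c) - v) * W (beta r μ m c (max v c)) :=
    mul_nonneg (sub_nonneg.2 ((le_max_left _ _).trans
      (le_beta hm hr0 hF hc hc1 (le_max_right _ _)))) (hW0 _)
  rcases le_or_gt b v with hbv | hbv
  · exact (mul_nonpos_of_nonpos_of_nonneg (sub_nonpos.2 hbv) (hW0 b)).trans hge
  rcases lt_or_ge (bHigh r μ m c) b with hBb | hbB
  · have h0 : ν.real (Ici b) = 0 := by
      have h2 : ν (Ici b) = 0 := measure_eq_zero_iff_ae_notMem.2
        (hνae.mono fun s hs hs' => absurd (hs.2.trans_lt hBb) (not_lt.2 hs'))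
      rw [measureReal_def, h2]
      rfl
    have h1 : W b = 0 := le_antisymm (h0 ▸ winSpec_le_real hτ b) (hW0 b)
    rw [h1, mul_zero]
    exact hge
  -- If `c` already maximizes revenue, the speculator bids `c` for sure. Only bids up to `c` by
  -- types below `c` remain, and bidding `c` wins with certainty since the speculator loses ties.
  rcases hB.1.eq_or_lt with hcB | hcB
  · have hx₀ : max v c = c := max_eq_right (hbv.le.trans (hbB.trans hcB.ge))
    have hβc : beta r μ m c c = c := by
      conv_lhs => rw [hcB]
      rw [← hcB]
      have := beta_bHigh hm hr0 hF hc hc1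
      rwa [← hcB] at this
    have hWc : W c = 1 := by
      have h1 : ν.real (Ici c) = 1 := by
        have h2 := beta_lowest hm hr0 hF hc hc1
        rw [hβc] at h2
        have : ν (Ici c) = 1 := (mem_ae_iff_prob_eq_one measurableSet_Ici).1
          (hνae.mono fun s hs => h2.le.trans hs.1)
        rw [measureReal_def, this]
        rfl
      have h2 := hQ c le_rfl hB.1
      rw [hβc, G_self, sub_zero, one_pow] at h2
      rw [hW, winSpec_zero, h1, h2, one_mul]
    rw [hx₀, hβc, hWc, mul_one]
    have := hW1 b
    nlinarith
  have hvB := hbv.trans_le hbB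
  have hx₀B : max v c < bHigh r μ m c := max_lt hvB hcB
  have hC : imitationPayoff r μ m c v (max v c) ≤
      (beta r μ m c (max v c) - v) * W (beta r μ m c (max v c)) := by
    have h1 := le_winSpec (r := r) (k := m - 1) (β := β) (ν := ν) hτ (beta r μ m c (max v c))
    rw [real_Ioi_eq_exp hm hr0 hF hc hc1 hν (le_max_right _ _) hx₀B,
      hQ _ (le_max_right _ _) hx₀B.le] at h1
    unfold imitationPayoff imitation
    have h2 : 0 ≤ beta r μ m c (max v c) - v := sub_nonneg.2 ((le_max_left _ _).trans
      (le_beta hm hr0 hF hc hc1 (le_max_right _ _)))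
    calc _ = (beta r μ m c (max v c) - v) * (Real.exp (-cumHazard r μ m c (max v c)) *
          (1 - G μ c (max v c)) ^ (m - 1)) := by ring
      _ ≤ _ := mul_le_mul_of_nonneg_left h1 h2
  refine le_trans ?_ hC
  rcases le_or_gt b (bLow r μ m c) with hbL | hbL
  · have h1 := imitationPayoff_le hm hr0 hF hc hc1 hv.1 hvB hcB le_rfl hcB
    have h2 : imitationPayoff r μ m c v c = bLow r μ m c - v := by
      rw [imitationPayoff, imitation, beta_lowest hm hr0 hF hc hc1, cumHazard_lowest, G_self]
      simp
    have := hW1 b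
    nlinarith
  -- Bids `b'` just below `b` are bids of types below `bHigh` and beat the speculator at least as
  -- often as `b`. Passing to the limit covers `b = bHigh`, where he may have an atom.
  · have hT : Tendsto (fun b' => (b' - v) * W b) (𝓝[<] b) (𝓝 ((b - v) * W b)) :=
      (Continuous.tendsto (by fun_prop) b).mono_left nhdsWithin_le_nhds
    refine le_of_tendsto hT ?_
    filter_upwards [Ioo_mem_nhdsLT (max_lt hbv hbL)] with b' hb'
    have hb'v : v < b' := (le_max_left _ _).trans_lt hb'.1
    obtain ⟨x, hx, rfl⟩ := exists_beta_eq hm hr0 hF hc hc1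
      ⟨((le_max_right _ _).trans_lt hb'.1).le, hb'.2.le.trans hbB⟩
    have hxB : x < bHigh r μ m c := by
      refine lt_of_le_of_ne hx.2 fun h => ?_
      rw [h, beta_bHigh hm hr0 hF hc hc1] at hb'
      exact absurd hb'.2 (not_lt.2 hbB)
    refine le_trans ?_ (imitationPayoff_le hm hr0 hF hc hc1 hv.1 hvB hcB hx.1 hxB)
    have h1 : W b ≤ ν.real (Ioi (beta r μ m c x)) * winAlone r (m - 1) β (beta r μ m c x) :=
      (winSpec_le hτ b).trans (mul_le_mul (measureReal_mono (Ici_subset_Ioi.2 hb'.2))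
        (winAlone_antitone hb'.2.le) (winAlone_nonneg _) measureReal_nonneg)
    rw [real_Ioi_eq_exp hm hr0 hF hc hc1 hν hx.1 hxB, hQ x hx.1 hx.2] at h1
    unfold imitationPayoff imitation
    calc _ ≤ (beta r μ m c x - v) * (Real.exp (-cumHazard r μ m c x) *
          (1 - G μ c x) ^ (m - 1)) := mul_le_mul_of_nonneg_left h1 (sub_nonneg.2 hb'v.le)
      _ = _ := by ring

/-! #### Existence of the speculator's mixed strategy -/

lemma cumHazard_nonneg {x : ℝ} (hx : c ≤ x) (hlt : x < bHigh r μ m c) :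
    0 ≤ cumHazard r μ m c x := by
  have := cumHazard_mono hm hr0 hF hc hc1 le_rfl hx hlt
  rwa [cumHazard_lowest] at this

/-- Right continuity of the candidate distribution function, expressed in types instead of bids. -/
lemma exists_cumHazard_lt {x a : ℝ} (hx : c ≤ x) (hlt : x < bHigh r μ m c)
    (ha : 1 - Real.exp (-cumHazard r μ m c x) < a) :
    ∃ y, x < y ∧ y < bHigh r μ m c ∧ 1 - Real.exp (-cumHazard r μ m c y) < a := by
  obtain ⟨z, hxz, hz⟩ := exists_between hlt
  have hcont : ContinuousOn (fun x => 1 - Real.exp (-cumHazard r μ m c x)) (Icc c z) :=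
    continuousOn_const.sub (Real.continuous_exp.comp_continuousOn
      (intervalIntegral.continuousOn_primitive_Icc (hazard_integrableOn hm hr0 hF hc hc1 hz)).neg)
  have h1 : Tendsto (fun x => 1 - Real.exp (-cumHazard r μ m c x)) (𝓝[>] x)
      (𝓝 (1 - Real.exp (-cumHazard r μ m c x))) := by
    refine (hcont x ⟨hx, hxz.le⟩).mono_left ?_
    rw [← nhdsWithin_Ioo_eq_nhdsGT hxz]
    exact nhdsWithin_mono _ fun t ht => ⟨hx.trans ht.1.le, ht.2.le⟩
  obtain ⟨y, hy1, hy2⟩ := ((h1.eventually (gt_mem_nhds ha)).and (Ioo_mem_nhdsGT hxz)).exists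
  exact ⟨y, hy2.1, hy2.2.trans hz, hy1⟩

theorem exists_spec_law : ∃ ν : Measure ℝ, IsProbabilityMeasure ν ∧
    ν (Icc (bLow r μ m c) (bHigh r μ m c)) = 1 ∧
    ∀ b ∈ Ico (bLow r μ m c) (bHigh r μ m c), cdf ν b = Psi r μ m c b := by
  set L := bLow r μ m c with hL
  set B := bHigh r μ m c with hBdef
  have hLB : L ≤ B := bLow_le_bHigh hm hr0 hF hc hc1
  have hI := beta_strictMonoOn_Icc hm hr0 hF hc hc1
  have hB := (bHigh_mem (m := m) (μ := μ) hc).1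
  have hrep : ∀ b ∈ Ico L B, ∃ x, c ≤ x ∧ x < B ∧ beta r μ m c x = b ∧
      Psi r μ m c b = 1 - Real.exp (-cumHazard r μ m c x) := fun b hb => by
    obtain ⟨x, hx, rfl⟩ := exists_beta_eq hm hr0 hF hc hc1 ⟨hb.1, hb.2.le⟩
    refine ⟨x, hx.1, lt_of_le_of_ne hx.2 fun h => ?_, rfl, Psi_beta hm hr0 hF hc hc1 hx⟩
    rw [h, beta_bHigh hm hr0 hF hc hc1] at hb
    exact lt_irrefl _ hb.2
  have hPsi0 : ∀ b ∈ Ico L B, 0 ≤ Psi r μ m c b := fun b hb => by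
    obtain ⟨x, hx, hxB, -, h⟩ := hrep b hb
    rw [h, sub_nonneg, Real.exp_le_one_iff, neg_nonpos]
    exact cumHazard_nonneg hm hr0 hF hc hc1 hx hxB
  have hPsi1 : ∀ b ∈ Ico L B, Psi r μ m c b ≤ 1 := fun b hb => by
    obtain ⟨x, hx, hxB, -, h⟩ := hrep b hb
    rw [h]
    exact sub_le_self _ (Real.exp_pos _).le
  have hPsim : ∀ b ∈ Ico L B, ∀ b' ∈ Ico L B, b ≤ b' → Psi r μ m c b ≤ Psi r μ m c b' :=
    fun b hb b' hb' hle => by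
      obtain ⟨x, hx, hxB, hxb, h⟩ := hrep b hb
      obtain ⟨x', hx', hxB', hxb', h'⟩ := hrep b' hb'
      have hxx : x ≤ x' := (hI.le_iff_le ⟨hx, hxB.le⟩ ⟨hx', hxB'.le⟩).1 (by rwa [hxb, hxb'])
      rw [h, h']
      have := Real.exp_le_exp.2 (neg_le_neg (cumHazard_mono hm hr0 hF hc hc1 hx hxx hxB'))
      linarith
  -- The jump to 1 at `B` places the remaining probability there; for `L = B` the law is a point
  -- mass.
  set S : ℝ → ℝ := fun b => if b < L then 0 else if b < B then Psi r μ m c b else 1 with hS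
  have hSlow : ∀ b < L, S b = 0 := fun b hb => if_pos hb
  have hSmid : ∀ b ∈ Ico L B, S b = Psi r μ m c b := fun b hb => by
    simp only [hS, if_neg (not_lt.2 hb.1), if_pos hb.2]
  have hShigh : ∀ b, B ≤ b → S b = 1 := fun b hb => by
    simp only [hS, if_neg (not_lt.2 (hLB.trans hb)), if_neg (not_lt.2 hb)]
  have hS01 : ∀ b, S b ∈ Icc (0 : ℝ) 1 := fun b => by
    rcases lt_or_ge b L with h | h
    · rw [hSlow b h]; exact ⟨le_rfl, zero_le_one⟩
    rcases lt_or_ge b B with h' | h'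
    · rw [hSmid b ⟨h, h'⟩]; exact ⟨hPsi0 b ⟨h, h'⟩, hPsi1 b ⟨h, h'⟩⟩
    · rw [hShigh b h']; exact ⟨zero_le_one, le_rfl⟩
  have hSmono : Monotone S := fun b b' hle => by
    rcases lt_or_ge b L with h | h
    · rw [hSlow b h]; exact (hS01 b').1
    rcases lt_or_ge b' B with h' | h'
    · rw [hSmid b ⟨h, hle.trans_lt h'⟩, hSmid b' ⟨h.trans hle, h'⟩]
      exact hPsim _ ⟨h, hle.trans_lt h'⟩ _ ⟨h.trans hle, h'⟩ hle
    · rw [hShigh b' h']; exact (hS01 b).2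
  have hSright : ∀ b, ContinuousWithinAt S (Ici b) b := fun b => by
    rw [ContinuousWithinAt, tendsto_order]
    refine ⟨fun a ha => ?_, fun a ha => ?_⟩
    · filter_upwards [self_mem_nhdsWithin] with t ht using ha.trans_le (hSmono ht)
    · suffices h : ∃ b' > b, S b' < a by
        obtain ⟨b', hb', hlt⟩ := h
        filter_upwards [Ico_mem_nhdsGE hb'] with t ht using (hSmono ht.2.le).trans_lt hlt
      rcases lt_or_ge b L with h | h
      · obtain ⟨b', h1, h2⟩ := exists_between h
        exact ⟨b', h1, by rw [hSlow b' h2, ← hSlow b h]; exact ha⟩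
      rcases lt_or_ge b B with h' | h'
      · obtain ⟨x, hx, hxB, hxb, hP⟩ := hrep b ⟨h, h'⟩
        rw [hSmid b ⟨h, h'⟩, hP] at ha
        obtain ⟨y, hxy, hyB, hya⟩ := exists_cumHazard_lt hm hr0 hF hc hc1 hx hxB ha
        have hcy := hx.trans hxy.le
        have hlt := hI ⟨hx, hxB.le⟩ ⟨hcy, hyB.le⟩ hxy
        have hltB := hI ⟨hcy, hyB.le⟩ ⟨hB.1, le_rfl⟩ hyB
        rw [beta_bHigh hm hr0 hF hc hc1] at hltB
        rw [hxb] at hlt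
        refine ⟨beta r μ m c y, hlt, ?_⟩
        rw [hSmid _ ⟨h.trans hlt.le, hltB⟩, Psi_beta hm hr0 hF hc hc1 ⟨hcy, hyB.le⟩]
        exact hya
      · exact ⟨b + 1, lt_add_one b, by
          rw [hShigh _ (h'.trans (le_add_of_nonneg_right zero_le_one)), ← hShigh b h']; exact ha⟩
  let f : StieltjesFunction ℝ := ⟨S, hSmono, hSright⟩
  have hbot : Tendsto f atBot (𝓝 0) := tendsto_const_nhds.congr' (by
    filter_upwards [Iio_mem_atBot L] with b hb using (hSlow b hb).symm)
  have htop : Tendsto f atTop (𝓝 1) := tendsto_const_nhds.congr' (by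
    filter_upwards [Ici_mem_atTop B] with b hb using (hShigh b hb).symm)
  refine ⟨f.measure, f.isProbabilityMeasure hbot htop, ?_, fun b hb => ?_⟩
  -- The mass of the closed interval is computed with the left limit at `L`, so an atom at `L` is
  -- included when `L = B`.
  · have hleft : Function.leftLim f L = 0 := by
      refine leftLim_eq_of_tendsto (tendsto_const_nhds.congr' ?_)
      filter_upwards [self_mem_nhdsWithin] with b hb using (hSlow b hb).symm
    rw [f.measure_Icc, hleft, show f B = 1 from hShigh B le_rfl]
    simp
  · rw [cdf_measure_stieltjesFunction f hbot htop]
    exact hSmid b hb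

end SpeculatorExplicit

/-! ### The explicit equilibrium -/

section Explicit

variable {N : ℕ} {r p c : ℝ} {μ : Measure ℝ} [IsProbabilityMeasure μ] [NullSingletonClass μ]
  {σ : Profile}
  (hN : 2 ≤ N) (hr0 : 0 < r) (hr1 : r ≤ 1) (hsupp : μ (Icc 0 1) = 1)
  (hF : StrictMonoOn (cdf μ) (Icc 0 r)) (hc : c ∈ Icc 0 r) (hc1 : cdf μ c < 1)

lemma measurable_beta (r : ℝ) (m : ℕ) (c : ℝ) : Measurable (beta r μ m c) := by
  have hG : Measurable (G μ c) := continuous_G.measurable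
  unfold beta
  refine Measurable.ite measurableSet_Iic ?_ measurable_id
  fun_prop

lemma measurable_betaSym (N : ℕ) (r c : ℝ) : Measurable (betaSym N r μ c) := by
  have hG : Measurable (G μ c) := continuous_G.measurable
  have hcont := continuous_surplus (μ := μ) N c
  have hint : Measurable fun v => ∫ x in v..r, (1 - G μ c x) ^ (N - 1) := by
    have : (fun v => ∫ x in v..r, (1 - G μ c x) ^ (N - 1)) =
        fun v => -∫ x in r..v, (1 - G μ c x) ^ (N - 1) :=
      funext fun v => intervalIntegral.integral_symm r v
    rw [this]
    exact (intervalIntegral.continuous_primitive (fun a b => hcont.intervalIntegrable a b)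
      r).neg.measurable
  unfold betaSym
  refine Measurable.ite measurableSet_Iic ?_ measurable_id
  exact measurable_id.add (hint.div (by fun_prop))

include hr0 hF hc hc1 in
theorem exists_isCutoffProfile : ∃ σ : Profile, IsCutoffProfile N r μ σ c := by
  have hlaw := fun m : ℕ => fun hm : 1 ≤ m => exists_spec_law (m := m) hm hr0 hF hc hc1
  choose! ν hν using hlaw
  have hm1 : Measurable fun v : ℝ => max v c := measurable_id.max measurable_const
  refine ⟨⟨fun v => if v < c then 1 else 0,
    fun m => if m = N then Kernel.deterministic (fun v => betaSym N r μ c (max v c))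
        ((measurable_betaSym N r c).comp hm1)
      else Kernel.deterministic (fun v => beta r μ m c (max v c)) ((measurable_beta r m c).comp hm1),
    fun m => if m = 0 then Measure.dirac r else ν m⟩, ?_⟩
  refine
    { accept_measurable := Measurable.ite measurableSet_Iio measurable_const measurable_const
      accept_eq := fun v _ => rfl
      bid_markov := fun m _ => ?_
      bid_spec := fun m hm v _ => ?_
      bid_sym := fun v _ => ?_
      spec_zero := by simp only [if_true]
      spec_prob := fun m _ => ?_
      spec_supp := fun m hm => ?_
      spec_cdf := fun m hm b hb => ?_ }
  · dsimp only
    split_ifs <;> infer_instance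
  · simp only [if_neg hm.2.ne, Kernel.deterministic_apply]
  · simp only [if_true, Kernel.deterministic_apply]
  · dsimp only
    split_ifs with h
    · infer_instance
    · exact (hν m (Nat.one_le_iff_ne_zero.2 h)).1
  · simp only [if_neg (show m ≠ 0 from Nat.one_le_iff_ne_zero.1 hm.1)]
    exact (hν m hm.1).2.1
  · simp only [if_neg (show m ≠ 0 from Nat.one_le_iff_ne_zero.1 hm.1)]
    exact (hν m hm.1).2.2 b hb

variable (hσ : IsCutoffProfile N r μ σ c)
include hN hr0 hr1 hsupp hF hc hc1 hσ

lemma IsCutoffProfile.undominatedBidding : UndominatedBidding N σ := by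
  constructor
  · intro m hm v hv
    rcases hm.2.lt_or_eq with hlt | rfl
    · rw [hσ.bid_spec m ⟨hm.1, hlt⟩ v hv, Measure.dirac_apply' _ measurableSet_Iio,
        indicator_of_notMem]
      exact not_lt.2 ((le_max_left v c).trans (le_beta hm.1 hr0 hF hc hc1 (le_max_right v c)))
    · rw [hσ.bid_sym v hv, Measure.dirac_apply' _ measurableSet_Iio, indicator_of_notMem]
      exact not_lt.2 ((le_max_left v c).trans (le_betaSym _))
  · intro m hm
    rcases Nat.eq_zero_or_pos m with rfl | hm0
    · rw [hσ.spec_zero, Measure.dirac_apply' _ measurableSet_Iio, indicator_of_notMem]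
      exact not_lt.2 hr0.le
    · have := hσ.spec_prob m hm
      have hae : ∀ᵐ s ∂(σ.spec m), s ∈ Icc (bLow r μ m c) (bHigh r μ m c) :=
        (mem_ae_iff_prob_eq_one measurableSet_Icc).2 (hσ.spec_supp m ⟨hm0, hm⟩)
      exact measure_eq_zero_iff_ae_notMem.2 (hae.mono fun s hs hs' =>
        absurd ((hc.1.trans (le_bLow hc.1 hc.2)).trans hs.1) (not_le.2 hs'))

lemma IsCutoffProfile.biddingEquilibrium :
    BiddingEquilibrium N r (fun _ => 0) σ fun _ => cond μ (Ici c) := by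
  have hprob := isProbabilityMeasure_belief hc1
  have hmemH : ∀ᵐ v ∂(cond μ (Ici c)), v ∈ Icc c 1 := ae_belief_mem hsupp
  refine ⟨by simp, hσ.bid_markov, hσ.spec_prob, fun m hm => hprob, fun m hm v hv b => ?_,
    fun m hm b => ?_, hσ.undominatedBidding hN hr0 hr1 hsupp hF hc hc1⟩
  · have := hσ.bid_markov m hm
    unfold sellerValue sellerPayoff
    rcases hm.2.lt_or_eq with hlt | rfl
    · have := hσ.spec_prob m hlt
      have hκ : ∀ᵐ v ∂(cond μ (Ici c)), σ.bid m v = Measure.dirac (beta r μ m c v) :=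
        hmemH.mono fun v hv => by
          rw [hσ.bid_spec m ⟨hm.1, hlt⟩ v ⟨hc.1.trans hv.1, hv.2⟩, max_eq_left hv.1]
      rw [hσ.bid_spec m ⟨hm.1, hlt⟩ v hv, integral_dirac, sellerWin_of_lt hlt, sellerWin_of_lt hlt]
      exact beta_optimal hm.1 hr0 hr1 hsupp hF hc hc1 hκ (hσ.spec_supp m ⟨hm.1, hlt⟩)
        (hσ.spec_cdf m ⟨hm.1, hlt⟩) hv b
    · have hκ : ∀ᵐ v ∂(cond μ (Ici c)), σ.bid m v = Measure.dirac (betaSym m r μ c v) :=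
        hmemH.mono fun v hv => by
          rw [hσ.bid_sym v ⟨hc.1.trans hv.1, hv.2⟩, max_eq_left hv.1]
      rw [hσ.bid_sym v hv, integral_dirac, sellerWin_self, sellerWin_self]
      exact betaSym_optimal hN hr1 hsupp hF hc hc1 hκ hv b
  · rcases Nat.eq_zero_or_pos m with rfl | hm0
    · have hval : ∀ s, specPayoff r (fun _ => 0) σ (fun _ => cond μ (Ici c)) 0 s =
          s * if s ≤ r then 1 else 0 := fun s => by
        unfold specPayoff
        rw [Measure.pi_of_empty _ finZeroElim, integral_dirac]
        simp [specShare]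
      rw [hσ.spec_zero, integral_dirac, hval, hval, if_pos le_rfl]
      split_ifs with h
      · linarith
      · linarith
    · have hmN : m ∈ Icc 1 N := ⟨hm0, hm.le⟩
      have := hσ.bid_markov m hmN
      have := hσ.spec_prob m hm
      have hκ : ∀ᵐ v ∂(cond μ (Ici c)), σ.bid m v = Measure.dirac (beta r μ m c v) :=
        hmemH.mono fun v hv => by
          rw [hσ.bid_spec m ⟨hm0, hm⟩ v ⟨hc.1.trans hv.1, hv.2⟩, max_eq_left hv.1]
      have hae : ∀ᵐ s ∂(σ.spec m), s ∈ Icc (bLow r μ m c) (bHigh r μ m c) :=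
        (mem_ae_iff_prob_eq_one measurableSet_Icc).2 (hσ.spec_supp m ⟨hm0, hm⟩)
      have hval : ∫ s, specPayoff r (fun _ => 0) σ (fun _ => cond μ (Ici c)) m s ∂(σ.spec m) =
          bLow r μ m c := by
        have h1 : specPayoff r (fun _ => 0) σ (fun _ => cond μ (Ici c)) m =ᵐ[σ.spec m]
            fun _ => bLow r μ m c :=
          hae.mono fun s hs => specPayoff_of_mem hm0 hr0 hsupp hF hc hc1 hκ hs
        rw [integral_congr_ae h1]
        simp
      rw [hval]
      exact specPayoff_le_bLow hm0 hr0 hsupp hF hc hc1 hκ b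

/-- The gain from accepting is decreasing in the value, so its sign at `c` decides for all types. It
is zero by the indifference condition if `p` exceeds `piZero`; otherwise `c = 0`, the gain there is
at most zero, and no type lies below. -/
theorem IsCutoffProfile.isSymmetricPBE (hcut : IsCutoff N r p μ c) :
    IsSymmetricPBE N r p μ (fun _ => 0) σ fun _ => cond μ (Ici c) := by
  have hB := hσ.biddingEquilibrium hN hr0 hr1 hsupp hF hc hc1
  have hprob := isProbabilityMeasure_belief hc1
  have hmem : ∀ᵐ v ∂μ, v ∈ Icc (0 : ℝ) 1 := (mem_ae_iff_prob_eq_one measurableSet_Icc).2 hsupp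
  have hae : ∀ᵐ v ∂μ, σ.accept v = if v < c then 1 else 0 := hmem.mono hσ.accept_eq
  have hmemA : ∀ v ∈ Icc (0 : ℝ) 1, σ.accept v ∈ Icc (0 : ℝ) 1 := fun v hv => by
    rw [hσ.accept_eq v hv]
    split_ifs <;> simp
  have hacc := accProb_of_cutoff hae
  have hrej := rejProb_eq hσ.accept_measurable (hmem.mono hmemA)
  have hacc' : accProb μ σ = 1 - rejProb μ σ := by linarith
  have hrejm : rejProb μ σ ∈ Icc (0 : ℝ) 1 := by
    rw [hrej, hacc]
    exact ⟨sub_nonneg.2 (cdf_le_one μ c), sub_le_self _ (cdf_nonneg μ c)⟩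
  have hprice := hB.rejectValue_cutoff (c := c) (μ := μ) hN hr1 hsupp hF hc hc1
    (by rw [hrej, hacc]) hacc fun _ _ _ => rfl
  have hc01 : c ∈ Icc (0 : ℝ) 1 := ⟨hc.1, hc.2.trans hr1⟩
  have hhigh : p - c - rejectValue N r μ (fun _ => 0) σ (fun _ => cond μ (Ici c)) c ≤ 0 := by
    rcases le_or_gt p (piZero N r μ) with h | h
    · have h0 := hcut.2.1 h
      subst h0
      rw [cutoffPrice_zero hN (cdf_zero_eq_zero hsupp)] at hprice
      linarith
    · have := indifference_iff.1 (hcut.2.2 h)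
      linarith
  have hlow : 0 < c → 0 ≤ p - c - rejectValue N r μ (fun _ => 0) σ (fun _ => cond μ (Ici c)) c := by
    intro hpos
    rcases le_or_gt p (piZero N r μ) with h | h
    · exact absurd (hcut.2.1 h) hpos.ne'
    · have := indifference_iff.1 (hcut.2.2 h)
      linarith
  refine ⟨hσ.accept_measurable, hmemA, hσ.bid_markov, hσ.spec_prob, fun _ _ => hprob, fun m hm => ?_,
    fun m hm _ _ => (posterior_of_cutoff hae).symm, hB.bid_optimal, hB.spec_optimal,
    fun v hv a ha => ?_⟩
  · exact (mem_ae_iff_prob_eq_one measurableSet_Icc).1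
      ((ae_belief_mem hsupp).mono fun v hv => ⟨hc.1.trans hv.1, hv.2⟩)
  · rw [hσ.accept_eq v hv]
    split_ifs with h
    · have h1 := hB.rejectValue_sub_le_sub (μ := μ) hN hrejm hacc' hv hc01 h.le
      have h2 := hlow (hv.1.trans_lt h)
      nlinarith [ha.2]
    · push Not at h
      have h1 := hB.rejectValue_sub_le_sub (μ := μ) hN hrejm hacc' hc01 hv h
      nlinarith [ha.1]

end Explicit

end FPASpeculation

end

theorem mainTheorem5
    (N : ℕ) (hN : 2 ≤ N) (r : ℝ) (hr0 : 0 < r) (hr1 : r ≤ 1)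
    (μ : Measure ℝ) [IsProbabilityMeasure μ] (hsupp : μ (Icc 0 1) = 1)
    (hdens : μ ≪ volume) (hF : StrictMonoOn (cdf μ) (Icc 0 r))
    (p : ℝ) (hp : p ∈ Icc 0 r) :
    ∃ c : ℝ,
      -- the cutoff is well defined
      (FPASpeculation.IsCutoff N r p μ c ∧
        ∀ c' : ℝ, FPASpeculation.IsCutoff N r p μ c' → c' = c) ∧
      -- (i) every symmetric equilibrium uses it, whatever the tie-breaking rule
      (∀ τ : ℕ → ℝ, (∀ k, τ k ∈ Icc (0 : ℝ) 1) →
        ∀ (σ : FPASpeculation.Profile) (bel : ℕ → Measure ℝ),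
          FPASpeculation.IsSymmetricPBE N r p μ τ σ bel →
          FPASpeculation.UndominatedBidding N σ →
          ∀ᵐ v ∂μ, σ.accept v = if v < c then 1 else 0) ∧
      -- (ii) the explicit profile exists and is an equilibrium (the speculator loses ties)
      (cdf μ c < 1 →
        (∃ σ : FPASpeculation.Profile, FPASpeculation.IsCutoffProfile N r μ σ c) ∧
        ∀ σ : FPASpeculation.Profile, FPASpeculation.IsCutoffProfile N r μ σ c →
          FPASpeculation.IsSymmetricPBE N r p μ (fun _ => 0) σ (fun _ => cond μ (Ici c)) ∧
          FPASpeculation.UndominatedBidding N σ) := by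
  -- The density enters only through the absence of atoms.
  have : NullSingletonClass μ := ⟨fun x => hdens (measure_singleton x)⟩
  obtain ⟨c, hc, huniq⟩ := FPASpeculation.exists_unique_cutoff hN hr0 hF
    (FPASpeculation.cdf_zero_eq_zero hsupp) hp
  refine ⟨c, ⟨hc, huniq⟩, fun τ hτ σ bel hσ hu => ?_, fun hc1 =>
    ⟨FPASpeculation.exists_isCutoffProfile hr0 hF hc.1 hc1, fun σ hσ =>
      ⟨hσ.isSymmetricPBE hN hr0 hr1 hsupp hF hc.1 hc1 hc,
        hσ.undominatedBidding hN hr0 hr1 hsupp hF hc.1 hc1⟩⟩⟩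
  obtain ⟨c', hc', hae⟩ :=
    FPASpeculation.exists_cutoff_of_isSymmetricPBE hN hr0 hr1 hsupp hF hp hτ hσ hu
  rwa [huniq c' hc'] at hae
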